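/- **Setting.** Let $\Gamma$ be a finite graph (a finite one-dimensional CW complex; loops and multiple edges are allowed, $\Gamma$ need not be connected), each of whose edges is identified with $[0,1]$. Let $V$ and $E$ be its sets of vertices and edges. A half-edge $h$ is an edge $e(h)$ together with one of its two ends; $v(h)$ is the vertex at that end. Let $T\subseteq\Gamma$ be a subgraph that is a (nonempty) tree, let $\varepsilon>0$, and let $U\subseteq \Gamma$ be the open $\varepsilon$-neighborhood of $T$. Assume $\varepsilon\le 1/2$, and $\varepsilon<1/2$ if some edge not in $T$ has both of its ends in $T$. Let $\Gamma/T$ be the graph obtained by contracting $T$ to a vertex $[T]$, and let $U/T\subseteq\Gamma/T$ be the image of $U$. For a space $X$, $W\subseteq X$ and $n,k\ge 0$ let $Conf_n(X)$ be the space of ordered configurations of $n$ distinct points in $X$ and $Conf_{n,k}(X,W)$ the subspace of those configurations of which at most $k$ points lie in $W$; let $UConf_n(X)$ and $UConf_{n,k}(X,W)$ be their quotients by the symmetric group $S_n$. **The Świątkowski complex.** Let $S(v)$ be the free abelian group with basis $\emptyset$, $v$ and the half-edges $h$ with $v(h)=v$, let $S(\Gamma)=\mathbb Z[E]\otimes\bigotimes_{v\in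 V}S(v)$ with the half-edges in degree $1$ and all other generators in degree $0$, let $\partial h=e(h)-v(h)$, extended as a $\mathbb Z[E]$-linear derivation (with Koszul signs for a fixed order of the vertices; in $\Gamma/T$ the vertex $[T]$ comes first and the others are ordered as in $\Gamma$). Edges, vertices and half-edges have weight $1$; $S_{*,n}(\Gamma)$ is the part of weight $n$. The reduced complex $\widetilde S(\Gamma)=\mathbb Z[E]\otimes\bigotimes_v\widetilde S(v)$ is the subcomplex with $\widetilde S(v)\subseteq S(v)$ spanned by $\emptyset$ and the differences $h-h'$ of half-edges at $v$. The comparison map $\kappa_\Gamma: S_{*,n}(\Gamma)\to C_*(UConf_n(\Gamma);\mathbb Z)$ to singular chains sends a generator of degree $k$ to the standard triangulation of the following $k$-cube of configurations, whose coordinates $t_v$ are indexed by the vertices $v$ with an active half-edge: there is a point at every occupied vertex; on each edge $e$ there are as many points as the exponent of $e$ plus the number of active half-edges of $e$, such that the gaps between consecutive points are equal, and the gap at either end of $e$ has, relative to these, length $t_v$ if the half-edge of $e$ at that end is active (and $v$ is its vertex), and length $1$ otherwise. **The contraction.** For a vertex $r$ of $T$ let $\gamma_r: S(\Gamma/T)\to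 S(\Gamma)$ be the $\mathbb Z[E\setminus E(T)]$-linear map that is the identity on $S(v)$ for $v\notin T$ and is given on $S([T])$ by $\emptyset\mapsto\emptyset$, $[T]\mapsto r$ and $$h\longmapsto h+\sum_{i=1}^m(h_i-\bar h_i),$$ where $h_1,\dots,h_m$ are the half-edges by which the reduced edge path in $T$ from $r$ to $v(h)$ leaves the vertices that it passes, and $\bar h_i$ is the other half of the edge of $h_i$. This is a chain map that preserves weights. Thus $h-h'$, for half-edges at $[T]$, is sent, up to cancelling terms, to the sum over the vertices $w$ on the path in $T$ from $v(h)$ to $v(h')$ of the difference of the half-edges at $w$ by which the path $h$, (path in $T$), $h'$ arrives at and leaves $w$; this is the An–Drummond-Cole–Knudsen contraction map on reduced complexes. **Theorem.** In this setting, for every $n\ge 0$: 1. There is a continuous map $f:\Gamma/T\to\Gamma$ that maps $U/T$ into $U$ and fixes all points outside (that is, $f$ sends the image in $\Gamma/T$ of each $x\in\Gamma\setminus U$ to $x$). 2. For all vertices $r,r'$ of $T$, the map $\gamma_r$ maps $\widetilde S(\Gamma/T)$ into $\widetilde S(\Gamma)$, and $\gamma_r=\gamma_{r'}$ on $\widetilde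 S(\Gamma/T)$. 3. The inclusions $Conf_{n,1}(\Gamma/T,U/T)\hookrightarrow Conf_n(\Gamma/T)$ and $UConf_{n,1}(\Gamma/T,U/T)\hookrightarrow UConf_n(\Gamma/T)$ are homotopy equivalences. 4. For every $f$ as in 1, applying $f$ to each point of a configuration defines homotopy equivalences $Conf_{n,1}(\Gamma/T,U/T)\to Conf_{n,1}(\Gamma,U)$ and $UConf_{n,1}(\Gamma/T,U/T)\to UConf_{n,1}(\Gamma,U)$. 5. For every $f$ as in 1, let $\Phi:UConf_n(\Gamma/T)\to UConf_n(\Gamma)$ be a map given by the span $$UConf_n(\Gamma/T)\ \xleftarrow{\ \simeq\ }\ UConf_{n,1}(\Gamma/T,U/T)\ \xrightarrow{\ \simeq\ }\ UConf_{n,1}(\Gamma,U)\ \hookrightarrow\ UConf_n(\Gamma),$$ i.e. the composite of a homotopy inverse of the inclusion in 3, the map in 4 and the inclusion. Then $\Phi$ realizes the contraction on homology: for every vertex $r$ of $T$ and every $k$, $$\Phi_*\circ(\kappa_{\Gamma/T})_*=(\kappa_\Gamma)_*\circ(\gamma_r)_*:\ H_k(S_{*,n}(\Gamma/T))\longrightarrow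 H_k(UConf_n(\Gamma);\mathbb Z).$$ -/

import Mathlib

open CategoryTheory

namespace SubtreeContraction
noncomputable section

set_option linter.unusedSectionVars false

/-! ### Singular chains of cubes -/

/-- The singular chain complex of `X` with integer coefficients. -/
abbrev singChains (X : TopCat.{0}) : ChainComplex (ModuleCat.{0} ℤ) ℕ :=
  ((AlgebraicTopology.singularChainComplexFunctor (ModuleCat.{0} ℤ)).obj (ModuleCat.of ℤ ℤ)).obj X

/-- The generator of the singular chain group given by a singular simplex. -/
def simplexChain {X : TopCat.{0}} {k : ℕ} (s : C(stdSimplex ℝ (Fin (k + 1)), X)) :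
    (singChains X).X k :=
  ((TopCat.toSSet.obj X).ιChainComplex (R := ModuleCat.of ℤ ℤ)
    ((X.toSSetObjEquiv (.op (SimplexCategory.mk k))).symm s)).hom (1 : ℤ)

/-- The `j`-th face inclusion of the standard simplex. -/
def simplexFace {k : ℕ} (j : Fin (k + 2)) :
    C(stdSimplex ℝ (Fin (k + 1)), stdSimplex ℝ (Fin (k + 2))) :=
  ⟨stdSimplex.map j.succAbove, stdSimplex.continuous_map _⟩

theorem simplexChain_d {X : TopCat.{0}} {k : ℕ} (s : C(stdSimplex ℝ (Fin (k + 2)), X)) :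
    ((singChains X).d (k + 1) k).hom (simplexChain s) =
      ∑ j : Fin (k + 2), (-1 : ℤ) ^ (j : ℕ) • simplexChain (s.comp (simplexFace j)) := by
  have h := (TopCat.toSSet.obj X).ιChainComplex_d (R := ModuleCat.of ℤ ℤ)
    ((X.toSSetObjEquiv (.op (SimplexCategory.mk (k + 1)))).symm s)
  have h2 := congrArg (fun f => f.hom (1 : ℤ)) h
  simp only [ModuleCat.hom_comp, LinearMap.comp_apply, ModuleCat.hom_sum, LinearMap.sum_apply] at h2
  refine h2.trans (Finset.sum_congr rfl fun j _ => ?_)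
  rfl

/-- The simplex of the standard triangulation of the cube belonging to a permutation `σ`:
its `j`-th vertex is `e_{σ 0} + ⋯ + e_{σ (j - 1)}`. -/
def cubeSimplex {k : ℕ} (σ : Equiv.Perm (Fin k)) : C(stdSimplex ℝ (Fin (k + 1)), Fin k → unitInterval) where
  toFun x i := ⟨∑ l with (σ.symm i).castSucc < l, x l,
    Finset.sum_nonneg fun l _ => stdSimplex.zero_le x l,
    (Finset.sum_le_sum_of_subset_of_nonneg (Finset.subset_univ _)
      fun l _ _ => stdSimplex.zero_le x l).trans (stdSimplex.sum_eq_one x).le⟩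
  continuous_toFun := by
    refine continuous_pi fun i => Continuous.subtype_mk ?_ _
    refine continuous_finsetSum _ fun l _ => ?_
    exact (continuous_apply l).comp continuous_subtype_val

/-- The singular chain of a singular cube: the signed sum of its restrictions to the simplices of
the standard triangulation of the cube. -/
def cubeChain {X : TopCat.{0}} {k : ℕ} (c : C(Fin k → unitInterval, X)) : (singChains X).X k :=
  ∑ σ : Equiv.Perm (Fin k), (Equiv.Perm.sign σ : ℤ) • simplexChain (c.comp (cubeSimplex σ))

/-- The inclusion of the face of the cube on which the `i`-th coordinate is `a`. -/
def cubeFace {k : ℕ} (i : Fin (k + 1)) (a : unitInterval) : C(Fin k → unitInterval, Fin (k + 1) → unitInterval) :=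
  ⟨fun t => i.insertNth a t, by fun_prop⟩

theorem cubeSimplex_face {k : ℕ} (σ : Equiv.Perm (Fin (k + 1))) (j : Fin (k + 2))
    (x : stdSimplex ℝ (Fin (k + 1))) (m : Fin (k + 1)) :
    ((cubeSimplex σ (simplexFace j x) (σ m) : unitInterval) : ℝ)
      = ∑ l with m.castSucc < j.succAbove l, x l := by
  simp only [cubeSimplex, simplexFace, ContinuousMap.coe_mk, Equiv.symm_apply_apply,
    stdSimplex.map_coe, FunOnFinite.linearMap_apply_apply]
  classical
  convert Finset.sum_fiberwise_eq_sum_filter Finset.univ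
    (Finset.univ.filter fun l => m.castSucc < l) j.succAbove (fun l => x l) using 2
  simp

/-- The permutation with `0 ↦ i` and `m + 1 ↦ i.succAbove (ρ m)`. -/
def consPerm {k : ℕ} (p : Fin (k + 1) × Equiv.Perm (Fin k)) : Equiv.Perm (Fin (k + 1)) :=
  p.1.cycleRange.symm * Equiv.Perm.decomposeFin.symm (0, p.2)

theorem consPerm_zero {k : ℕ} (p : Fin (k + 1) × Equiv.Perm (Fin k)) : consPerm p 0 = p.1 := by
  simp [consPerm]

theorem consPerm_succ {k : ℕ} (p : Fin (k + 1) × Equiv.Perm (Fin k)) (m : Fin k) :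
    consPerm p m.succ = p.1.succAbove (p.2 m) := by
  simp [consPerm]

theorem sign_consPerm {k : ℕ} (p : Fin (k + 1) × Equiv.Perm (Fin k)) :
    ((Equiv.Perm.sign (consPerm p) : ℤˣ) : ℤ) = (-1) ^ (p.1 : ℕ) * (Equiv.Perm.sign p.2 : ℤˣ) := by
  simp [consPerm, Equiv.Perm.decomposeFin.symm_sign]

theorem consPerm_bijective {k : ℕ} :
    Function.Bijective (consPerm : Fin (k + 1) × Equiv.Perm (Fin k) → _) := by
  rw [Fintype.bijective_iff_injective_and_card]
  constructor
  · rintro ⟨i, ρ⟩ ⟨i', ρ'⟩ h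
    have h0 : i = i' := by simpa [consPerm_zero] using congrArg (fun σ => σ 0) h
    subst h0
    refine Prod.ext rfl (Equiv.ext fun m => ?_)
    simpa [consPerm_succ] using congrArg (fun σ => σ m.succ) h
  · simp [Fintype.card_perm, Nat.factorial_succ]

theorem cubeSimplex_face_zero {k : ℕ} (p : Fin (k + 1) × Equiv.Perm (Fin k)) :
    (cubeSimplex (consPerm p)).comp (simplexFace 0) = (cubeFace p.1 1).comp (cubeSimplex p.2) := by
  ext x i
  obtain ⟨m, rfl⟩ := (consPerm p).surjective i
  refine (cubeSimplex_face _ _ _ _).trans ?_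
  refine Fin.cases ?_ (fun m => ?_) m
  · rw [consPerm_zero]
    simp [cubeFace]
  · rw [consPerm_succ]
    simp only [cubeFace, ContinuousMap.comp_apply, ContinuousMap.coe_mk,
      Fin.insertNth_apply_succAbove]
    simp [cubeSimplex, Fin.lt_def]

theorem cubeSimplex_face_last {k : ℕ} (p : Fin (k + 1) × Equiv.Perm (Fin k)) :
    (cubeSimplex (consPerm p * finRotate (k + 1))).comp (simplexFace (Fin.last _)) =
      (cubeFace p.1 0).comp (cubeSimplex p.2) := by
  ext x i
  obtain ⟨m, rfl⟩ := (consPerm p * finRotate (k + 1)).surjective i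
  refine (cubeSimplex_face _ _ _ _).trans ?_
  refine Fin.lastCases ?_ (fun m => ?_) m
  · rw [Equiv.Perm.mul_apply, finRotate_last, consPerm_zero]
    simp [cubeFace, Fin.lt_def]
    refine Finset.sum_eq_zero fun l hl => ?_
    simp at hl; omega
  · have : finRotate (k + 1) m.castSucc = m.succ := by
      rw [finRotate_apply, Fin.coeSucc_eq_succ]
    rw [Equiv.Perm.mul_apply, this, consPerm_succ]
    simp only [cubeFace, ContinuousMap.comp_apply, ContinuousMap.coe_mk,
      Fin.insertNth_apply_succAbove]
    simp [cubeSimplex, Fin.lt_def]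

theorem cubeSimplex_face_swap {k : ℕ} (σ : Equiv.Perm (Fin (k + 1))) (j : Fin k) :
    (cubeSimplex (σ * Equiv.swap j.castSucc j.succ)).comp (simplexFace j.succ.castSucc) =
      (cubeSimplex σ).comp (simplexFace j.succ.castSucc) := by
  ext x i
  obtain ⟨m, rfl⟩ := (σ * Equiv.swap j.castSucc j.succ).surjective i
  refine (cubeSimplex_face _ _ _ _).trans ?_
  rw [Equiv.Perm.mul_apply]
  refine Eq.trans ?_ (cubeSimplex_face _ _ _ _).symm
  refine Finset.sum_congr (Finset.filter_congr fun l _ => ?_) fun _ _ => rfl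
  simp only [Fin.lt_def, Fin.succAbove, Equiv.swap_apply_def]
  split_ifs <;> simp_all [Fin.ext_iff] <;> omega

theorem cube_boundary {M : Type*} [AddCommGroup M] {k : ℕ}
    (F : C(stdSimplex ℝ (Fin (k + 1)), Fin (k + 1) → unitInterval) → M) :
    (∑ σ : Equiv.Perm (Fin (k + 1)), (Equiv.Perm.sign σ : ℤ) •
      ∑ j : Fin (k + 2), (-1 : ℤ) ^ (j : ℕ) • F ((cubeSimplex σ).comp (simplexFace j))) =
      ∑ i : Fin (k + 1), (-1 : ℤ) ^ (i : ℕ) •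
        ((∑ ρ : Equiv.Perm (Fin k), (Equiv.Perm.sign ρ : ℤ) •
            F ((cubeFace i 1).comp (cubeSimplex ρ))) -
          ∑ ρ : Equiv.Perm (Fin k), (Equiv.Perm.sign ρ : ℤ) •
            F ((cubeFace i 0).comp (cubeSimplex ρ))) := by
  have key : (∑ σ : Equiv.Perm (Fin (k + 1)), (Equiv.Perm.sign σ : ℤ) •
      ∑ j : Fin (k + 2), (-1 : ℤ) ^ (j : ℕ) • F ((cubeSimplex σ).comp (simplexFace j))) =
      ∑ j : Fin (k + 2), (-1 : ℤ) ^ (j : ℕ) • ∑ σ : Equiv.Perm (Fin (k + 1)),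
        (Equiv.Perm.sign σ : ℤ) • F ((cubeSimplex σ).comp (simplexFace j)) := by
    simp only [Finset.smul_sum]
    rw [Finset.sum_comm]
    refine Finset.sum_congr rfl fun j _ => Finset.sum_congr rfl fun σ _ => ?_
    rw [smul_comm]
  rw [key, Fin.sum_univ_succ, Fin.sum_univ_castSucc]
  have mid : ∀ j : Fin k, (∑ σ : Equiv.Perm (Fin (k + 1)), (Equiv.Perm.sign σ : ℤ) •
      F ((cubeSimplex σ).comp (simplexFace j.castSucc.succ))) = 0 := by
    intro j
    refine Finset.sum_involution (fun σ _ => σ * Equiv.swap j.castSucc j.succ) ?_ ?_ ?_ ?_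
    · intro σ _
      have := cubeSimplex_face_swap σ j
      rw [Fin.succ_castSucc, this]
      simp [Equiv.Perm.sign_mul, Equiv.Perm.sign_swap (Fin.castSucc_lt_succ (i := j)).ne]
    · intro σ _ _ h
      have := congrArg (fun τ => σ.symm (τ j.castSucc)) h
      simp at this
      exact (Fin.castSucc_lt_succ (i := j)).ne this.symm
    · intros; simp
    · intro σ _; simp [mul_assoc]
  simp only [mid, smul_zero, Finset.sum_const_zero, zero_add]
  have h0 : (∑ σ : Equiv.Perm (Fin (k + 1)), (Equiv.Perm.sign σ : ℤ) •
      F ((cubeSimplex σ).comp (simplexFace 0))) =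
      ∑ i : Fin (k + 1), (-1 : ℤ) ^ (i : ℕ) • ∑ ρ : Equiv.Perm (Fin k),
        (Equiv.Perm.sign ρ : ℤ) • F ((cubeFace i 1).comp (cubeSimplex ρ)) := by
    rw [← consPerm_bijective.sum_comp, Fintype.sum_prod_type]
    refine Finset.sum_congr rfl fun i _ => ?_
    rw [Finset.smul_sum]
    refine Finset.sum_congr rfl fun ρ _ => ?_
    rw [sign_consPerm, cubeSimplex_face_zero, mul_smul]
  have h1 : (∑ σ : Equiv.Perm (Fin (k + 1)), (Equiv.Perm.sign σ : ℤ) •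
      F ((cubeSimplex σ).comp (simplexFace (Fin.last _)))) =
      (-1 : ℤ) ^ k • ∑ i : Fin (k + 1), (-1 : ℤ) ^ (i : ℕ) • ∑ ρ : Equiv.Perm (Fin k),
        (Equiv.Perm.sign ρ : ℤ) • F ((cubeFace i 0).comp (cubeSimplex ρ)) := by
    rw [← (Equiv.mulRight (finRotate (k + 1))).bijective.sum_comp, ← consPerm_bijective.sum_comp,
      Fintype.sum_prod_type, Finset.smul_sum]
    refine Finset.sum_congr rfl fun i _ => ?_
    rw [Finset.smul_sum, Finset.smul_sum]
    refine Finset.sum_congr rfl fun ρ _ => ?_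
    rw [Equiv.coe_mulRight, cubeSimplex_face_last, Equiv.Perm.sign_mul, sign_finRotate,
      Units.val_mul, sign_consPerm, ← mul_smul, ← mul_smul]
    congr 1
    push_cast
    ring
  rw [Fin.succ_last, h0, h1]
  simp only [Fin.val_zero, pow_zero, one_smul, Fin.val_last, ← mul_smul, smul_sub,
    Finset.sum_sub_distrib]
  rw [← pow_add, show k.succ + k = 2 * k + 1 by omega, pow_succ, pow_mul]
  simp [sub_eq_add_neg]

theorem cubeChain_d {X : TopCat.{0}} {k : ℕ} (c : C(Fin (k + 1) → unitInterval, X)) :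
    ((singChains X).d (k + 1) k).hom (cubeChain c) =
      ∑ i : Fin (k + 1), (-1 : ℤ) ^ (i : ℕ) •
        (cubeChain (c.comp (cubeFace i 1)) - cubeChain (c.comp (cubeFace i 0))) := by
  refine Eq.trans ?_ (cube_boundary fun s => simplexChain (c.comp s))
  simp only [cubeChain, map_sum, map_zsmul, simplexChain_d]
  rfl


/-! ### Configuration spaces -/

/-- The ordered configuration space of `n` points in `X`. -/
def Conf (n : ℕ) (X : Type) : Type := {x : Fin n → X // Function.Injective x}

/-- The space of ordered configurations of `n` points in `X`,
no more than `k` of which lie in `U`. -/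
def ConfLE (n k : ℕ) (X : Type) (U : Set X) : Type :=
  {x : Fin n → X // Function.Injective x ∧ {i | x i ∈ U}.ncard ≤ k}

instance (n : ℕ) (X : Type) [TopologicalSpace X] : TopologicalSpace (Conf n X) :=
  inferInstanceAs (TopologicalSpace {x : Fin n → X // Function.Injective x})

instance (n k : ℕ) (X : Type) [TopologicalSpace X] (U : Set X) :
    TopologicalSpace (ConfLE n k X U) :=
  inferInstanceAs (TopologicalSpace
    {x : Fin n → X // Function.Injective x ∧ {i | x i ∈ U}.ncard ≤ k})

/-- Two ordered configurations are identified when they differ by a permutation of the labels. -/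
instance Conf.setoid (n : ℕ) (X : Type) : Setoid (Conf n X) where
  r x y := ∃ π : Equiv.Perm (Fin n), ∀ i, y.1 i = x.1 (π i)
  iseqv := ⟨fun _ => ⟨1, fun _ => rfl⟩,
    fun ⟨π, h⟩ => ⟨π.symm, fun i => by rw [h, Equiv.apply_symm_apply]⟩,
    fun ⟨π, h⟩ ⟨ρ, h'⟩ => ⟨ρ.trans π, fun i => by rw [h', h]; rfl⟩⟩

instance ConfLE.setoid (n k : ℕ) (X : Type) (U : Set X) : Setoid (ConfLE n k X U) where
  r x y := ∃ π : Equiv.Perm (Fin n), ∀ i, y.1 i = x.1 (π i)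
  iseqv := ⟨fun _ => ⟨1, fun _ => rfl⟩,
    fun ⟨π, h⟩ => ⟨π.symm, fun i => by rw [h, Equiv.apply_symm_apply]⟩,
    fun ⟨π, h⟩ ⟨ρ, h'⟩ => ⟨ρ.trans π, fun i => by rw [h', h]; rfl⟩⟩

/-- The unordered configuration space: the quotient of `Conf n X` by the symmetric group. -/
def UConf (n : ℕ) (X : Type) : Type := Quotient (Conf.setoid n X)

/-- The space of unordered configurations of `n` points in `X`, no more than `k` of which
lie in `U`. -/
def UConfLE (n k : ℕ) (X : Type) (U : Set X) : Type := Quotient (ConfLE.setoid n k X U)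

instance (n : ℕ) (X : Type) [TopologicalSpace X] : TopologicalSpace (UConf n X) :=
  inferInstanceAs (TopologicalSpace (Quotient (Conf.setoid n X)))

instance (n k : ℕ) (X : Type) [TopologicalSpace X] (U : Set X) :
    TopologicalSpace (UConfLE n k X U) :=
  inferInstanceAs (TopologicalSpace (Quotient (ConfLE.setoid n k X U)))

theorem Conf.mk_eq_iff {n : ℕ} {X : Type} (x y : Conf n X) :
    (Quotient.mk _ x : UConf n X) = Quotient.mk _ y ↔ Set.range x.1 = Set.range y.1 := by
  rw [Quotient.eq]
  constructor
  · rintro ⟨π, h⟩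
    have : y.1 = x.1 ∘ π := funext h
    rw [this, π.surjective.range_comp]
  · intro h
    refine ⟨(Equiv.ofInjective _ y.2).trans ((Equiv.setCongr h.symm).trans
      (Equiv.ofInjective _ x.2).symm), fun i => ?_⟩
    simp [Equiv.apply_ofInjective_symm]

section maps
variable {X Y : Type} [TopologicalSpace X] [TopologicalSpace Y] (n : ℕ)

/-- The inclusion of the configurations with at most `k` points in `U`. -/
def ConfLE.incl (k : ℕ) (U : Set X) : C(ConfLE n k X U, Conf n X) where
  toFun x := ⟨x.1, x.2.1⟩
  continuous_toFun := Continuous.subtype_mk continuous_subtype_val _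

/-- The inclusion of the unordered configurations with at most `k` points in `U`. -/
def UConfLE.incl (k : ℕ) (U : Set X) : C(UConfLE n k X U, UConf n X) where
  toFun := Quotient.map (ConfLE.incl n k U) fun _ _ h => h
  continuous_toFun := (ConfLE.incl n k U).continuous.quotient_map' _

/-- Conditions under which a continuous map `f : X → Y` can be applied pointwise to configurations
with at most one point in `U`, giving configurations with at most one point in `W`. -/
structure Pushable (f : C(X, Y)) (U : Set X) (W : Set Y) : Prop where
  mapsTo : Set.MapsTo f U W
  mapsTo_compl : Set.MapsTo f Uᶜ Wᶜ
  injOn : Set.InjOn f Uᶜ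

variable {f : C(X, Y)} {U : Set X} {W : Set Y}

theorem Pushable.push_mem (hf : Pushable f U W) (x : ConfLE n 1 X U) :
    Function.Injective (fun i => f (x.1 i)) ∧ {i | f (x.1 i) ∈ W}.ncard ≤ 1 := by
  have hW : ∀ i, f (x.1 i) ∈ W ↔ x.1 i ∈ U := fun i =>
    ⟨fun h => by_contra fun h' => hf.mapsTo_compl h' h, fun h => hf.mapsTo h⟩
  constructor
  · intro i j hij
    have hij' : f (x.1 i) = f (x.1 j) := hij
    by_cases hi : x.1 i ∈ U
    · have hj : x.1 j ∈ U := (hW j).1 (hij' ▸ (hW i).2 hi)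
      exact (Set.ncard_le_one_iff (Set.toFinite _)).1 x.2.2 hi hj
    · have hj : x.1 j ∉ U := fun hj => hi ((hW i).1 (hij' ▸ (hW j).2 hj))
      exact x.2.1 (hf.injOn hi hj hij')
  · simp only [hW]
    exact x.2.2

/-- The map of spaces of ordered configurations that applies `f` to each point. -/
def ConfLE.push (hf : Pushable f U W) : C(ConfLE n 1 X U, ConfLE n 1 Y W) where
  toFun x := ⟨fun i => f (x.1 i), hf.push_mem n x⟩
  continuous_toFun := Continuous.subtype_mk (continuous_pi fun i =>
    f.continuous.comp ((continuous_apply i).comp continuous_subtype_val)) _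

/-- The map of spaces of unordered configurations that applies `f` to each point. -/
def UConfLE.push (hf : Pushable f U W) : C(UConfLE n 1 X U, UConfLE n 1 Y W) where
  toFun := Quotient.map (ConfLE.push n hf) fun _ _ ⟨π, h⟩ => ⟨π, fun i => congrArg f (h i)⟩
  continuous_toFun := (ConfLE.push n hf).continuous.quotient_map' _

end maps

/-- A continuous map is a homotopy equivalence. -/
def IsHomotopyEquiv {X Y : Type} [TopologicalSpace X] [TopologicalSpace Y] (f : C(X, Y)) : Prop :=
  ∃ h : ContinuousMap.HomotopyEquiv X Y, h.toFun = f

/-! ### Graphs -/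

/-- A (multi)graph with vertex set `V` and edge set `E`, loops and multiple edges allowed.
Every edge is identified with `[0, 1]`; its end at `0` is called `false` and its end at `1` is
called `true`. A half-edge is a pair `(e, b)` of an edge and one of its two ends. -/
structure Multigraph (V E : Type) where
  /-- The vertex at the end `b` of the edge `e`. -/
  vert : E → Bool → V

namespace Multigraph

variable {V E : Type} (Γ : Multigraph V E)

/-- The gluing of the ends of the edges to the vertices. -/
inductive Glue : ((Sigma fun _ : V => Unit) ⊕ (Sigma fun _ : E => unitInterval)) →
    ((Sigma fun _ : V => Unit) ⊕ (Sigma fun _ : E => unitInterval)) → Prop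
  | zero (e : E) : Glue (.inr ⟨e, 0⟩) (.inl ⟨Γ.vert e false, ()⟩)
  | one (e : E) : Glue (.inr ⟨e, 1⟩) (.inl ⟨Γ.vert e true, ()⟩)

/-- The geometric realization of `Γ`: the quotient of the disjoint union of one point for each
vertex and one unit interval for each edge. -/
def Space : Type := Quot Γ.Glue

instance : TopologicalSpace Γ.Space :=
  inferInstanceAs (TopologicalSpace (Quot Γ.Glue))

/-- The point of the realization given by a vertex. -/
def vertexPt (v : V) : Γ.Space := Quot.mk _ (.inl ⟨v, ()⟩)

/-- The point with coordinate `t` on the edge `e`. -/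
def edgePt (e : E) (t : unitInterval) : Γ.Space := Quot.mk _ (.inr ⟨e, t⟩)

theorem edgePt_zero (e : E) : Γ.edgePt e 0 = Γ.vertexPt (Γ.vert e false) :=
  Quot.sound (.zero e)

theorem edgePt_one (e : E) : Γ.edgePt e 1 = Γ.vertexPt (Γ.vert e true) :=
  Quot.sound (.one e)

theorem continuous_edgePt (e : E) : Continuous (Γ.edgePt e) :=
  continuous_quot_mk.comp (continuous_inr.comp continuous_sigmaMk)

/-- The point on the edge `e` at distance `t` from its end `b`. -/
def halfEdgePt (e : E) (b : Bool) (t : unitInterval) : Γ.Space :=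
  Γ.edgePt e (if b then unitInterval.symm t else t)

open Classical in
/-- A normal form for points of the realization. -/
def normalForm (x : Γ.Space) : V ⊕ (E × unitInterval) :=
  Quot.lift (fun p : (Sigma fun _ : V => Unit) ⊕ (Sigma fun _ : E => unitInterval) => match p with
    | .inl ⟨v, _⟩ => Sum.inl v
    | .inr ⟨e, t⟩ => if t = 0 then Sum.inl (Γ.vert e false) else
        if t = 1 then Sum.inl (Γ.vert e true) else Sum.inr (e, t))
    (by rintro _ _ (e | e) <;> simp) x

theorem normalForm_vertexPt (v : V) : Γ.normalForm (Γ.vertexPt v) = .inl v := rfl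

open Classical in
theorem normalForm_edgePt (e : E) (t : unitInterval) : Γ.normalForm (Γ.edgePt e t) =
    if t = 0 then Sum.inl (Γ.vert e false) else
        if t = 1 then Sum.inl (Γ.vert e true) else Sum.inr (e, t) := rfl

/-- An edge path from `v` to `w`, given by the list of the half-edges along which it leaves
the vertices that it passes. -/
def IsWalk (v : V) (l : List (E × Bool)) (w : V) : Prop :=
  match l with
  | [] => v = w
  | d :: l => Γ.vert d.1 d.2 = v ∧ IsWalk (Γ.vert d.1 (!d.2)) l w

/-- An edge path is reduced if it never traverses an edge and then immediately goes back
along the same edge. -/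
def IsReduced (l : List (E × Bool)) : Prop :=
  l.IsChain fun d d' => d' ≠ (d.1, !d.2)

/-- A subgraph. -/
structure Subgraph where
  /-- The vertices of the subgraph. -/
  verts : Finset V
  /-- The edges of the subgraph. -/
  edges : Finset E
  vert_mem : ∀ e ∈ edges, ∀ b, Γ.vert e b ∈ verts

namespace Subgraph

variable {Γ} (T : Γ.Subgraph)

/-- `l` is a reduced edge path from `v` to `w` inside the subgraph `T`. -/
def IsPath (v : V) (l : List (E × Bool)) (w : V) : Prop :=
  Γ.IsWalk v l w ∧ IsReduced l ∧ ∀ d ∈ l, d.1 ∈ T.edges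

/-- The subgraph `T` is a tree: it is nonempty, and any two of its vertices are joined by
exactly one reduced edge path in `T`. -/
def IsTree : Prop :=
  T.verts.Nonempty ∧ ∀ v ∈ T.verts, ∀ w ∈ T.verts, ∃! l, T.IsPath v l w

open Classical in
/-- The reduced edge path in the tree `T` from `v` to `w`. -/
def path (v w : V) : List (E × Bool) :=
  if h : ∃ l, T.IsPath v l w then h.choose else []

/-- The open `ε`-neighbourhood of `T` in the realization of `Γ`, in which all edges have length
one: the points of `T`, and the points whose distance along an edge from a vertex
of `T` is less than `ε`. -/
def nhd (ε : ℝ) : Set Γ.Space :=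
  {x | (∃ v ∈ T.verts, x = Γ.vertexPt v) ∨ (∃ e ∈ T.edges, ∃ t, x = Γ.edgePt e t) ∨
    ∃ e b, ∃ t : unitInterval, Γ.vert e b ∈ T.verts ∧ (t : ℝ) < ε ∧ x = Γ.halfEdgePt e b t}

variable [DecidableEq V]

/-- The image in `Γ / T` of a vertex of `Γ`; the vertex `⊥` of `Γ / T` is the image of `T`. -/
def collapseVert (v : V) : WithBot {v : V // v ∉ T.verts} :=
  if h : v ∈ T.verts then ⊥ else ((⟨v, h⟩ : {v : V // v ∉ T.verts}) : WithBot _)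

/-- The graph `Γ / T` obtained by contracting `T` to a single vertex. -/
def contract : Multigraph (WithBot {v : V // v ∉ T.verts}) {e : E // e ∉ T.edges} where
  vert e b := T.collapseVert (Γ.vert e.1 b)

variable [DecidableEq E]

/-- The collapse map from the realization of `Γ` to the realization of `Γ / T`, which maps `T` to
one point and is the identity elsewhere. -/
def collapse : C(Γ.Space, T.contract.Space) where
  toFun := Quot.lift (fun p => match p with
    | .inl ⟨v, _⟩ => T.contract.vertexPt (T.collapseVert v)
    | .inr ⟨e, t⟩ => if h : e ∈ T.edges then T.contract.vertexPt ⊥ else T.contract.edgePt ⟨e, h⟩ t)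
    (by
      rintro _ _ (e | e)
      · by_cases h : e ∈ T.edges
        · simp [h, collapseVert, T.vert_mem e h]
        · simp only [h, dite_false]
          exact T.contract.edgePt_zero ⟨e, h⟩
      · by_cases h : e ∈ T.edges
        · simp [h, collapseVert, T.vert_mem e h]
        · simp only [h, dite_false]
          exact T.contract.edgePt_one ⟨e, h⟩)
  continuous_toFun := by
    refine continuous_quot_lift _ (continuous_sum_dom.2 ⟨?_, ?_⟩)
    · exact continuous_sigma fun v => continuous_of_discreteTopology
    · refine continuous_sigma fun e => ?_
      by_cases h : e ∈ T.edges
      · simpa [Function.comp_def, h] using continuous_const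
      · simpa [Function.comp_def, h] using T.contract.continuous_edgePt ⟨e, h⟩

theorem collapse_surjective (hT : T.verts.Nonempty) : Function.Surjective T.collapse := by
  rintro ⟨⟨v, _⟩ | ⟨e, t⟩⟩
  · induction v using WithBot.recBotCoe with
    | bot =>
      obtain ⟨v, hv⟩ := hT
      refine ⟨Γ.vertexPt v, ?_⟩
      show T.contract.vertexPt (T.collapseVert v) = T.contract.vertexPt ⊥
      simp [collapseVert, hv]
    | coe v =>
      refine ⟨Γ.vertexPt v.1, ?_⟩
      show T.contract.vertexPt (T.collapseVert v.1) = T.contract.vertexPt v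
      simp [collapseVert, v.2]
  · refine ⟨Γ.edgePt e.1 t, ?_⟩
    show (if h : e.1 ∈ T.edges then T.contract.vertexPt ⊥ else T.contract.edgePt ⟨e.1, h⟩ t) =
      T.contract.edgePt e t
    simp [e.2]

/-- The image `U / T` in `Γ / T` of the `ε`-neighbourhood `U` of `T`. -/
def nhdContract (ε : ℝ) : Set T.contract.Space := T.collapse '' T.nhd ε

/-- A continuous map `f : Γ / T → Γ` that maps `U / T` to `U` and fixes all points outside. -/
structure IsExpansion (ε : ℝ) (f : C(T.contract.Space, Γ.Space)) : Prop where
  mapsTo : Set.MapsTo f (T.nhdContract ε) (T.nhd ε)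
  fix : ∀ x ∉ T.nhd ε, f (T.collapse x) = x

theorem IsExpansion.pushable {T : Γ.Subgraph} {ε : ℝ} {f : C(T.contract.Space, Γ.Space)}
    (hf : T.IsExpansion ε f) (hT : T.verts.Nonempty) :
    Pushable f (T.nhdContract ε) (T.nhd ε) := by
  have key : ∀ y ∉ T.nhdContract ε, ∃ x ∉ T.nhd ε, T.collapse x = y := fun y hy => by
    obtain ⟨x, rfl⟩ := T.collapse_surjective hT y
    exact ⟨x, fun hx => hy ⟨x, hx, rfl⟩, rfl⟩
  refine ⟨hf.mapsTo, fun y hy => ?_, fun y hy y' hy' h => ?_⟩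
  · obtain ⟨x, hx, rfl⟩ := key y hy
    rwa [Set.mem_compl_iff, hf.fix x hx]
  · obtain ⟨x, hx, rfl⟩ := key y hy
    obtain ⟨x', hx', rfl⟩ := key y' hy'
    rw [hf.fix x hx, hf.fix x' hx'] at h
    rw [h]

end Subgraph

end Multigraph

/-! ### The Świątkowski complex -/

/-- The possible basis elements of the local factor `S(v) = ℤ⟨∅, v, h ∈ H(v)⟩` of a vertex `v`: the
vertex is empty, occupied, or half-edge `(e, b)` at `v` is active. -/
inductive LocalState (E : Type) where
  | empty : LocalState E
  | occupied : LocalState E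
  | half (e : E) (b : Bool) : LocalState E
deriving DecidableEq

/-- The state is a half-edge. -/
def LocalState.isHalf {E : Type} : LocalState E → Bool
  | .half _ _ => true
  | _ => false

namespace Multigraph

variable {V E : Type} (Γ : Multigraph V E)

/-- The basis of the Świątkowski complex `S(Γ) = ℤ[E] ⊗ ⨂ᵥ S(v)`: a basis element of `S(v)`
for every vertex `v`, and a monomial in the edges. -/
@[ext]
structure Gen where
  /-- The basis element of `S(v)`. -/
  st : V → LocalState E
  /-- The exponents of the monomial in the edges. -/
  mult : E → ℕ
  vert_eq : ∀ v e b, st v = .half e b → Γ.vert e b = v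

/-- The Świątkowski complex, as a module (without its gradings). -/
abbrev Swiat : Type := Γ.Gen →₀ ℤ

namespace Gen

variable {Γ} [Fintype V] [LinearOrder V] [DecidableEq E] (g : Γ.Gen)

/-- The vertices at which a half-edge is active. -/
def active : Finset V := Finset.univ.filter fun v => (g.st v).isHalf

/-- The number of points of the configurations described by a generator: edges, vertices and
half-edges have weight one. -/
def weight [Fintype E] : ℕ := ∑ e, g.mult e + (Finset.univ.filter fun v => g.st v ≠ .empty).card

/-- The homological degree: half-edges have degree one. -/
abbrev degree : ℕ := g.active.card

/-- The Koszul sign of an operator of degree one applied to the factor of the vertex `v`. -/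
def sign (v : V) : ℤ := (-1) ^ (g.active.filter (· < v)).card

/-- Change of the state at a vertex. -/
def setState (v : V) (s : LocalState E) (hs : ∀ e b, s = .half e b → Γ.vert e b = v) : Γ.Gen where
  st := Function.update g.st v s
  mult := g.mult
  vert_eq w e b h := by
    by_cases hw : w = v
    · subst hw; exact hs e b (by simpa using h)
    · exact g.vert_eq w e b (by simpa [hw] using h)

/-- Replacement of the half-edge `h` at `v` by its edge `e(h)`. -/
def release (v : V) : Γ.Gen :=
  match g.st v with
  | .half e _ =>
    { g.setState v .empty (by simp) with mult := g.mult + Pi.single e 1 }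
  | _ => g

/-- Replacement of the half-edge at `v` by the vertex `v`. -/
def settle (v : V) : Γ.Gen :=
  match g.st v with
  | .half _ _ => g.setState v .occupied (by simp)
  | _ => g

/-- The differential of a generator: the signed sum of the terms `e(h) - v(h)`
over all active half-edges `h`. -/
def bdry : Γ.Swiat :=
  ∑ v ∈ g.active, g.sign v • (Finsupp.single (g.release v) 1 - Finsupp.single (g.settle v) 1)

variable {g}

theorem mem_active {v : V} : v ∈ g.active ↔ ∃ e b, g.st v = .half e b := by
  simp only [active, Finset.mem_filter, Finset.mem_univ, true_and]
  cases g.st v <;> simp [LocalState.isHalf]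

theorem release_of_half {v : V} {e : E} {b : Bool} (h : g.st v = .half e b) :
    g.release v = { g.setState v .empty (by simp) with mult := g.mult + Pi.single e 1 } := by
  unfold release; split <;> simp_all

theorem settle_of_half {v : V} {e : E} {b : Bool} (h : g.st v = .half e b) :
    g.settle v = g.setState v .occupied (by simp) := by
  unfold settle; split <;> simp_all

theorem release_st {v : V} (hv : v ∈ g.active) :
    (g.release v).st = Function.update g.st v .empty := by
  obtain ⟨e, b, h⟩ := mem_active.1 hv
  rw [release_of_half h]; rfl

theorem settle_st {v : V} (hv : v ∈ g.active) :
    (g.settle v).st = Function.update g.st v .occupied := by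
  obtain ⟨e, b, h⟩ := mem_active.1 hv
  rw [settle_of_half h]; rfl

theorem release_mult {v : V} {e : E} {b : Bool} (h : g.st v = .half e b) :
    (g.release v).mult = g.mult + Pi.single e 1 := by
  rw [release_of_half h]

theorem settle_mult {v : V} : (g.settle v).mult = g.mult := by
  unfold settle; split <;> rfl

theorem active_of_update {g' : Γ.Gen} {v : V} {s : LocalState E} (hs : s.isHalf = false)
    (h : g'.st = Function.update g.st v s) : g'.active = g.active.erase v := by
  ext w
  simp only [active, h, Finset.mem_filter, Finset.mem_univ, true_and, Finset.mem_erase]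
  by_cases hw : w = v
  · subst hw; simp [hs]
  · simp [hw]

theorem release_active {v : V} (hv : v ∈ g.active) : (g.release v).active = g.active.erase v :=
  active_of_update rfl (release_st hv)

theorem settle_active {v : V} (hv : v ∈ g.active) : (g.settle v).active = g.active.erase v :=
  active_of_update rfl (settle_st hv)

theorem sign_of_erase {g' : Γ.Gen} {v : V} (hv : v ∈ g.active) (h : g'.active = g.active.erase v)
    (w : V) : g'.sign w = (if v < w then -1 else 1) * g.sign w := by
  unfold sign
  rw [h, Finset.filter_erase]
  split_ifs with hvw
  · have hm : v ∈ g.active.filter (· < w) := Finset.mem_filter.2 ⟨hv, hvw⟩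
    rw [← Finset.card_erase_add_one hm, pow_succ]
    ring
  · rw [Finset.erase_eq_of_notMem (by simp [hvw]), one_mul]

theorem st_of_ne {g' : Γ.Gen} {v w : V} {s : LocalState E} (hw : w ≠ v)
    (h : g'.st = Function.update g.st v s) : g'.st w = g.st w := by simp [h, hw]

theorem release_release {v w : V} (hv : v ∈ g.active) (hw : w ∈ g.active) (hvw : v ≠ w) :
    (g.release v).release w = (g.release w).release v := by
  have hw' : w ∈ (g.release v).active := by rw [release_active hv]; simp [hw, hvw.symm]
  have hv' : v ∈ (g.release w).active := by rw [release_active hw]; simp [hv, hvw]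
  obtain ⟨e, b, he⟩ := mem_active.1 hv
  obtain ⟨e', b', he'⟩ := mem_active.1 hw
  refine Gen.ext ?_ ?_
  · rw [release_st hw', release_st hv, release_st hv', release_st hw, Function.update_comm hvw]
  · rw [release_mult (e := e') (b := b') (by rw [st_of_ne hvw.symm (release_st hv), he']),
      release_mult he, release_mult (e := e) (b := b) (by rw [st_of_ne hvw (release_st hw), he]),
      release_mult he', add_right_comm]

theorem release_settle {v w : V} (hv : v ∈ g.active) (hw : w ∈ g.active) (hvw : v ≠ w) :
    (g.release v).settle w = (g.settle w).release v := by
  have hw' : w ∈ (g.release v).active := by rw [release_active hv]; simp [hw, hvw.symm]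
  have hv' : v ∈ (g.settle w).active := by rw [settle_active hw]; simp [hv, hvw]
  obtain ⟨e, b, he⟩ := mem_active.1 hv
  refine Gen.ext ?_ ?_
  · rw [settle_st hw', release_st hv, release_st hv', settle_st hw, Function.update_comm hvw]
  · rw [settle_mult, release_mult he,
      release_mult (e := e) (b := b) (by rw [st_of_ne hvw (settle_st hw), he]), settle_mult]

theorem settle_settle {v w : V} (hv : v ∈ g.active) (hw : w ∈ g.active) (hvw : v ≠ w) :
    (g.settle v).settle w = (g.settle w).settle v := by
  have hw' : w ∈ (g.settle v).active := by rw [settle_active hv]; simp [hw, hvw.symm]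
  have hv' : v ∈ (g.settle w).active := by rw [settle_active hw]; simp [hv, hvw]
  refine Gen.ext ?_ ?_
  · rw [settle_st hw', settle_st hv, settle_st hv', settle_st hw, Function.update_comm hvw]
  · simp only [settle_mult]

theorem weight_of_face [Fintype E] {g' : Γ.Gen} {v : V} {s : LocalState E}
    (h : g'.st = Function.update g.st v s) (hv : v ∈ g.active) :
    g'.weight + 1 + ∑ e, g.mult e = g.weight + ∑ e, g'.mult e + (if s = .empty then 0 else 1) := by
  have hne : g.st v ≠ .empty := by
    obtain ⟨e, b, he⟩ := mem_active.1 hv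
    simp [he]
  have hm : v ∈ Finset.univ.filter (fun w => g.st w ≠ .empty) := by simpa using hne
  have h1 := Finset.card_erase_add_one hm
  have h2 : (Finset.univ.filter fun w => g'.st w ≠ .empty) =
      if s = .empty then (Finset.univ.filter fun w => g.st w ≠ .empty).erase v
      else (Finset.univ.filter fun w => g.st w ≠ .empty) := by
    ext w
    by_cases hw : w = v
    · subst hw; split_ifs with hs <;> simp [h, hs, hne]
    · split_ifs <;> simp [h, hw]
  unfold weight
  rw [h2]
  split_ifs <;> omega

theorem release_weight [Fintype E] {v : V} (hv : v ∈ g.active) :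
    (g.release v).weight = g.weight := by
  have h := weight_of_face (release_st hv) hv
  obtain ⟨e, b, he⟩ := mem_active.1 hv
  simp only [release_mult he, if_true, Pi.add_apply, Finset.sum_add_distrib,
    Finset.sum_pi_single', Finset.mem_univ] at h
  omega

theorem settle_weight [Fintype E] {v : V} (hv : v ∈ g.active) :
    (g.settle v).weight = g.weight := by
  have h := weight_of_face (settle_st hv) hv
  simp only [settle_mult, reduceCtorEq, if_false] at h
  omega

theorem degree_of_erase {g' : Γ.Gen} {v : V} (hv : v ∈ g.active)
    (h : g'.active = g.active.erase v) : g'.degree + 1 = g.degree := by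
  unfold degree
  rw [h, Finset.card_erase_add_one hv]

end Gen

variable [Fintype V] [LinearOrder V] [DecidableEq E]

/-- The differential of the Świątkowski complex. -/
def swiatD : Γ.Swiat →ₗ[ℤ] Γ.Swiat := Finsupp.linearCombination ℤ Gen.bdry

variable {Γ}

theorem swiatD_single (g : Γ.Gen) : Γ.swiatD (Finsupp.single g 1) = g.bdry := by
  simp [swiatD]

theorem swiatD_face {g g' : Γ.Gen} {v : V} (hv : v ∈ g.active)
    (h : g'.active = g.active.erase v) :
    Γ.swiatD (Finsupp.single g' 1) = ∑ w ∈ g.active.erase v, ((if v < w then -1 else 1) * g.sign w) •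
      (Finsupp.single (g'.release w) 1 - Finsupp.single (g'.settle w) 1) := by
  rw [swiatD_single, Gen.bdry, h]
  exact Finset.sum_congr rfl fun w _ => by rw [Gen.sign_of_erase hv h]

theorem swiatD_bdry (g : Γ.Gen) : Γ.swiatD g.bdry = 0 := by
  have h1 : Γ.swiatD g.bdry = ∑ v ∈ g.active, ∑ w ∈ g.active.erase v,
      (g.sign v * ((if v < w then -1 else 1) * g.sign w)) •
        ((Finsupp.single ((g.release v).release w) 1 - Finsupp.single ((g.release v).settle w) 1) -
        (Finsupp.single ((g.settle v).release w) 1 - Finsupp.single ((g.settle v).settle w) 1) :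
          Γ.Swiat) := by
    rw [Gen.bdry, map_sum]
    refine Finset.sum_congr rfl fun v hv => ?_
    rw [map_zsmul, map_sub, swiatD_face hv (Gen.release_active hv),
      swiatD_face hv (Gen.settle_active hv), ← Finset.sum_sub_distrib, Finset.smul_sum]
    refine Finset.sum_congr rfl fun w _ => ?_
    rw [← smul_sub, smul_smul]
  rw [h1, Finset.sum_sigma']
  refine Finset.sum_involution (fun p _ => ⟨p.2, p.1⟩) ?_ ?_ ?_ ?_
  · rintro ⟨v, w⟩ h
    simp only [Finset.mem_sigma, Finset.mem_erase] at h
    obtain ⟨hv, hwv, hw⟩ := h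
    dsimp only
    rw [Gen.release_release hw hv hwv, Gen.settle_settle hw hv hwv, Gen.release_settle hw hv hwv,
      Gen.release_settle hv hw hwv.symm]
    rcases lt_or_gt_of_ne hwv with h | h
    · simp only [h, h.not_gt, if_true, if_false]
      module
    · simp only [h, h.not_gt, if_true, if_false]
      module
  · rintro ⟨v, w⟩ h _ h'
    simp only [Finset.mem_sigma, Finset.mem_erase] at h
    exact h.2.1 (congrArg Sigma.fst h')
  · rintro ⟨v, w⟩ h
    simp only [Finset.mem_sigma, Finset.mem_erase] at h ⊢
    exact ⟨h.2.2, h.2.1.symm, h.1⟩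
  · intros; rfl

theorem swiatD_swiatD (c : Γ.Swiat) : Γ.swiatD (Γ.swiatD c) = 0 := by
  have : Γ.swiatD ∘ₗ Γ.swiatD = 0 := by
    ext1 g
    ext1
    simp only [LinearMap.comp_apply, Finsupp.lsingle_apply, LinearMap.zero_apply]
    rw [swiatD_single, swiatD_bdry]
  exact LinearMap.congr_fun this c

variable [Fintype E] (Γ)

/-- The part of weight `n` and degree `k` of the Świątkowski complex. -/
def swiatPart (n k : ℕ) : Submodule ℤ Γ.Swiat :=
  Finsupp.supported ℤ ℤ {g | g.weight = n ∧ g.degree = k}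

variable {Γ}

theorem swiatPart_le {n k : ℕ} {N : Submodule ℤ Γ.Swiat}
    (h : ∀ g : Γ.Gen, g.weight = n → g.degree = k → Finsupp.single g 1 ∈ N) :
    Γ.swiatPart n k ≤ N := by
  rw [swiatPart, Finsupp.supported_eq_span_single, Submodule.span_le]
  rintro _ ⟨g, hg, rfl⟩
  exact h g hg.1 hg.2

theorem single_mem_swiatPart {n k : ℕ} {g : Γ.Gen} (h : g.weight = n) (h' : g.degree = k) :
    Finsupp.single g 1 ∈ Γ.swiatPart n k := Finsupp.single_mem_supported ℤ 1 ⟨h, h'⟩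

theorem swiatD_mem {n k : ℕ} (c : Γ.Swiat) (hc : c ∈ Γ.swiatPart n (k + 1)) :
    Γ.swiatD c ∈ Γ.swiatPart n k := by
  refine swiatPart_le (N := (Γ.swiatPart n k).comap Γ.swiatD) (fun g hg hk => ?_) hc
  rw [Submodule.mem_comap, swiatD_single, Gen.bdry]
  refine Submodule.sum_mem _ fun v hv => Submodule.smul_mem _ _ (Submodule.sub_mem _ ?_ ?_)
  · have := Gen.degree_of_erase hv (Gen.release_active hv)
    exact single_mem_swiatPart ((Gen.release_weight hv).trans hg) (by omega)
  · have := Gen.degree_of_erase hv (Gen.settle_active hv)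
    exact single_mem_swiatPart ((Gen.settle_weight hv).trans hg) (by omega)

variable (Γ)

/-- The part of weight `n` of the Świątkowski complex of `Γ`, as a chain complex. -/
def swiatComplex (n : ℕ) : ChainComplex (ModuleCat.{0} ℤ) ℕ :=
  ChainComplex.of (fun k => ModuleCat.of ℤ (Γ.swiatPart n k))
    (fun k => ModuleCat.ofHom (Γ.swiatD.restrict (swiatD_mem (n := n) (k := k))))
    (fun k => by
      refine ModuleCat.hom_ext (LinearMap.ext fun c => Subtype.ext ?_)
      exact swiatD_swiatD c.1)

/-- The reduced Świątkowski complex `ℤ[E] ⊗ ⨂ᵥ S̃(v)` as a submodule of the Świątkowski complex.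
Here `S̃(v) ⊆ S(v)` is spanned by `∅` and the differences of half-edges at `v`, i.e. it
consists of those combinations of `∅`, `v`, `h ∈ H(v)` in which `v` has coefficient zero
and the coefficients of the half-edges at `v` add up to zero. -/
def reducedSwiat : Submodule ℤ Γ.Swiat where
  carrier := {c | (∀ g v, g.st v = .occupied → c g = 0) ∧
    ∀ (g : Γ.Gen) (v : V), ∑ h : {h : E × Bool // Γ.vert h.1 h.2 = v},
      c (g.setState v (.half h.1.1 h.1.2) (by rintro e b ⟨⟩; exact h.2)) = 0}
  zero_mem' := by simp
  add_mem' := fun ⟨ha, ha'⟩ ⟨hb, hb'⟩ =>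
    ⟨fun g v h => by simp [ha g v h, hb g v h], fun g v => by
      simp only [Finsupp.add_apply, Finset.sum_add_distrib]
      simp [ha' g v, hb' g v]⟩
  smul_mem' := fun r c ⟨hc, hc'⟩ =>
    ⟨fun g v h => by simp [hc g v h], fun g v => by
      simp only [Finsupp.smul_apply, ← Finset.smul_sum]
      simp [hc' g v]⟩

/-! ### The cubes of the Świątkowski complex -/

namespace Gen

variable {Γ} (g : Γ.Gen)

/-- The half-edge `(e, b)` is active. -/
def HalfAt (e : E) (b : Bool) : Prop := g.st (Γ.vert e b) = .half e b

instance (e : E) (b : Bool) : Decidable (g.HalfAt e b) :=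
  inferInstanceAs (Decidable (g.st (Γ.vert e b) = .half e b))

/-- The number of points on the edge `e`, including those on active half-edges of `e`. -/
def count (e : E) : ℕ :=
  g.mult e + (if g.HalfAt e false then 1 else 0) + (if g.HalfAt e true then 1 else 0)

/-- The relative length of the gap between the end `b` of the edge `e` and the closest point:
it is variable if the half-edge is active, and one otherwise. -/
def gap (t : V → unitInterval) (e : E) (b : Bool) : ℝ :=
  if g.HalfAt e b then (t (Γ.vert e b) : ℝ) else 1

/-- The coordinate on the edge `e` of the `j`-th point on `e`. All gaps between consecutive points
have relative length one. -/
def coord (t : V → unitInterval) (e : E) (j : ℕ) : ℝ :=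
  (g.gap t e false + j) / (g.gap t e false + g.gap t e true + (g.count e - 1))

/-- The labels of the points of the configurations described by a generator. -/
abbrev Label : Type := {v : V // g.st v = .occupied} ⊕ (Sigma fun e : E => Fin (g.count e))

/-- The configuration described by the generator `g` and the parameters `t`: one point at each
occupied vertex; on each edge `e`, as many points as the exponent of `e`; and for each active
half-edge at `v`, a point that moves along the half-edge from `v` (parameter `0`)
into the interior of the edge (parameter `1`). -/
def point (t : V → unitInterval) : g.Label → Γ.Space
  | .inl v => Γ.vertexPt v.1
  | .inr p => Γ.edgePt p.1 (Set.projIcc 0 1 zero_le_one (g.coord t p.1 p.2))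

variable {g}

theorem HalfAt.active {e : E} {b : Bool} (h : g.HalfAt e b) : Γ.vert e b ∈ g.active :=
  mem_active.2 ⟨e, b, h⟩

theorem gap_nonneg (t : V → unitInterval) (e : E) (b : Bool) : 0 ≤ g.gap t e b := by
  unfold gap; split_ifs
  · exact (t _).2.1
  · exact zero_le_one

theorem gap_le_one (t : V → unitInterval) (e : E) (b : Bool) : g.gap t e b ≤ 1 := by
  unfold gap; split_ifs
  · exact (t _).2.2
  · exact le_rfl

theorem one_le_denom (t : V → unitInterval) {e : E} (he : 0 < g.count e) :
    1 ≤ g.gap t e false + g.gap t e true + ((g.count e : ℝ) - 1) := by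
  have h0 := gap_nonneg (g := g) t e false
  have h1 := gap_nonneg (g := g) t e true
  have hc : (1 : ℝ) ≤ g.count e := by exact_mod_cast he
  by_cases hf : g.HalfAt e false
  · by_cases ht : g.HalfAt e true
    · have : (2 : ℝ) ≤ g.count e := by
        have : 2 ≤ g.count e := by simp only [count, hf, ht, if_true]; omega
        exact_mod_cast this
      linarith
    · have : g.gap t e true = 1 := if_neg ht
      linarith
  · have : g.gap t e false = 1 := if_neg hf
    linarith

theorem coord_nonneg (t : V → unitInterval) {e : E} {j : ℕ} (hj : j < g.count e) :
    0 ≤ g.coord t e j := by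
  have := one_le_denom (g := g) t (e := e) (by omega)
  have := gap_nonneg (g := g) t e false
  unfold coord; positivity

theorem coord_le_one (t : V → unitInterval) {e : E} {j : ℕ} (hj : j < g.count e) :
    g.coord t e j ≤ 1 := by
  have := one_le_denom (g := g) t (e := e) (by omega)
  have := gap_nonneg (g := g) t e true
  have : (j : ℝ) + 1 ≤ g.count e := by exact_mod_cast hj
  unfold coord
  rw [div_le_one (by linarith)]
  linarith

theorem coord_inj (t : V → unitInterval) {e : E} {i j : ℕ} (hj : j < g.count e)
    (h : g.coord t e i = g.coord t e j) : i = j := by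
  have := one_le_denom (g := g) t (e := e) (by omega)
  unfold coord at h
  rw [div_left_inj' (by linarith)] at h
  exact_mod_cast add_left_cancel h

theorem coord_eq_zero (t : V → unitInterval) {e : E} {j : ℕ} (hj : j < g.count e)
    (h : g.coord t e j = 0) : g.HalfAt e false ∧ j = 0 := by
  have h1 := one_le_denom (g := g) t (e := e) (by omega)
  have h2 := gap_nonneg (g := g) t e false
  unfold coord at h
  rw [div_eq_zero_iff] at h
  have hj0 : (0 : ℝ) ≤ j := Nat.cast_nonneg j
  have h3 : g.gap t e false + j = 0 := h.resolve_right (by linarith)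
  refine ⟨by_contra fun hf => ?_, ?_⟩
  · have : g.gap t e false = 1 := if_neg hf
    linarith
  · have : (j : ℝ) = 0 := by linarith
    exact_mod_cast this

theorem coord_eq_one (t : V → unitInterval) {e : E} {j : ℕ} (hj : j < g.count e)
    (h : g.coord t e j = 1) : g.HalfAt e true ∧ j + 1 = g.count e := by
  have h1 := one_le_denom (g := g) t (e := e) (by omega)
  have h2 := gap_nonneg (g := g) t e true
  have h4 : (j : ℝ) + 1 ≤ g.count e := by exact_mod_cast hj
  unfold coord at h
  rw [div_eq_one_iff_eq (by linarith)] at h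
  refine ⟨by_contra fun hf => ?_, ?_⟩
  · have : g.gap t e true = 1 := if_neg hf
    linarith
  · have : (j : ℝ) + 1 = g.count e := by linarith
    exact_mod_cast this

theorem projIcc_coord (t : V → unitInterval) {e : E} {j : ℕ} (hj : j < g.count e) :
    ((Set.projIcc 0 1 zero_le_one (g.coord t e j) : unitInterval) : ℝ) = g.coord t e j := by
  rw [Set.projIcc_of_mem _ ⟨coord_nonneg t hj, coord_le_one t hj⟩]

/-- Where a point on an edge can be. -/
theorem normalForm_point (t : V → unitInterval) (p : Sigma fun e : E => Fin (g.count e)) :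
    (∃ b, g.HalfAt p.1 b ∧ Γ.normalForm (g.point t (.inr p)) = .inl (Γ.vert p.1 b) ∧
        (p.2 : ℕ) = if b then g.count p.1 - 1 else 0) ∨
      ∃ s : unitInterval, (s : ℝ) = g.coord t p.1 p.2 ∧
        Γ.normalForm (g.point t (.inr p)) = .inr (p.1, s) := by
  have hp := projIcc_coord (g := g) t p.2.2
  simp only [point, normalForm_edgePt]
  split_ifs with h0 h1
  · have := coord_eq_zero t p.2.2 (by rw [← hp, h0]; rfl)
    exact .inl ⟨false, this.1, rfl, by simpa using this.2⟩
  · have := coord_eq_one t p.2.2 (by rw [← hp, h1]; rfl)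
    exact .inl ⟨true, this.1, rfl, by have := this.2; simp; omega⟩
  · exact .inr ⟨_, hp, rfl⟩

theorem point_injective (t : V → unitInterval) : Function.Injective (g.point t) := by
  have key : ∀ (v : {v : V // g.st v = .occupied}) (p : Sigma fun e : E => Fin (g.count e)),
      g.point t (.inl v) ≠ g.point t (.inr p) := by
    intro v p h
    have h' := congrArg Γ.normalForm h
    change Sum.inl v.1 = _ at h'
    rcases normalForm_point t p with ⟨b, hb, h2, _⟩ | ⟨s, _, h2⟩
    · rw [h2] at h'
      have := v.2
      rw [Sum.inl_injective h', hb] at this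
      cases this
    · rw [h2] at h'
      cases h'
  rintro (v | p) (w | q) h
  · have h' := congrArg Γ.normalForm h
    change Sum.inl v.1 = Sum.inl w.1 at h'
    rw [Subtype.ext (Sum.inl_injective h')]
  · exact (key _ _ h).elim
  · exact (key _ _ h.symm).elim
  · have h' := congrArg Γ.normalForm h
    obtain ⟨e, i⟩ := p
    obtain ⟨e', j⟩ := q
    rcases normalForm_point t ⟨e, i⟩ with ⟨b, hb, h2, h3⟩ | ⟨s, h3, h2⟩ <;>
    rcases normalForm_point t ⟨e', j⟩ with ⟨b', hb', h2', h3'⟩ | ⟨s', h3', h2'⟩ <;>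
    rw [h2, h2'] at h'
    · have hv : Γ.vert e b = Γ.vert e' b' := Sum.inl_injective h'
      have : LocalState.half e b = LocalState.half e' b' := by
        rw [← show g.st (Γ.vert e b) = .half e b from hb,
          ← show g.st (Γ.vert e' b') = .half e' b' from hb', hv]
      obtain ⟨rfl, rfl⟩ := LocalState.half.inj this
      have hij : i = j := Fin.ext (h3.trans h3'.symm)
      rw [hij]
    · cases h'
    · cases h'
    · have := Prod.mk.inj (Sum.inr_injective h')
      obtain ⟨rfl, rfl⟩ := this
      have hij : i = j := Fin.ext (coord_inj t j.2 (h3.symm.trans h3'))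
      rw [hij]

theorem continuous_point (l : g.Label) : Continuous fun t => g.point t l := by
  rcases l with v | p
  · exact continuous_const
  · refine (Γ.continuous_edgePt p.1).comp (continuous_projIcc.comp ?_)
    have hgap : ∀ b, Continuous fun t : V → unitInterval => g.gap t p.1 b := by
      intro b
      unfold gap
      split_ifs
      · exact continuous_subtype_val.comp (continuous_apply _)
      · exact continuous_const
    refine Continuous.div ((hgap _).add continuous_const)
      (((hgap _).add (hgap _)).add continuous_const) fun t => ?_
    have := one_le_denom (g := g) t (e := p.1) (lt_of_le_of_lt (Nat.zero_le _) p.2.2)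
    linarith

theorem sum_halfAt : ∑ e : E, ((if g.HalfAt e false then 1 else 0) +
    (if g.HalfAt e true then 1 else 0)) = g.active.card := by
  have h1 : ∑ e : E, ((if g.HalfAt e false then 1 else 0) + (if g.HalfAt e true then 1 else 0)) =
      ((Finset.univ : Finset (E × Bool)).filter fun p => g.HalfAt p.1 p.2).card := by
    rw [Finset.card_filter, Fintype.sum_prod_type]
    exact Finset.sum_congr rfl fun e _ => by rw [Fintype.sum_bool, add_comm]
  rw [h1]
  refine Finset.card_bij (fun p _ => Γ.vert p.1 p.2) (fun p hp => ?_) (fun p hp q hq h => ?_)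
    fun v hv => ?_
  · exact HalfAt.active (Finset.mem_filter.1 hp).2
  · have hp := (Finset.mem_filter.1 hp).2
    have hq := (Finset.mem_filter.1 hq).2
    unfold HalfAt at hp hq
    rw [h, hq] at hp
    obtain ⟨h1, h2⟩ := LocalState.half.inj hp
    exact Prod.ext h1.symm h2.symm
  · obtain ⟨e, b, h⟩ := mem_active.1 hv
    have hv := g.vert_eq v e b h
    exact ⟨(e, b), Finset.mem_filter.2 ⟨Finset.mem_univ _, by subst hv; exact h⟩, hv⟩

theorem card_label : Fintype.card g.Label = g.weight := by
  have h2 : (Finset.univ.filter fun v => g.st v ≠ .empty).card =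
      (Finset.univ.filter fun v => g.st v = .occupied).card + g.active.card := by
    rw [← Finset.card_union_of_disjoint]
    · congr 1
      ext v
      simp only [active, Finset.mem_union, Finset.mem_filter, Finset.mem_univ, true_and]
      cases g.st v <;> simp [LocalState.isHalf]
    · refine Finset.disjoint_filter.2 fun v _ h => ?_
      simp [h, LocalState.isHalf]
  rw [Fintype.card_sum, Fintype.card_sigma, Fintype.card_subtype, weight, h2, ← sum_halfAt]
  have h3 : ∑ e, Fintype.card (Fin (g.count e)) = ∑ e, g.mult e +
      ∑ e, ((if g.HalfAt e false then 1 else 0) + (if g.HalfAt e true then 1 else 0)) := by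
    rw [← Finset.sum_add_distrib]
    exact Finset.sum_congr rfl fun e _ => (Fintype.card_fin _).trans (add_assoc _ _ _)
  rw [h3]
  omega

variable (g)

/-- A parameter for each coordinate of the cube, used at the corresponding active vertex;
the parameters at other vertices are irrelevant. -/
def spread {k : ℕ} (hk : g.degree = k) (t : Fin k → unitInterval) (v : V) : unitInterval :=
  if h : v ∈ g.active then t ((g.active.orderIsoOfFin hk).symm ⟨v, h⟩) else 1

/-- An ordered configuration described by `g`, with an arbitrary labelling. -/
def ordCube {n k : ℕ} (hn : g.weight = n) (hk : g.degree = k) :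
    C(Fin k → unitInterval, Conf n Γ.Space) where
  toFun t := ⟨fun i => g.point (g.spread hk t)
      ((Fintype.equivFinOfCardEq (card_label.trans hn)).symm i),
    (point_injective _).comp (Equiv.injective _)⟩
  continuous_toFun := by
    refine Continuous.subtype_mk (continuous_pi fun i => ?_) _
    refine (continuous_point _).comp (continuous_pi fun v => ?_)
    unfold spread
    split_ifs
    · exact continuous_apply _
    · exact continuous_const

/-- The singular cube in the unordered configuration space given by a generator of the
Świątkowski complex. -/
def cube {n k : ℕ} (hn : g.weight = n) (hk : g.degree = k) :
    C(Fin k → unitInterval, UConf n Γ.Space) where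
  toFun t := Quotient.mk _ (g.ordCube hn hk t)
  continuous_toFun := continuous_quot_mk.comp (g.ordCube hn hk).continuous

variable {g}

theorem cube_eq_iff {n k k' : ℕ} {g' : Γ.Gen} (hn : g.weight = n) (hk : g.degree = k)
    (hn' : g'.weight = n) (hk' : g'.degree = k') (t : Fin k → unitInterval)
    (t' : Fin k' → unitInterval) : g.cube hn hk t = g'.cube hn' hk' t' ↔
      Set.range (g.point (g.spread hk t)) = Set.range (g'.point (g'.spread hk' t')) := by
  refine (Conf.mk_eq_iff _ _).trans ?_
  have key : ∀ {k : ℕ} (g : Γ.Gen) (hn : g.weight = n) (hk : g.degree = k)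
      (t : Fin k → unitInterval),
      Set.range (g.ordCube hn hk t).1 = Set.range (g.point (g.spread hk t)) := by
    intro k g hn hk t
    exact (Fintype.equivFinOfCardEq (card_label.trans hn)).symm.surjective.range_comp
      (g.point (g.spread hk t))
  rw [key, key]

theorem mem_range_point {t : V → unitInterval} {x : Γ.Space} : x ∈ Set.range (g.point t) ↔
    (∃ v, g.st v = .occupied ∧ Γ.vertexPt v = x) ∨
      ∃ e, ∃ j < g.count e, Γ.edgePt e (Set.projIcc 0 1 zero_le_one (g.coord t e j)) = x := by
  constructor
  · rintro ⟨v | p, rfl⟩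
    · exact .inl ⟨v.1, v.2, rfl⟩
    · exact .inr ⟨p.1, p.2, p.2.2, rfl⟩
  · rintro (⟨v, hv, rfl⟩ | ⟨e, j, hj, rfl⟩)
    · exact ⟨.inl ⟨v, hv⟩, rfl⟩
    · exact ⟨.inr ⟨e, j, hj⟩, rfl⟩

theorem halfAt_face {g' : Γ.Gen} {v : V} {e : E} {b : Bool} {s : LocalState E}
    (h : g.st v = .half e b) (hs : s.isHalf = false) (h' : g'.st = Function.update g.st v s)
    (e' : E) (b' : Bool) : g'.HalfAt e' b' ↔ g.HalfAt e' b' ∧ (e', b') ≠ (e, b) := by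
  unfold HalfAt
  by_cases hv : Γ.vert e' b' = v
  · rw [hv, h', Function.update_self, h]
    constructor
    · rintro rfl; cases hs
    · rintro ⟨h1, h2⟩
      obtain ⟨rfl, rfl⟩ := LocalState.half.inj h1
      exact (h2 rfl).elim
  · rw [h', Function.update_of_ne hv]
    refine ⟨fun h1 => ⟨h1, ?_⟩, fun h1 => h1.1⟩
    rintro ⟨⟩
    exact hv (g.vert_eq _ _ _ h)

theorem halfAt_of_half {v : V} {e : E} {b : Bool} (h : g.st v = .half e b) : g.HalfAt e b := by
  unfold HalfAt
  rw [g.vert_eq _ _ _ h, h]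

theorem gap_face {g' : Γ.Gen} {v : V} {e : E} {b : Bool} {s : LocalState E}
    (h : g.st v = .half e b) (hs : s.isHalf = false) (h' : g'.st = Function.update g.st v s)
    (t : V → unitInterval) (e' : E) (b' : Bool) :
    g'.gap t e' b' = if (e', b') = (e, b) then 1 else g.gap t e' b' := by
  unfold gap
  by_cases he : (e', b') = (e, b)
  · rw [if_pos he, if_neg]
    rw [halfAt_face h hs h']
    exact fun h => h.2 he
  · rw [if_neg he]
    exact if_congr (by rw [halfAt_face h hs h']; exact and_iff_left he) rfl rfl

theorem gap_self {v : V} {e : E} {b : Bool} (h : g.st v = .half e b) (t : V → unitInterval) :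
    g.gap t e b = t v := by
  rw [gap, if_pos (halfAt_of_half h), g.vert_eq _ _ _ h]

theorem release_count {v : V} (hv : v ∈ g.active) (e' : E) :
    (g.release v).count e' = g.count e' := by
  obtain ⟨e, b, h⟩ := mem_active.1 hv
  have hb := halfAt_of_half h
  simp only [count, release_mult h, halfAt_face h rfl (release_st hv), Pi.add_apply]
  by_cases he : e' = e
  · subst he
    cases b
    · simp [hb]
    · simp [hb]; omega
  · simp [he]

theorem settle_count {v : V} {e : E} {b : Bool} (h : g.st v = .half e b) (e' : E) :
    (g.settle v).count e' + (if e' = e then 1 else 0) = g.count e' := by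
  have hb := halfAt_of_half h
  have hv : v ∈ g.active := mem_active.2 ⟨e, b, h⟩
  simp only [count, settle_mult, halfAt_face h rfl (settle_st hv)]
  by_cases he : e' = e
  · subst he
    cases b <;> simp [hb]
    omega
  · simp [he]

theorem range_release {v : V} (hv : v ∈ g.active) {t : V → unitInterval} (ht : t v = 1) :
    Set.range ((g.release v).point t) = Set.range (g.point t) := by
  obtain ⟨e, b, h⟩ := mem_active.1 hv
  have hgap : ∀ e' b', (g.release v).gap t e' b' = g.gap t e' b' := by
    intro e' b'
    rw [gap_face h rfl (release_st hv)]
    split_ifs with he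
    · obtain ⟨rfl, rfl⟩ := Prod.mk.inj he
      rw [gap_self h, ht]; rfl
    · rfl
  have hcoord : ∀ e' j, (g.release v).coord t e' j = g.coord t e' j := by
    intro e' j
    simp only [coord, hgap, release_count hv]
  ext x
  rw [mem_range_point, mem_range_point]
  simp only [hcoord, release_count hv]
  refine or_congr (exists_congr fun w => and_congr_left fun _ => ?_) Iff.rfl
  rw [release_st hv]
  by_cases hw : w = v
  · subst hw; simp [h]
  · simp [hw]

theorem projIcc_zero' : (Set.projIcc 0 1 zero_le_one (0 : ℝ) : unitInterval) = 0 :=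
  Set.projIcc_left _

theorem projIcc_one' : (Set.projIcc 0 1 zero_le_one (1 : ℝ) : unitInterval) = 1 :=
  Set.projIcc_right _

theorem range_settle {v : V} (hv : v ∈ g.active) {t : V → unitInterval} (ht : t v = 0) :
    Set.range ((g.settle v).point t) = Set.range (g.point t) := by
  obtain ⟨e, b, h⟩ := mem_active.1 hv
  have hcount := settle_count h
  have hvert := g.vert_eq _ _ _ h
  have hgap := gap_face h rfl (settle_st hv) t
  have hself : g.gap t e b = 0 := by rw [gap_self h, ht]; rfl
  have hce := hcount e
  rw [if_pos rfl] at hce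
  have hceR : ((g.settle v).count e : ℝ) + 1 = g.count e := by exact_mod_cast hce
  have hcoord : ∀ e' j, e' ≠ e → (g.settle v).coord t e' j = g.coord t e' j := by
    intro e' j he
    have := hcount e'
    rw [if_neg he, add_zero] at this
    have h1 : ∀ b', (e', b') ≠ (e, b) := fun b' h' => he (Prod.mk.inj h').1
    simp only [coord, hgap, h1, this, if_false]
  have hocc : ∀ w, (g.settle v).st w = .occupied ↔ w = v ∨ g.st w = .occupied := by
    intro w
    rw [settle_st hv]
    by_cases hw : w = v
    · subst hw; simp
    · simp [hw]
  -- the points on the edge `e`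
  have hedge : ∀ x, ((∃ j < (g.settle v).count e,
      Γ.edgePt e (Set.projIcc 0 1 zero_le_one ((g.settle v).coord t e j)) = x) ∨
        Γ.vertexPt v = x) ↔ ∃ j < g.count e,
      Γ.edgePt e (Set.projIcc 0 1 zero_le_one (g.coord t e j)) = x := by
    intro x
    cases b
    · have h0 : g.coord t e 0 = 0 := by simp [coord, hself]
      have hs : ∀ j, g.coord t e (j + 1) = (g.settle v).coord t e j := by
        intro j
        simp only [coord, hgap, hself, ← hceR]
        simp only [if_true, Prod.mk.injEq, true_and, reduceCtorEq, if_false]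
        push_cast
        congr 1 <;> ring
      constructor
      · rintro (⟨j, hj, rfl⟩ | rfl)
        · exact ⟨j + 1, by omega, by rw [hs]⟩
        · exact ⟨0, by omega, by rw [h0, projIcc_zero', edgePt_zero, hvert]⟩
      · rintro ⟨j, hj, rfl⟩
        cases j with
        | zero => right; rw [h0, projIcc_zero', edgePt_zero, hvert]
        | succ j => left; exact ⟨j, by omega, by rw [hs]⟩
    · have hs : ∀ j, g.coord t e j = (g.settle v).coord t e j := by
        intro j
        simp only [coord, hgap, hself, ← hceR]
        simp only [if_true, Prod.mk.injEq, true_and, reduceCtorEq, if_false]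
        congr 1
        ring
      have h1 : g.coord t e ((g.settle v).count e) = 1 := by
        have := one_le_denom (g := g) t (e := e) (by omega)
        unfold coord
        rw [div_eq_one_iff_eq (by linarith), hself, ← hceR]
        ring
      constructor
      · rintro (⟨j, hj, rfl⟩ | rfl)
        · exact ⟨j, by omega, by rw [hs]⟩
        · exact ⟨(g.settle v).count e, by omega, by rw [h1, projIcc_one', edgePt_one, hvert]⟩
      · rintro ⟨j, hj, rfl⟩
        by_cases hj' : j < (g.settle v).count e
        · left; exact ⟨j, hj', by rw [hs]⟩
        · right
          have : j = (g.settle v).count e := by omega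
          rw [this, h1, projIcc_one', edgePt_one, hvert]
  ext x
  rw [mem_range_point, mem_range_point]
  constructor
  · rintro (⟨w, hw, rfl⟩ | ⟨e', j, hj, rfl⟩)
    · rcases (hocc w).1 hw with rfl | hw
      · exact .inr ⟨e, (hedge _).1 (.inr rfl)⟩
      · exact .inl ⟨w, hw, rfl⟩
    · by_cases he : e' = e
      · subst he
        exact .inr ⟨e', (hedge _).1 (.inl ⟨j, hj, rfl⟩)⟩
      · have := hcount e'
        rw [if_neg he, add_zero] at this
        exact .inr ⟨e', j, by omega, by rw [hcoord _ _ he]⟩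
  · rintro (⟨w, hw, rfl⟩ | ⟨e', j, hj, rfl⟩)
    · exact .inl ⟨w, (hocc w).2 (.inr hw), rfl⟩
    · by_cases he : e' = e
      · subst he
        rcases (hedge _).2 ⟨j, hj, rfl⟩ with h' | h'
        · exact .inr ⟨e', h'⟩
        · exact .inl ⟨v, (hocc v).2 (.inl rfl), h'⟩
      · have := hcount e'
        rw [if_neg he, add_zero] at this
        exact .inr ⟨e', j, by omega, by rw [hcoord _ _ he]⟩

theorem point_congr {t t' : V → unitInterval} (h : ∀ v ∈ g.active, t v = t' v) :
    g.point t = g.point t' := by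
  have hgap : ∀ e b, g.gap t e b = g.gap t' e b := by
    intro e b
    unfold gap
    split_ifs with hb
    · rw [h _ hb.active]
    · rfl
  funext l
  rcases l with v | p
  · rfl
  · simp only [point, coord, hgap]

theorem orderIso_erase {k : ℕ} (s : Finset V) (hs : s.card = k + 1) (i : Fin (k + 1)) (s' : Finset V)
    (hs' : s'.card = k) (h : s' = s.erase (s.orderEmbOfFin hs i)) (j : Fin k) :
    s'.orderEmbOfFin hs' j = s.orderEmbOfFin hs (i.succAbove j) := by
  have := Finset.orderEmbOfFin_unique (s := s') hs' (f := fun j => s.orderEmbOfFin hs (i.succAbove j))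
    (fun j => by
      rw [h, Finset.mem_erase]
      exact ⟨fun h' => Fin.succAbove_ne i j ((s.orderEmbOfFin hs).injective h'),
        s.orderEmbOfFin_mem hs _⟩)
    ((s.orderEmbOfFin hs).strictMono.comp (Fin.strictMono_succAbove i))
  exact (congrFun this j).symm

theorem spread_apply {k : ℕ} (hk : g.degree = k) (t : Fin k → unitInterval) (i : Fin k) :
    g.spread hk t (g.active.orderEmbOfFin hk i) = t i := by
  have hm : g.active.orderEmbOfFin hk i ∈ g.active := g.active.orderEmbOfFin_mem hk i
  rw [spread, dif_pos hm]
  congr 1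
  rw [OrderIso.symm_apply_eq]
  exact Subtype.ext rfl

theorem exists_eq_orderEmb {k : ℕ} (hk : g.degree = k) {v : V} (hv : v ∈ g.active) :
    ∃ i, g.active.orderEmbOfFin hk i = v := by
  have : v ∈ Set.range (g.active.orderEmbOfFin hk) := by
    rw [Finset.range_orderEmbOfFin]; exact hv
  exact this

theorem cube_face {n k : ℕ} {g' : Γ.Gen} (hn : g.weight = n) (hk : g.degree = k + 1)
    (hn' : g'.weight = n) (hk' : g'.degree = k) (i : Fin (k + 1)) (a : unitInterval)
    (hact : g'.active = g.active.erase (g.active.orderEmbOfFin hk i))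
    (hrange : ∀ t : V → unitInterval, t (g.active.orderEmbOfFin hk i) = a →
      Set.range (g'.point t) = Set.range (g.point t)) :
    (g.cube hn hk).comp (cubeFace i a) = g'.cube hn' hk' := by
  ext t
  rw [ContinuousMap.comp_apply, cube_eq_iff, ← hrange _ (by rw [spread_apply]; simp [cubeFace])]
  congr 1
  refine point_congr fun v hv => ?_
  obtain ⟨j, rfl⟩ := exists_eq_orderEmb hk' hv
  rw [spread_apply, orderIso_erase g.active hk i g'.active hk' hact, spread_apply]
  simp [cubeFace]

theorem sign_orderEmb {k : ℕ} (hk : g.degree = k) (i : Fin k) :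
    g.sign (g.active.orderEmbOfFin hk i) = (-1) ^ (i : ℕ) := by
  unfold sign
  congr 1
  have : g.active.filter (· < g.active.orderEmbOfFin hk i) =
      (Finset.univ.filter (· < i)).map (g.active.orderEmbOfFin hk).toEmbedding := by
    ext v
    simp only [Finset.mem_filter, Finset.mem_map, Finset.mem_univ, true_and,
      RelEmbedding.coe_toEmbedding]
    constructor
    · rintro ⟨hv, h⟩
      obtain ⟨j, rfl⟩ := exists_eq_orderEmb hk hv
      exact ⟨j, (g.active.orderEmbOfFin hk).lt_iff_lt.1 h, rfl⟩
    · rintro ⟨j, hj, rfl⟩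
      exact ⟨g.active.orderEmbOfFin_mem hk _, (g.active.orderEmbOfFin hk).lt_iff_lt.2 hj⟩
  rw [this, Finset.card_map]
  exact (congrArg Finset.card (by ext; simp)).trans (Fin.card_Iio i)

end Gen

/-- The singular chain in the unordered configuration space given by a generator of the
Świątkowski complex (zero if weight or degree are not the right ones). -/
def genChain (n k : ℕ) (g : Γ.Gen) : (singChains (TopCat.of (UConf n Γ.Space))).X k :=
  if h : g.weight = n ∧ g.degree = k then cubeChain (g.cube h.1 h.2) else 0

/-- The linear extension of `genChain`. -/
def toSing (n k : ℕ) : Γ.Swiat →ₗ[ℤ] (singChains (TopCat.of (UConf n Γ.Space))).X k :=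
  Finsupp.linearCombination ℤ (Γ.genChain n k)

variable {Γ}

theorem toSing_single (n k : ℕ) (g : Γ.Gen) :
    Γ.toSing n k (Finsupp.single g 1) = Γ.genChain n k g :=
  (Finsupp.linearCombination_single ℤ 1 g).trans (@one_smul ℤ _ _ (_) _)

theorem genChain_of {n k : ℕ} {g : Γ.Gen} (hn : g.weight = n) (hk : g.degree = k) :
    Γ.genChain n k g = cubeChain (X := TopCat.of (UConf n Γ.Space)) (g.cube hn hk) :=
  dif_pos ⟨hn, hk⟩

theorem toSing_bdry {n k : ℕ} {g : Γ.Gen} (hn : g.weight = n) (hk : g.degree = k + 1) :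
    ((singChains (TopCat.of (UConf n Γ.Space))).d (k + 1) k).hom (Γ.genChain n (k + 1) g) =
      Γ.toSing n k g.bdry := by
  rw [genChain_of hn hk]
  refine (cubeChain_d _).trans ?_
  have h1 : g.bdry = ∑ i : Fin (k + 1), (-1 : ℤ) ^ (i : ℕ) •
      (Finsupp.single (g.release (g.active.orderEmbOfFin hk i)) 1 -
        Finsupp.single (g.settle (g.active.orderEmbOfFin hk i)) 1) := by
    have h2 : g.active = Finset.univ.map (g.active.orderEmbOfFin hk).toEmbedding := by
      ext v
      simp only [Finset.mem_map, Finset.mem_univ, true_and, RelEmbedding.coe_toEmbedding]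
      exact ⟨fun hv => Gen.exists_eq_orderEmb hk hv,
        fun ⟨i, hi⟩ => hi ▸ g.active.orderEmbOfFin_mem hk i⟩
    unfold Gen.bdry
    conv_lhs => rw [h2, Finset.sum_map]
    refine Finset.sum_congr rfl fun i _ => ?_
    rw [RelEmbedding.coe_toEmbedding, Gen.sign_orderEmb]
  rw [h1, map_sum]
  refine Finset.sum_congr rfl fun i _ => ?_
  have hm := g.active.orderEmbOfFin_mem hk i
  have d1 := Gen.degree_of_erase hm (Gen.release_active hm)
  have d2 := Gen.degree_of_erase hm (Gen.settle_active hm)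
  have d1' : (g.release (g.active.orderEmbOfFin hk i)).degree = k := by omega
  have d2' : (g.settle (g.active.orderEmbOfFin hk i)).degree = k := by omega
  have w1 := (Gen.release_weight hm).trans hn
  have w2 := (Gen.settle_weight hm).trans hn
  rw [map_zsmul, map_sub, toSing_single, toSing_single, genChain_of w1 d1', genChain_of w2 d2',
    ← Gen.cube_face hn hk w1 d1' i 1 (Gen.release_active hm) (fun t ht => Gen.range_release hm ht),
    ← Gen.cube_face hn hk w2 d2' i 0 (Gen.settle_active hm) (fun t ht => Gen.range_settle hm ht)]

theorem toSing_comm {n k : ℕ} (c : Γ.Swiat) (hc : c ∈ Γ.swiatPart n (k + 1)) :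
    ((singChains (TopCat.of (UConf n Γ.Space))).d (k + 1) k).hom (Γ.toSing n (k + 1) c) =
      Γ.toSing n k (Γ.swiatD c) := by
  refine LinearMap.mem_eqLocus.1 (swiatPart_le (N := LinearMap.eqLocus
    (((singChains (TopCat.of (UConf n Γ.Space))).d (k + 1) k).hom ∘ₗ Γ.toSing n (k + 1))
    (Γ.toSing n k ∘ₗ Γ.swiatD)) (fun g hg hk => ?_) hc)
  rw [LinearMap.mem_eqLocus, LinearMap.comp_apply, LinearMap.comp_apply, toSing_single,
    swiatD_single, toSing_bdry hg hk]

variable (Γ)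

theorem swiatComplex_d (n k : ℕ) : (Γ.swiatComplex n).d (k + 1) k =
    ModuleCat.ofHom (Γ.swiatD.restrict (swiatD_mem (n := n) (k := k))) :=
  ChainComplex.of_d (fun k => ModuleCat.of ℤ (Γ.swiatPart n k))
    (fun k => ModuleCat.ofHom (Γ.swiatD.restrict (swiatD_mem (n := n) (k := k)))) k

/-- The comparison map from the Świątkowski complex to the singular chains of the unordered
configuration space, which maps each generator to its cube. It induces the standard identification
of the homology of the Świątkowski complex with that of the configuration space. -/
def swiatToSing (n : ℕ) : Γ.swiatComplex n ⟶ singChains (TopCat.of (UConf n Γ.Space)) where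
  f k := ModuleCat.ofHom (Γ.toSing n k ∘ₗ (Γ.swiatPart n k).subtype)
  comm' := by
    rintro _ k rfl
    refine ModuleCat.hom_ext (LinearMap.ext fun c => ?_)
    rw [swiatComplex_d]
    exact toSing_comm c.1 c.2

end Multigraph

/-! ### The contraction of a subtree on the Świątkowski complex -/

/-- The state of a vertex of `Γ` outside `T` given by a state of the same vertex of `Γ / T`. -/
def LocalState.val {E : Type} {p : E → Prop} : LocalState {e // p e} → LocalState E
  | .empty => .empty
  | .occupied => .occupied
  | .half e b => .half e.1 b

theorem LocalState.isHalf_val {E : Type} {p : E → Prop} (s : LocalState {e // p e}) :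
    s.val.isHalf = s.isHalf := by cases s <;> rfl

theorem LocalState.val_eq_half {E : Type} {p : E → Prop} {s : LocalState {e // p e}} {e : E} {b : Bool}
    (h : s.val = .half e b) : ∃ e' : {e // p e}, s = .half e' b ∧ e'.1 = e := by
  cases s with
  | empty => cases h
  | occupied => cases h
  | half e' b' => cases h; exact ⟨e', rfl, rfl⟩

namespace Multigraph

variable {V E : Type} {Γ : Multigraph V E} [Fintype V] [LinearOrder V] [DecidableEq E]

namespace Gen

variable (g : Γ.Gen)

/-- Insertion of the half-edge `h = (e, b)` as a tensor factor at its vertex, with the Koszul sign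
for moving it there from the first position. -/
def putHalf (e : E) (b : Bool) : Γ.Swiat :=
  g.sign (Γ.vert e b) • Finsupp.single
    (g.setState (Γ.vert e b) (.half e b) (by rintro _ _ ⟨⟩; rfl)) 1

/-- Insertion of the sum, over the edges `e` of an edge path, of the differences `h - h'` of the two
half-edges of `e`, where `h` comes before `h'` on the path. -/
def putPath (l : List (E × Bool)) : Γ.Swiat :=
  (l.map fun d => g.putHalf d.1 d.2 - g.putHalf d.1 (!d.2)).sum

/-- Insertion of a vertex. -/
def putVertex (v : V) : Γ.Swiat := Finsupp.single (g.setState v .occupied (by simp)) 1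

end Gen

namespace Subgraph

variable (T : Γ.Subgraph)

/-- The generator of the Świątkowski complex of `Γ` which agrees with the generator `g` of the
complex of `Γ / T` outside `T` and is trivial on `T`. -/
def liftGen (g : T.contract.Gen) : Γ.Gen where
  st v := if h : v ∈ T.verts then .empty
    else (g.st ((⟨v, h⟩ : {v : V // v ∉ T.verts}) : WithBot _)).val
  mult e := if h : e ∈ T.edges then 0 else g.mult ⟨e, h⟩
  vert_eq v e b h := by
    by_cases hv : v ∈ T.verts
    · simp [hv] at h
    · simp only [hv, dite_false] at h
      obtain ⟨e', hs, rfl⟩ := LocalState.val_eq_half h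
      have h1 := g.vert_eq _ _ _ hs
      by_cases hw : Γ.vert e'.1 b ∈ T.verts
      · simp [contract, collapseVert, hw] at h1
      · simp only [contract, collapseVert, hw, dite_false] at h1
        exact congrArg Subtype.val (WithBot.coe_injective h1)

/-- The image of a basis element of the local factor `S(⊥)` of the vertex `⊥ = [T]` of `Γ / T`,
inserted into a generator that is trivial on `T`. The trivial element is mapped to the trivial
element, the vertex to the vertex `r` of `T`, and a half-edge `h` to the sum of `h` and the
differences of half-edges along the path in `T` from `r` to the vertex of `h`. -/
def putLocal (r : V) (s : LocalState {e : E // e ∉ T.edges}) (g : Γ.Gen) : Γ.Swiat :=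
  match s with
  | .empty => Finsupp.single g 1
  | .occupied => g.putVertex r
  | .half e b => g.putHalf e b + g.putPath (T.path r (Γ.vert e b))

/-- The contraction map `S(Γ / T) → S(Γ)`. On the reduced complexes it is the map that sends
a difference `h - h'` of two half-edges at the vertex `[T]` to the sum of the differences of the
half-edges through which the path `h, (path in T), h'` passes at each vertex of `T`, and is the
identity on the other factors. The choice of the vertex `r` matters only for the unreduced
complexes. -/
def swiatContract (r : V) : T.contract.Swiat →ₗ[ℤ] Γ.Swiat :=
  Finsupp.linearCombination ℤ fun g => T.putLocal r (g.st ⊥) (T.liftGen g)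

end Subgraph

namespace Gen

variable {g : Γ.Gen}

theorem mem_active_iff {v : V} : v ∈ g.active ↔ (g.st v).isHalf = true := by
  simp only [active, Finset.mem_filter, Finset.mem_univ, true_and]

theorem active_setState_half {v : V} (hv : g.st v = .empty) {e : E} {b : Bool}
    (hs : ∀ e' b', LocalState.half e b = .half e' b' → Γ.vert e' b' = v) :
    v ∉ g.active ∧ (g.setState v (.half e b) hs).active = insert v g.active := by
  constructor
  · rw [mem_active_iff, hv]; simp [LocalState.isHalf]
  · ext w
    rw [Finset.mem_insert, mem_active_iff, mem_active_iff]
    simp only [setState]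
    by_cases hw : w = v
    · subst hw; simp [LocalState.isHalf]
    · simp [hw]

theorem active_setState_occupied {v : V} (hv : g.st v = .empty) :
    (g.setState v .occupied (by simp)).active = g.active := by
  ext w
  rw [mem_active_iff, mem_active_iff]
  simp only [setState]
  by_cases hw : w = v
  · subst hw; simp [LocalState.isHalf, hv]
  · simp [hw]

theorem sign_insert {g' : Γ.Gen} {v : V} (hv : v ∉ g.active) (h : g'.active = insert v g.active)
    (w : V) : g'.sign w = (if v < w then -1 else 1) * g.sign w := by
  unfold sign
  rw [h, Finset.filter_insert]
  split_ifs with hvw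
  · rw [Finset.card_insert_of_notMem (by simp [hv]), pow_succ]
    ring
  · rw [one_mul]

theorem release_setState {v w : V} (hw : w ∈ g.active) (hvw : w ≠ v) (s : LocalState E)
    (hs : ∀ e b, s = .half e b → Γ.vert e b = v) :
    (g.setState v s hs).release w = (g.release w).setState v s hs := by
  obtain ⟨e, b, he⟩ := mem_active.1 hw
  have he' : (g.setState v s hs).st w = .half e b := by simp [setState, hvw, he]
  have hw' : w ∈ (g.setState v s hs).active := mem_active.2 ⟨e, b, he'⟩
  refine Gen.ext ?_ ?_
  · rw [release_st hw']
    change _ = Function.update (g.release w).st v s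
    rw [release_st hw]
    exact Function.update_comm hvw.symm _ _ _
  · rw [release_mult he']
    change _ = (g.release w).mult
    rw [release_mult he]; rfl

theorem settle_setState {v w : V} (hw : w ∈ g.active) (hvw : w ≠ v) (s : LocalState E)
    (hs : ∀ e b, s = .half e b → Γ.vert e b = v) :
    (g.setState v s hs).settle w = (g.settle w).setState v s hs := by
  obtain ⟨e, b, he⟩ := mem_active.1 hw
  have he' : (g.setState v s hs).st w = .half e b := by simp [setState, hvw, he]
  have hw' : w ∈ (g.setState v s hs).active := mem_active.2 ⟨e, b, he'⟩
  refine Gen.ext ?_ ?_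
  · rw [settle_st hw']
    change _ = Function.update (g.settle w).st v s
    rw [settle_st hw]
    exact Function.update_comm hvw.symm _ _ _
  · rw [settle_mult]
    change _ = (g.settle w).mult
    rw [settle_mult]; rfl

/-- The differential of `g`, composed with some function of generators. -/
def bdryWith (F : Γ.Gen → Γ.Swiat) (g : Γ.Gen) : Γ.Swiat :=
  ∑ w ∈ g.active, g.sign w • (F (g.release w) - F (g.settle w))

theorem bdryWith_sub (F F' : Γ.Gen → Γ.Swiat) (g : Γ.Gen) :
    bdryWith (fun g => F g - F' g) g = bdryWith F g - bdryWith F' g := by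
  unfold bdryWith
  rw [← Finset.sum_sub_distrib]
  exact Finset.sum_congr rfl fun w _ => by module

theorem bdryWith_add (F F' : Γ.Gen → Γ.Swiat) (g : Γ.Gen) :
    bdryWith (fun g => F g + F' g) g = bdryWith F g + bdryWith F' g := by
  unfold bdryWith
  rw [← Finset.sum_add_distrib]
  exact Finset.sum_congr rfl fun w _ => by module

/-- Multiplication with an edge. -/
def addEdge (g : Γ.Gen) (e : E) : Γ.Gen := { g with mult := g.mult + Pi.single e 1 }

theorem swiatD_putVertex {v : V} (hv : g.st v = .empty) :
    Γ.swiatD (g.putVertex v) = bdryWith (fun g => g.putVertex v) g := by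
  unfold putVertex bdryWith
  rw [swiatD_single, bdry]
  have ha := active_setState_occupied hv
  rw [ha]
  refine Finset.sum_congr rfl fun w hw => ?_
  have hvw : w ≠ v := by
    rintro rfl
    obtain ⟨e, b, he⟩ := mem_active.1 hw
    rw [hv] at he; cases he
  rw [release_setState hw hvw, settle_setState hw hvw]
  unfold sign
  rw [ha]

theorem swiatD_putHalf {e : E} {b : Bool} (hv : g.st (Γ.vert e b) = .empty) :
    Γ.swiatD (g.putHalf e b) = Finsupp.single (g.addEdge e) 1 - g.putVertex (Γ.vert e b)
      - bdryWith (fun g => g.putHalf e b) g := by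
  have hs : ∀ e' b', LocalState.half e b = .half e' b' → Γ.vert e' b' = Γ.vert e b := by
    rintro _ _ ⟨⟩; rfl
  obtain ⟨hna, ha⟩ := active_setState_half hv hs
  set g' := g.setState (Γ.vert e b) (.half e b) hs with hg'
  have hst : g'.st (Γ.vert e b) = .half e b := by simp [hg', setState]
  have hsq : ∀ w, g.sign w * g.sign w = 1 := fun w => by
    unfold sign; rw [← pow_add, ← two_mul, pow_mul]; simp
  have h1 : g'.release (Γ.vert e b) = g.addEdge e := by
    refine Gen.ext ?_ ?_
    · rw [release_st (mem_active.2 ⟨e, b, hst⟩)]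
      simp only [hg', setState, addEdge, Function.update_idem]
      rw [← hv, Function.update_eq_self]
    · rw [release_mult hst]; rfl
  have h2 : g'.settle (Γ.vert e b) = g.setState (Γ.vert e b) .occupied (by simp) := by
    refine Gen.ext ?_ ?_
    · rw [settle_st (mem_active.2 ⟨e, b, hst⟩)]
      simp only [hg', setState, Function.update_idem]
    · rw [settle_mult]; rfl
  unfold putHalf
  rw [map_zsmul, swiatD_single, bdry, ha, Finset.sum_insert hna, h1, h2, smul_add, smul_smul]
  have h3 : g'.sign (Γ.vert e b) = g.sign (Γ.vert e b) := by
    rw [sign_insert hna ha]; simp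
  rw [h3, hsq, one_smul, sub_eq_add_neg (_ - _) (bdryWith _ _)]
  congr 1
  unfold bdryWith
  rw [← Finset.sum_neg_distrib, Finset.smul_sum]
  refine Finset.sum_congr rfl fun w hw => ?_
  have hvw : w ≠ Γ.vert e b := by rintro rfl; exact hna hw
  dsimp only
  rw [sign_insert hna ha, release_setState hw hvw, settle_setState hw hvw,
    sign_of_erase hw (release_active hw), sign_of_erase hw (settle_active hw)]
  rcases lt_or_gt_of_ne hvw with h | h
  · simp only [h, h.not_gt, if_true, if_false]
    module
  · simp only [h, h.not_gt, if_true, if_false]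
    module

theorem swiatD_putPath {l : List (E × Bool)} {v w : V} (hl : Γ.IsWalk v l w)
    (h : ∀ d ∈ l, ∀ b, g.st (Γ.vert d.1 b) = .empty) :
    Γ.swiatD (g.putPath l) =
      g.putVertex w - g.putVertex v - bdryWith (fun g => g.putPath l) g := by
  induction l generalizing v with
  | nil =>
    have hvw : v = w := hl
    subst hvw
    simp [putPath, bdryWith]
  | cons d l ih =>
    obtain ⟨h1, h2⟩ := hl
    have hd := h d (List.mem_cons_self)
    have ih' := ih h2 fun d' hd' => h d' (List.mem_cons_of_mem _ hd')
    have hcons : ∀ g : Γ.Gen, g.putPath (d :: l) =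
        (g.putHalf d.1 d.2 - g.putHalf d.1 (!d.2)) + g.putPath l := fun g => by simp [putPath]
    simp only [hcons]
    rw [bdryWith_add, bdryWith_sub, map_add, map_sub, ih', swiatD_putHalf (hd _),
      swiatD_putHalf (hd _), ← h1]
    abel

end Gen

namespace Subgraph

variable {T : Γ.Subgraph} {g : T.contract.Gen}

theorem liftGen_st_of_mem {v : V} (hv : v ∈ T.verts) : (T.liftGen g).st v = .empty := by
  simp [liftGen, hv]

theorem liftGen_st (v : {v : V // v ∉ T.verts}) :
    (T.liftGen g).st v.1 = (g.st (v : WithBot _)).val := by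
  simp [liftGen, v.2]

theorem mem_active_liftGen (v : {v : V // v ∉ T.verts}) :
    v.1 ∈ (T.liftGen g).active ↔ (v : WithBot {v : V // v ∉ T.verts}) ∈ g.active := by
  rw [Gen.mem_active_iff, Gen.mem_active_iff, liftGen_st, LocalState.isHalf_val]

theorem notMem_of_active {v : V} (hv : v ∈ (T.liftGen g).active) : v ∉ T.verts := by
  intro h
  obtain ⟨e, b, he⟩ := Gen.mem_active.1 hv
  rw [liftGen_st_of_mem h] at he
  cases he

/-- The active vertices of `g` other than `⊥` are those of its lift. -/
theorem active_erase : g.active.erase ⊥ =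
    ((T.liftGen g).active.subtype fun v => v ∉ T.verts).map
      ⟨(WithBot.some : {v : V // v ∉ T.verts} → WithBot {v : V // v ∉ T.verts}),
        WithBot.coe_injective⟩ := by
  ext w
  rw [Finset.mem_erase, Finset.mem_map]
  constructor
  · rintro ⟨hw, h⟩
    obtain ⟨v, rfl⟩ := WithBot.ne_bot_iff_exists.1 hw
    exact ⟨v, Finset.mem_subtype.2 ((mem_active_liftGen v).2 h), rfl⟩
  · rintro ⟨v, hv, rfl⟩
    exact ⟨WithBot.coe_ne_bot, (mem_active_liftGen v).1 (Finset.mem_subtype.1 hv)⟩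

theorem sum_active_erase {M : Type*} [AddCommMonoid M]
    (F : WithBot {v : V // v ∉ T.verts} → M) (F' : V → M)
    (h : ∀ v : {v : V // v ∉ T.verts}, (v : WithBot {v : V // v ∉ T.verts}) ∈ g.active → F v = F' v.1) :
    ∑ w ∈ g.active.erase ⊥, F w = ∑ v ∈ (T.liftGen g).active, F' v := by
  rw [active_erase, Finset.sum_map, ← Finset.sum_subtype_of_mem F' fun v hv => notMem_of_active hv]
  refine Finset.sum_congr rfl fun v hv => ?_
  exact h v ((mem_active_liftGen v).1 (Finset.mem_subtype.1 hv))

theorem card_active_erase : (g.active.erase ⊥).card = (T.liftGen g).active.card := by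
  rw [Finset.card_eq_sum_ones, Finset.card_eq_sum_ones]
  exact sum_active_erase _ _ fun _ _ => rfl

theorem sign_lift (v : {v : V // v ∉ T.verts}) :
    g.sign (v : WithBot {v : V // v ∉ T.verts}) =
      (if ⊥ ∈ g.active then -1 else 1) * (T.liftGen g).sign v.1 := by
  have h1 : ((g.active.erase ⊥).filter (· < (v : WithBot {v : V // v ∉ T.verts}))).card =
      ((T.liftGen g).active.filter (· < v.1)).card := by
    rw [Finset.card_filter, Finset.card_filter]
    refine sum_active_erase _ _ fun w _ => ?_
    exact if_congr (by rw [WithBot.coe_lt_coe]; rfl) rfl rfl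
  unfold Gen.sign
  rw [← h1, Finset.filter_erase]
  split_ifs with h
  · have hm : ⊥ ∈ g.active.filter (· < (v : WithBot {v : V // v ∉ T.verts})) :=
      Finset.mem_filter.2 ⟨h, WithBot.bot_lt_coe v⟩
    rw [← Finset.card_erase_add_one hm, pow_succ]
    ring
  · rw [Finset.erase_eq_of_notMem (by simp [h]), one_mul]

theorem liftGen_face {g' : T.contract.Gen} {v : {v : V // v ∉ T.verts}}
    {s : LocalState {e : E // e ∉ T.edges}}
    (h : g'.st = Function.update g.st (v : WithBot {v : V // v ∉ T.verts}) s) :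
    (T.liftGen g').st = Function.update (T.liftGen g).st v.1 s.val := by
  funext w
  by_cases hw : w ∈ T.verts
  · rw [liftGen_st_of_mem hw, Function.update_of_ne (by rintro rfl; exact v.2 hw),
      liftGen_st_of_mem hw]
  · have h1 := liftGen_st (g := g') ⟨w, hw⟩
    have h2 := liftGen_st (g := g) ⟨w, hw⟩
    dsimp only at h1 h2
    rw [h1, h]
    by_cases hvw : w = v.1
    · subst hvw; simp
    · have : ((⟨w, hw⟩ : {v : V // v ∉ T.verts}) : WithBot {v : V // v ∉ T.verts}) ≠ v := by
        intro h3; exact hvw (congrArg Subtype.val (WithBot.coe_injective h3))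
      rw [Function.update_of_ne this, Function.update_of_ne hvw, h2]

theorem liftGen_mult_add {g' : T.contract.Gen} {e : {e : E // e ∉ T.edges}}
    (h : g'.mult = g.mult + Pi.single e 1) :
    (T.liftGen g').mult = (T.liftGen g).mult + Pi.single e.1 1 := by
  funext e'
  simp only [liftGen, h, Pi.add_apply]
  split_ifs with he
  · have : e' ≠ e.1 := by rintro rfl; exact e.2 he
    simp [this]
  · simp [Pi.single_apply, Subtype.ext_iff]

theorem liftGen_release {v : {v : V // v ∉ T.verts}}
    (hv : (v : WithBot {v : V // v ∉ T.verts}) ∈ g.active) :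
    T.liftGen (g.release v) = (T.liftGen g).release v.1 := by
  have hv' := (mem_active_liftGen v).2 hv
  obtain ⟨e, b, he⟩ := Gen.mem_active.1 hv
  refine Gen.ext ?_ ?_
  · rw [liftGen_face (Gen.release_st hv), Gen.release_st hv']; rfl
  · rw [liftGen_mult_add (Gen.release_mult he), Gen.release_mult (e := e.1) (b := b)]
    rw [liftGen_st, he]; rfl

theorem liftGen_settle {v : {v : V // v ∉ T.verts}}
    (hv : (v : WithBot {v : V // v ∉ T.verts}) ∈ g.active) :
    T.liftGen (g.settle v) = (T.liftGen g).settle v.1 := by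
  have hv' := (mem_active_liftGen v).2 hv
  refine Gen.ext ?_ ?_
  · rw [liftGen_face (Gen.settle_st hv), Gen.settle_st hv']; rfl
  · rw [Gen.settle_mult]
    simp only [liftGen, Gen.settle_mult]

theorem liftGen_of_bot {g' : T.contract.Gen} {s : LocalState {e : E // e ∉ T.edges}}
    (h : g'.st = Function.update g.st ⊥ s) : (T.liftGen g').st = (T.liftGen g).st := by
  funext w
  by_cases hw : w ∈ T.verts
  · rw [liftGen_st_of_mem hw, liftGen_st_of_mem hw]
  · have h1 := liftGen_st (g := g') ⟨w, hw⟩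
    have h2 := liftGen_st (g := g) ⟨w, hw⟩
    dsimp only at h1 h2
    rw [h1, h2, h, Function.update_of_ne WithBot.coe_ne_bot]

theorem swiatContract_single (r : V) : T.swiatContract r (Finsupp.single g 1) =
    T.putLocal r (g.st ⊥) (T.liftGen g) := by
  simp [swiatContract]

theorem sum_active_contract (r : V) : ∑ w ∈ g.active.erase ⊥, g.sign w •
    (T.swiatContract r (Finsupp.single (g.release w) 1) -
      T.swiatContract r (Finsupp.single (g.settle w) 1)) =
    (if ⊥ ∈ g.active then (-1 : ℤ) else 1) •
      Gen.bdryWith (T.putLocal r (g.st ⊥)) (T.liftGen g) := by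
  unfold Gen.bdryWith
  rw [Finset.smul_sum]
  refine sum_active_erase _ (fun v => (if ⊥ ∈ g.active then (-1 : ℤ) else 1) •
    (T.liftGen g).sign v • (T.putLocal r (g.st ⊥) ((T.liftGen g).release v) -
      T.putLocal r (g.st ⊥) ((T.liftGen g).settle v))) fun v hv => ?_
  rw [swiatContract_single, swiatContract_single, sign_lift, liftGen_release hv, liftGen_settle hv,
    mul_smul, Gen.st_of_ne WithBot.bot_ne_coe (Gen.release_st hv),
    Gen.st_of_ne WithBot.bot_ne_coe (Gen.settle_st hv)]

/-- A half-edge of `Γ / T` at the vertex `⊥` is a half-edge of `Γ` at a vertex of `T`. -/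
theorem vert_mem_of_bot {e : {e : E // e ∉ T.edges}} {b : Bool} (h : g.st ⊥ = .half e b) :
    Γ.vert e.1 b ∈ T.verts := by
  have h1 := g.vert_eq _ _ _ h
  by_contra hw
  simp [contract, collapseVert, hw] at h1

theorem isPath_path (hT : T.IsTree) {v w : V} (hv : v ∈ T.verts) (hw : w ∈ T.verts) :
    T.IsPath v (T.path v w) w := by
  have h := (hT.2 v hv w hw).exists
  rw [path, dif_pos h]
  exact h.choose_spec

theorem swiatContract_comm (hT : T.IsTree) {r : V} (hr : r ∈ T.verts) (c : T.contract.Swiat) :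
    Γ.swiatD (T.swiatContract r c) = T.swiatContract r (T.contract.swiatD c) := by
  suffices h : Γ.swiatD ∘ₗ T.swiatContract r = T.swiatContract r ∘ₗ T.contract.swiatD from
    LinearMap.congr_fun h c
  ext1 g
  ext1
  simp only [LinearMap.comp_apply, Finsupp.lsingle_apply]
  rw [swiatContract_single, swiatD_single, Gen.bdry, map_sum]
  simp only [map_zsmul, map_sub]
  have hlift : ∀ v ∈ T.verts, (T.liftGen g).st v = .empty := fun v hv => liftGen_st_of_mem hv
  have hrest := sum_active_contract (g := g) r
  cases hs : g.st ⊥ with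
  | empty =>
    have hb : ⊥ ∉ g.active := by rw [Gen.mem_active_iff, hs]; simp [LocalState.isHalf]
    rw [Finset.erase_eq_of_notMem hb, if_neg hb, one_smul, hs] at hrest
    rw [hrest]
    exact swiatD_single _
  | occupied =>
    have hb : ⊥ ∉ g.active := by rw [Gen.mem_active_iff, hs]; simp [LocalState.isHalf]
    rw [Finset.erase_eq_of_notMem hb, if_neg hb, one_smul, hs] at hrest
    rw [hrest]
    exact Gen.swiatD_putVertex (hlift r hr)
  | half e b =>
    have hb : ⊥ ∈ g.active := Gen.mem_active.2 ⟨e, b, hs⟩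
    rw [if_pos hb, hs] at hrest
    rw [← Finset.add_sum_erase _ _ hb, hrest]
    have hv := vert_mem_of_bot hs
    obtain ⟨hp1, -, hp2⟩ := isPath_path hT hr hv
    have h1 : T.putLocal r (.half e b) = fun g : Γ.Gen =>
        g.putHalf e.1 b + g.putPath (T.path r (Γ.vert e.1 b)) := rfl
    have hsign : g.sign ⊥ = 1 := by simp [Gen.sign]
    have hrel : T.swiatContract r (Finsupp.single (g.release ⊥) 1) =
        Finsupp.single ((T.liftGen g).addEdge e.1) 1 := by
      rw [swiatContract_single, show (g.release ⊥).st ⊥ = .empty by rw [Gen.release_st hb]; simp]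
      refine congrArg (fun g => Finsupp.single g 1) (Gen.ext ?_ ?_)
      · exact liftGen_of_bot (Gen.release_st hb)
      · exact liftGen_mult_add (Gen.release_mult hs)
    have hset : T.swiatContract r (Finsupp.single (g.settle ⊥) 1) =
        (T.liftGen g).putVertex r := by
      rw [swiatContract_single, show (g.settle ⊥).st ⊥ = .occupied by rw [Gen.settle_st hb]; simp]
      have : T.liftGen (g.settle ⊥) = T.liftGen g := by
        refine Gen.ext (liftGen_of_bot (Gen.settle_st hb)) ?_
        simp only [liftGen, Gen.settle_mult]
      rw [this]; rfl
    rw [hrel, hset, hsign, h1, Gen.bdryWith_add, map_add, Gen.swiatD_putHalf (hlift _ hv),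
      Gen.swiatD_putPath hp1 fun d hd b => hlift _ (T.vert_mem _ (hp2 d hd) b)]
    module

variable [Fintype E]

theorem liftGen_weight :
    (T.liftGen g).weight + (if g.st ⊥ = .empty then 0 else 1) = g.weight := by
  have h1 : ∑ e, (T.liftGen g).mult e = ∑ e, g.mult e := by
    rw [← Finset.sum_subset (Finset.subset_univ (Finset.univ.filter fun e => e ∉ T.edges))]
    · rw [Finset.sum_subtype (p := fun e => e ∉ T.edges) _ (fun e => by simp)]
      exact Finset.sum_congr rfl fun e _ => dif_neg e.2
    · intro e _ he
      have : e ∈ T.edges := by simpa using he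
      exact dif_pos this
  have h2 : (Finset.univ.filter fun w => g.st w ≠ .empty).card = (if g.st ⊥ = .empty then 0 else 1) +
      ∑ v : {v : V // v ∉ T.verts},
        (if g.st (v : WithBot {v : V // v ∉ T.verts}) ≠ .empty then 1 else 0) := by
    rw [Finset.card_filter]
    refine (Fintype.sum_option _).trans (congrArg₂ _ ?_ rfl)
    change (if g.st ⊥ ≠ .empty then 1 else 0) = _
    split_ifs <;> simp_all
  have h3 : (Finset.univ.filter fun v => (T.liftGen g).st v ≠ .empty).card =
      ∑ v : {v : V // v ∉ T.verts},
        (if g.st (v : WithBot {v : V // v ∉ T.verts}) ≠ .empty then 1 else 0) := by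
    rw [Finset.card_filter,
      ← Finset.sum_subset (Finset.subset_univ (Finset.univ.filter fun v => v ∉ T.verts))]
    · rw [Finset.sum_subtype (p := fun v => v ∉ T.verts) _ (fun v => by simp)]
      refine Finset.sum_congr rfl fun v _ => if_congr ?_ rfl rfl
      rw [liftGen_st]
      cases g.st (v : WithBot {v : V // v ∉ T.verts}) <;> simp [LocalState.val]
    · intro v _ hv
      have : v ∈ T.verts := by simpa using hv
      simp [liftGen_st_of_mem this]
  unfold Gen.weight
  rw [h1, h2, h3]
  omega

theorem liftGen_degree : (T.liftGen g).degree + (if (g.st ⊥).isHalf then 1 else 0) = g.degree := by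
  have h := card_active_erase (g := g)
  change (T.liftGen g).active.card + _ = g.active.card
  rw [← h]
  split_ifs with hb
  · exact Finset.card_erase_add_one (Gen.mem_active_iff.2 hb)
  · rw [Finset.erase_eq_of_notMem (by rwa [Gen.mem_active_iff]), add_zero]

end Subgraph

theorem Gen.setState_weight [Fintype E] {g : Γ.Gen} {v : V} {s : LocalState E} (hv : g.st v = .empty)
    (hs : s ≠ .empty) (hs' : ∀ e b, s = .half e b → Γ.vert e b = v) :
    (g.setState v s hs').weight = g.weight + 1 := by
  have : (Finset.univ.filter fun w => (g.setState v s hs').st w ≠ .empty) =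
      insert v (Finset.univ.filter fun w => g.st w ≠ .empty) := by
    ext w
    rw [Finset.mem_insert, Finset.mem_filter, Finset.mem_filter]
    change _ ∧ Function.update g.st v s w ≠ .empty ↔ _
    by_cases hw : w = v
    · subst hw; simp [hs]
    · simp [hw]
  unfold weight
  rw [this, Finset.card_insert_of_notMem (by simp [hv])]
  rfl

variable [Fintype E]

theorem Gen.putHalf_mem {n k : ℕ} {g : Γ.Gen} {e : E} {b : Bool}
    (hv : g.st (Γ.vert e b) = .empty) (hn : g.weight + 1 = n) (hk : g.degree + 1 = k) :
    g.putHalf e b ∈ Γ.swiatPart n k := by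
  have hs : ∀ e' b', LocalState.half e b = .half e' b' → Γ.vert e' b' = Γ.vert e b := by
    rintro _ _ ⟨⟩; rfl
  obtain ⟨hna, ha⟩ := Gen.active_setState_half hv hs
  refine Submodule.smul_mem _ _ (single_mem_swiatPart ?_ ?_)
  · rw [Gen.setState_weight hv (by simp), hn]
  · change (Finset.card _) = k
    rw [ha, Finset.card_insert_of_notMem hna]
    exact hk

theorem Gen.putPath_mem {n k : ℕ} {g : Γ.Gen} {l : List (E × Bool)}
    (h : ∀ d ∈ l, ∀ b, g.st (Γ.vert d.1 b) = .empty) (hn : g.weight + 1 = n)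
    (hk : g.degree + 1 = k) : g.putPath l ∈ Γ.swiatPart n k := by
  refine list_sum_mem fun x hx => ?_
  obtain ⟨d, hd, rfl⟩ := List.mem_map.1 hx
  exact Submodule.sub_mem _ (Gen.putHalf_mem (h d hd _) hn hk) (Gen.putHalf_mem (h d hd _) hn hk)

namespace Subgraph

variable {T : Γ.Subgraph}

theorem swiatContract_mem (hT : T.IsTree) {r : V} (hr : r ∈ T.verts) {n k : ℕ}
    (c : T.contract.Swiat) (hc : c ∈ T.contract.swiatPart n k) :
    T.swiatContract r c ∈ Γ.swiatPart n k := by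
  refine swiatPart_le (N := (Γ.swiatPart n k).comap (T.swiatContract r)) (fun g hg hk => ?_) hc
  rw [Submodule.mem_comap, swiatContract_single]
  have hw := liftGen_weight (g := g)
  have hd := liftGen_degree (g := g)
  have hlift : ∀ v ∈ T.verts, (T.liftGen g).st v = .empty := fun v hv => liftGen_st_of_mem hv
  cases hs : g.st ⊥ with
  | empty =>
    simp only [hs, LocalState.isHalf, if_true, Bool.false_eq_true, if_false, add_zero] at hw hd
    exact single_mem_swiatPart (hw.trans hg) (hd.trans hk)
  | occupied =>
    simp only [hs, LocalState.isHalf, reduceCtorEq, Bool.false_eq_true, if_false, add_zero] at hw hd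
    refine single_mem_swiatPart ?_ ?_
    · rw [Gen.setState_weight (hlift r hr) (by simp), hw, hg]
    · change Finset.card _ = k
      rw [Gen.active_setState_occupied (hlift r hr)]
      exact hd.trans hk
  | half e b =>
    simp only [hs, LocalState.isHalf, reduceCtorEq, if_true, if_false] at hw hd
    have hv := vert_mem_of_bot hs
    obtain ⟨hp1, -, hp2⟩ := isPath_path hT hr hv
    exact Submodule.add_mem _ (Gen.putHalf_mem (hlift _ hv) (hw.trans hg) (hd.trans hk))
      (Gen.putPath_mem (fun d hd' b => hlift _ (T.vert_mem _ (hp2 d hd') b)) (hw.trans hg)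
        (hd.trans hk))

/-- The contraction of the tree `T`, as a chain map `S(Γ / T) → S(Γ)` in weight `n`. -/
def contractChain (hT : T.IsTree) {r : V} (hr : r ∈ T.verts) (n : ℕ) :
    T.contract.swiatComplex n ⟶ Γ.swiatComplex n where
  f k := ModuleCat.ofHom ((T.swiatContract r).restrict (swiatContract_mem hT hr (n := n) (k := k)))
  comm' := by
    rintro _ k rfl
    refine ModuleCat.hom_ext (LinearMap.ext fun c => Subtype.ext ?_)
    rw [swiatComplex_d, swiatComplex_d]
    exact swiatContract_comm hT hr c.1

end Subgraph

end Multigraph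


/-- The map of singular chain complexes induced by a continuous map. -/
def singMap {X Y : Type} [TopologicalSpace X] [TopologicalSpace Y] (f : C(X, Y)) :
    singChains (TopCat.of X) ⟶ singChains (TopCat.of Y) :=
  ((AlgebraicTopology.singularChainComplexFunctor (ModuleCat.{0} ℤ)).obj (ModuleCat.of ℤ ℤ)).map
    (TopCat.ofHom f)

namespace Multigraph.Subgraph

variable {V E : Type} {Γ : Multigraph V E} [DecidableEq V] [DecidableEq E]

/-- The map `UConf n (Γ / T) → UConf n Γ` given by the span
`UConf n (Γ / T) ← UConfLE n 1 (Γ / T) (U / T) → UConfLE n 1 Γ U → UConf n Γ`,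
where `h` is a homotopy equivalence that provides a homotopy inverse of the first map. -/
def spanMap (T : Γ.Subgraph) (hT : T.IsTree) {ε : ℝ} {f : C(T.contract.Space, Γ.Space)}
    (hf : T.IsExpansion ε f) (n : ℕ)
    (h : ContinuousMap.HomotopyEquiv (UConfLE n 1 T.contract.Space (T.nhdContract ε))
      (UConf n T.contract.Space)) : C(UConf n T.contract.Space, UConf n Γ.Space) :=
  (UConfLE.incl n 1 (T.nhd ε)).comp ((UConfLE.push n (hf.pushable hT.1)).comp h.invFun)

end Multigraph.Subgraph

end

end SubtreeContraction

open SubtreeContraction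

/-!
The proof rests on two homotopies of graphs, and on an explicit chain homotopy.

*Homotopy equivalences.* In `Γ / T` the neighbourhood `U / T` is an open star around the vertex
`[T]`, and there is a radial flow away from `[T]` (`Multigraph.radialFlow`). It exists on a star
slightly larger than `U / T`, which is what the condition on `ε` for loops at `[T]` is for. Flowing
a configuration for a sufficiently long time, which depends continuously on the configuration, drives
all but one point out of `U / T`; this gives the inverse of the inclusion of the configurations with
at most one point in `U / T` (`RadialFlow.isHomotopyEquiv_incl`). Contracting the tree to a root `r`
inside of `U` factors, at its end, as `Γ → Γ / T → Γ`, and the second map is an expansion `f₀`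
(`expansion`); its composite with the collapse map is homotopic to the identity of `Γ`. For any other
expansion `f`, the composite `Γ / T → Γ → Γ / T` is the identity outside `U / T`, hence homotopic to
the identity by the Alexander trick along the flow (`RadialFlow.pushHomotopic_id`). All homotopies
preserve `U` or `U / T` and are constant outside, so that they can be applied to configurations with
at most one point there. Thus all expansions induce homotopic homotopy equivalences
(`IsExpansion.isHomotopyEquiv_push`).

*Reduced complexes.* An element of the Świątkowski complex is reduced if and only if it has no
occupied vertices and is annihilated, for every vertex `w`, by the derivation `dropHalf w` that maps
the half-edges at `w` to `∅` (`mem_reducedSwiat_iff`). At a vertex of the tree other than `r`, the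
half-edges by which a path arrives and leaves cancel under this derivation, so that the contraction
commutes with these derivations, where `r` corresponds to `[T]` and the other vertices of the tree
give zero (`dropHalf_swiatContract_of_mem`, `dropHalf_swiatContract`). Changing
the root adds the same chain to the image of each half-edge at `[T]`, hence does not affect reduced
elements (`swiatContract_sub`).

*Homology.* The configurations in the cubes of `Γ / T` have at most one point in a neighbourhood of
`[T]` of radius less than `1 / (n + 1)`. Thus the cubes lift to cubes `nearCube` in the configurations
with at most one point near `[T]`, and the map given by the span is, on these, homotopic to applying
an expansion `f₀` with small support (`spanMap_comp_incl`). It remains to compare the expanded cubes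
with the cubes of the images of the generators under the contraction. If there is no half-edge at
`[T]`, they are equal. Otherwise, all of them consist of configurations in which the points outside
the tree are as in `Γ / T` and one more point is on the hair of the half-edge `h` at `[T]`, the path
in the tree from `r` to the vertex of `h` continued by `h`; they are described by a `Track`. Pulling
the additional point back to `r` along its hair gives a prism over each of these cubes. The prisms
have common ends: the parameter `0` of a half-edge that leaves a vertex of the path is the parameter
`0` of the one that arrives there, and the parameters `1` of the two halves of an edge agree. So
these ends cancel in the sum over the terms of the contraction (`homotopyChain_d`), and the signed
sum of the prisms is the chain homotopy (`cubeChain_expand`).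
-/

namespace SubtreeContraction
noncomputable section

set_option linter.unusedSectionVars false

/-! ### Homotopies of maps of configuration spaces -/

/-- A homotopy that respects equivalence relations induces a homotopy of maps of quotients. -/
theorem homotopic_quotient {A B : Type} [TopologicalSpace A] [TopologicalSpace B]
    {sA : Setoid A} {sB : Setoid B} (F : C(unitInterval × A, B))
    (hF : ∀ s a a', a ≈ a' → F (s, a) ≈ F (s, a')) {f g : C(Quotient sA, Quotient sB)}
    (hf : ∀ a, f (Quotient.mk _ a) = Quotient.mk _ (F (0, a)))
    (hg : ∀ a, g (Quotient.mk _ a) = Quotient.mk _ (F (1, a))) : f.Homotopic g := by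
  let G : unitInterval × Quotient sA → Quotient sB := fun p =>
    Quotient.map (fun a => F (p.1, a)) (hF p.1) p.2
  have hG : Continuous G := by
    refine (isQuotientMap_quotient_mk' (s := sA)).continuous_lift_prod_right ?_
    exact continuous_quot_mk.comp F.continuous
  exact ⟨{ toFun := G
           continuous_toFun := hG
           map_zero_left := fun x => Quotient.inductionOn x fun a => (hf a).symm
           map_one_left := fun x => Quotient.inductionOn x fun a => (hg a).symm }⟩

theorem IsHomotopyEquiv.of_homotopic {X Y : Type} [TopologicalSpace X] [TopologicalSpace Y]
    {f : C(X, Y)} (g : C(Y, X)) (h : (g.comp f).Homotopic (.id X))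
    (h' : (f.comp g).Homotopic (.id Y)) : IsHomotopyEquiv f :=
  ⟨⟨f, g, h, h'⟩, rfl⟩

section push
variable {X Y Z : Type} [TopologicalSpace X] [TopologicalSpace Y] [TopologicalSpace Z]

theorem Pushable.comp {f : C(X, Y)} {g : C(Y, Z)} {U : Set X} {W : Set Y} {O : Set Z}
    (hg : Pushable g W O) (hf : Pushable f U W) : Pushable (g.comp f) U O where
  mapsTo := hg.mapsTo.comp hf.mapsTo
  mapsTo_compl := hg.mapsTo_compl.comp hf.mapsTo_compl
  injOn := hg.injOn.comp hf.injOn hf.mapsTo_compl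

theorem Pushable.of_fix {f : C(X, X)} {U : Set X} (h : Set.MapsTo f U U) (h' : ∀ x ∉ U, f x = x) :
    Pushable f U U where
  mapsTo := h
  mapsTo_compl x hx := by rw [Set.mem_compl_iff, h' x hx]; exact hx
  injOn x hx y hy hxy := by rwa [h' x hx, h' y hy] at hxy

/-- Two maps that are homotopic through maps to which `Pushable` applies. -/
def PushHomotopic (f g : C(X, Y)) (U : Set X) (W : Set Y) : Prop :=
  ∃ F : C(unitInterval × X, Y), (∀ x, F (0, x) = f x) ∧ (∀ x, F (1, x) = g x) ∧
    ∀ s, Pushable (F.comp ⟨fun x => (s, x), by fun_prop⟩) U W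

variable {f g : C(X, Y)} {U : Set X} {W : Set Y} (n : ℕ)

/-- The homotopy of maps of spaces of ordered configurations induced by a homotopy of maps. -/
theorem exists_push_homotopy (F : C(unitInterval × X, Y))
    (hF : ∀ s, Pushable (F.comp ⟨fun x => (s, x), by fun_prop⟩) U W) :
    ∃ G : C(unitInterval × ConfLE n 1 X U, ConfLE n 1 Y W),
      ∀ s x i, (G (s, x)).1 i = F (s, x.1 i) := by
  refine ⟨⟨fun p => ConfLE.push n (hF p.1) p.2, ?_⟩, fun s x i => rfl⟩
  refine Continuous.subtype_mk (continuous_pi fun i => F.continuous.comp ?_) _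
  exact continuous_fst.prodMk ((continuous_apply i).comp
    (continuous_subtype_val.comp continuous_snd))

theorem PushHomotopic.conf (h : PushHomotopic f g U W) (hf : Pushable f U W)
    (hg : Pushable g U W) : (ConfLE.push n hf).Homotopic (ConfLE.push n hg) := by
  obtain ⟨F, h0, h1, hF⟩ := h
  obtain ⟨G, hG⟩ := exists_push_homotopy n F hF
  exact ⟨{ toFun := G
           continuous_toFun := G.continuous
           map_zero_left := fun x => Subtype.ext (funext fun i => by
             refine (hG 0 x i).trans (h0 _))
           map_one_left := fun x => Subtype.ext (funext fun i => by
             refine (hG 1 x i).trans (h1 _)) }⟩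

theorem PushHomotopic.uconf (h : PushHomotopic f g U W) (hf : Pushable f U W)
    (hg : Pushable g U W) : (UConfLE.push n hf).Homotopic (UConfLE.push n hg) := by
  obtain ⟨F, h0, h1, hF⟩ := h
  obtain ⟨G, hG⟩ := exists_push_homotopy n F hF
  refine homotopic_quotient (sA := ConfLE.setoid n 1 X U) (sB := ConfLE.setoid n 1 Y W) G
    (fun s a a' ⟨π, h⟩ => ⟨π, fun i => by rw [hG, hG, h]⟩) (fun a => ?_) fun a => ?_
  · exact congrArg (Quotient.mk _) (Subtype.ext (funext fun i => ((hG 0 a i).trans (h0 _)).symm))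
  · exact congrArg (Quotient.mk _) (Subtype.ext (funext fun i => ((hG 1 a i).trans (h1 _)).symm))

theorem UConfLE.push_comp {g : C(Y, Z)} {O : Set Z} (hf : Pushable f U W) (hg : Pushable g W O) :
    UConfLE.push n (hg.comp hf) = (UConfLE.push n hg).comp (UConfLE.push n hf) := by
  ext x
  exact Quotient.inductionOn x fun a => rfl

theorem UConfLE.push_id {f : C(X, X)} (hf : Pushable f U U) (h : ∀ x, f x = x) :
    UConfLE.push n hf = .id _ := by
  ext x
  exact Quotient.inductionOn x fun a =>
    congrArg (Quotient.mk _) (Subtype.ext (funext fun i => h _))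

theorem ConfLE.push_id {f : C(X, X)} (hf : Pushable f U U) (h : ∀ x, f x = x) :
    ConfLE.push n hf = .id _ := by
  ext x
  exact Subtype.ext (funext fun i => h _)

end push

/-! ### Radial flows -/

/-- The time `a` map of a flow on `[0, l]` with the fixed points `0` and `l`. -/
def stretch (l a c : ℝ) : ℝ := Real.exp a * l * c / ((l - c) + Real.exp a * c)

section stretch
variable {l a c : ℝ}

theorem stretch_denom_pos (hl : 0 < l) (h0 : 0 ≤ c) (h1 : c ≤ l) :
    0 < (l - c) + Real.exp a * c := by
  have := Real.exp_pos a
  rcases h0.eq_or_lt with rfl | h0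
  · simpa using hl
  · have : 0 < Real.exp a * c := by positivity
    linarith

theorem stretch_zero_left (hl : 0 < l) : stretch l 0 c = c := by
  simp [stretch]; field_simp

theorem stretch_zero_right : stretch l a 0 = 0 := by simp [stretch]

theorem stretch_self (hl : 0 < l) : stretch l a l = l := by
  have := Real.exp_pos a
  simp [stretch]; field_simp

theorem stretch_nonneg (hl : 0 < l) (h0 : 0 ≤ c) (h1 : c ≤ l) : 0 ≤ stretch l a c := by
  have := stretch_denom_pos (a := a) hl h0 h1
  unfold stretch; positivity

theorem stretch_le (hl : 0 < l) (h0 : 0 ≤ c) (h1 : c ≤ l) : stretch l a c ≤ l := by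
  have := stretch_denom_pos (a := a) hl h0 h1
  unfold stretch
  rw [div_le_iff₀ this]
  nlinarith

theorem stretch_add (hl : 0 < l) (h0 : 0 ≤ c) (h1 : c ≤ l) (b : ℝ) :
    stretch l b (stretch l a c) = stretch l (b + a) c := by
  have h2 := stretch_denom_pos (a := a) hl h0 h1
  have h3 := stretch_denom_pos (a := b + a) hl h0 h1
  have h4 := stretch_denom_pos (a := b) hl (stretch_nonneg (a := a) hl h0 h1) (stretch_le hl h0 h1)
  unfold stretch at h4 ⊢
  rw [Real.exp_add] at *
  rw [div_eq_div_iff h4.ne' h3.ne']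
  field_simp
  ring

theorem le_stretch (hl : 0 < l) (h0 : 0 ≤ c) (h1 : c ≤ l) (ha : 0 ≤ a) : c ≤ stretch l a c := by
  have := stretch_denom_pos (a := a) hl h0 h1
  unfold stretch
  rw [le_div_iff₀ this]
  have : 1 ≤ Real.exp a := Real.one_le_exp ha
  nlinarith [mul_nonneg h0 (mul_nonneg (sub_nonneg.2 this) (sub_nonneg.2 h1))]

theorem stretch_mono (hl : 0 < l) (h0 : 0 ≤ c) {c' : ℝ} (h : c ≤ c') (h1 : c' ≤ l) :
    stretch l a c ≤ stretch l a c' := by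
  have h2 := stretch_denom_pos (a := a) hl h0 (h.trans h1)
  have h3 := stretch_denom_pos (a := a) hl (h0.trans h) h1
  unfold stretch
  rw [div_le_div_iff₀ h2 h3]
  have h4 : 0 ≤ Real.exp a * l * l * (c' - c) := by
    have := sub_nonneg.2 h
    positivity
  linarith

/-- A point at distance `c` from the fixed point `0` is moved beyond `d` by the time `log (1 + K / c)`. -/
theorem le_stretch_of_le {d K : ℝ} (hd : 0 ≤ d) (hdl : d < l) (h0 : 0 < c) (h1 : c ≤ l)
    (hK : K = l * d / (l - d)) (ha : 1 + K / c ≤ Real.exp a) : d ≤ stretch l a c := by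
  have hl : 0 < l := hd.trans_lt hdl
  have := stretch_denom_pos (a := a) hl h0.le h1
  unfold stretch
  rw [le_div_iff₀ this]
  have h2 : 0 < l - d := by linarith
  have h3 : (1 + K / c) * (c * (l - d)) = c * (l - d) + l * d := by
    rw [hK]; field_simp
  have h4 : (1 + K / c) * (c * (l - d)) ≤ Real.exp a * (c * (l - d)) := by gcongr
  nlinarith

/-- The points of `[0, d)` are moved close to `0` in negative time, at a uniform rate. -/
theorem stretch_le_of_lt {d K : ℝ} (h0 : 0 ≤ c) (h1 : c < d) (hdl : d < l)
    (hK : K = l * d / (l - d)) : stretch l a c ≤ Real.exp a * K := by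
  have hd : 0 < d := h0.trans_lt h1
  have hl : 0 < l := hd.trans hdl
  have := stretch_denom_pos (a := a) hl h0 (h1.trans hdl).le
  have h2 : 0 < l - d := by linarith
  have h3 : 0 ≤ Real.exp a * c := by positivity
  rw [hK]
  calc stretch l a c = Real.exp a * (l * c) / ((l - c) + Real.exp a * c) := by
        unfold stretch; ring
    _ ≤ Real.exp a * (l * d) / (l - d) := by
        gcongr
        linarith [Real.exp_pos a]
    _ = _ := by ring

end stretch

/-- A flow on a space with a center, together with a function that measures the distance from the
center, cut off at `l`, such that the flow acts on distances as `stretch`. -/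
structure RadialFlow (X : Type) [TopologicalSpace X] (l : ℝ) where
  /-- The flow. -/
  flow : ℝ → X → X
  /-- The distance from the center, cut off at `l`. -/
  dist : X → ℝ
  continuous_flow : Continuous fun p : ℝ × X => flow p.1 p.2
  continuous_dist : Continuous dist
  flow_zero : ∀ x, flow 0 x = x
  flow_flow : ∀ a b x, flow a (flow b x) = flow (a + b) x
  dist_flow : ∀ a x, dist (flow a x) = stretch l a (dist x)
  dist_nonneg : ∀ x, 0 ≤ dist x
  dist_le : ∀ x, dist x ≤ l
  eq_of_dist : ∀ x y, dist x = 0 → dist y = 0 → x = y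

namespace RadialFlow
variable {X : Type} [TopologicalSpace X] {l : ℝ} (R : RadialFlow X l)

/-- The open star around the center. -/
def star (d : ℝ) : Set X := {x | R.dist x < d}

theorem mem_star {d : ℝ} {x : X} : x ∈ R.star d ↔ R.dist x < d := Iff.rfl

theorem flow_injective (a : ℝ) : Function.Injective (R.flow a) := fun x y h => by
  have := congrArg (R.flow (-a)) h
  simpa [R.flow_flow, R.flow_zero] using this

/-- The rate at which a configuration has to be stretched such that only one point remains
in the star. The denominators do not vanish on configurations, since at most one of two distinct
points is at the center, and the sum over all pairs makes the rate continuous and symmetric. -/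
def rate {n : ℕ} (K : ℝ) (x : Fin n → X) : ℝ :=
  ∑ p : {p : Fin n × Fin n // p.1 ≠ p.2}, K / max (R.dist (x p.1.1)) (R.dist (x p.1.2))

variable {n : ℕ} {K d : ℝ}

theorem max_pos {x : Fin n → X} (hx : Function.Injective x) {i j : Fin n} (hij : i ≠ j) :
    0 < max (R.dist (x i)) (R.dist (x j)) := by
  by_contra h
  have h1 := le_max_left (R.dist (x i)) (R.dist (x j))
  have h2 := le_max_right (R.dist (x i)) (R.dist (x j))
  have h3 := R.dist_nonneg (x i)
  have h4 := R.dist_nonneg (x j)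
  exact hij (hx (R.eq_of_dist _ _ (by linarith) (by linarith)))

theorem rate_nonneg (hK : 0 ≤ K) (x : Fin n → X) : 0 ≤ R.rate K x :=
  Finset.sum_nonneg fun _ _ => div_nonneg hK ((R.dist_nonneg _).trans (le_max_left _ _))

theorem rate_perm (x y : Fin n → X) (π : Equiv.Perm (Fin n)) (h : ∀ i, y i = x (π i)) :
    R.rate K y = R.rate K x := by
  refine Fintype.sum_equiv ((Equiv.prodCongr π π).subtypeEquiv fun p => ?_) _ _ fun p => ?_
  · simp
  · simp [h]

theorem continuous_rate : Continuous fun x : Conf n X => R.rate K x.1 := by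
  refine continuous_finsetSum _ fun p _ => ?_
  have hc : ∀ i : Fin n, Continuous fun x : Conf n X => R.dist (x.1 i) := fun i =>
    R.continuous_dist.comp ((continuous_apply i).comp continuous_subtype_val)
  refine Continuous.div continuous_const ((hc _).max (hc _)) fun x => ?_
  exact (R.max_pos x.2 p.2).ne'

theorem one_le_arg (hK : 0 ≤ K) (s : unitInterval) (x : Fin n → X) : 1 ≤ 1 + s * R.rate K x := by
  have := mul_nonneg s.2.1 (R.rate_nonneg hK x)
  linarith

/-- The homotopy that stretches configurations. The logarithm turns the linear bound of
`le_stretch_of_le` into a time of the flow. -/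
def spreadOut (hK : 0 ≤ K) : C(unitInterval × Conf n X, Conf n X) where
  toFun p := ⟨fun i => R.flow (Real.log (1 + p.1 * R.rate K p.2.1)) (p.2.1 i),
    (R.flow_injective _).comp p.2.2⟩
  continuous_toFun := by
    refine Continuous.subtype_mk (continuous_pi fun i => R.continuous_flow.comp
      (Continuous.prodMk ?_ ((continuous_apply i).comp
        (continuous_subtype_val.comp continuous_snd)))) _
    refine Continuous.log ?_ fun p => ?_
    · exact continuous_const.add ((continuous_subtype_val.comp continuous_fst).mul
        (R.continuous_rate.comp continuous_snd))
    · have := R.one_le_arg hK p.1 p.2.1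
      linarith

theorem spreadOut_apply (hK : 0 ≤ K) (s : unitInterval) (x : Conf n X) (i : Fin n) :
    (R.spreadOut hK (s, x)).1 i = R.flow (Real.log (1 + s * R.rate K x.1)) (x.1 i) := rfl

theorem spreadOut_zero (hK : 0 ≤ K) (x : Conf n X) : R.spreadOut hK (0, x) = x :=
  Subtype.ext (funext fun i => by simp [spreadOut_apply, R.flow_zero])

theorem dist_le_spreadOut (hl : 0 < l) (hK : 0 ≤ K) (s : unitInterval) (x : Conf n X) (i : Fin n) :
    R.dist (x.1 i) ≤ R.dist ((R.spreadOut hK (s, x)).1 i) := by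
  refine (le_stretch hl (R.dist_nonneg _) (R.dist_le _) ?_).trans (R.dist_flow _ _).ge
  exact Real.log_nonneg (R.one_le_arg hK s x.1)

theorem spreadOut_ncard_le (hl : 0 < l) (hK : 0 ≤ K) (s : unitInterval) (x : Conf n X)
    (hx : {i | x.1 i ∈ R.star d}.ncard ≤ 1) :
    {i | (R.spreadOut hK (s, x)).1 i ∈ R.star d}.ncard ≤ 1 :=
  (Set.ncard_le_ncard (fun i hi => (R.dist_le_spreadOut hl hK s x i).trans_lt hi)).trans hx

theorem spreadOut_one (hd : 0 ≤ d) (hdl : d < l) (hK : 0 ≤ K) (hKd : K = l * d / (l - d))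
    (x : Conf n X) : {i | (R.spreadOut hK (1, x)).1 i ∈ R.star d}.ncard ≤ 1 := by
  rw [Set.ncard_le_one_iff]
  intro i j hi hj
  by_contra hij
  -- The point of the pair that is further from the center leaves the star.
  have key : ∀ k : Fin n, R.dist (x.1 k) = max (R.dist (x.1 i)) (R.dist (x.1 j)) →
      (R.spreadOut hK (1, x)).1 k ∉ R.star d := by
    intro k hk h
    have hpos := R.max_pos x.2 hij
    refine absurd (R.mem_star.1 h) (not_lt.2 ?_)
    refine le_trans ?_ (R.dist_flow _ _).ge
    refine le_stretch_of_le hd hdl (hk ▸ hpos) (R.dist_le _) hKd ?_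
    have h1 := R.one_le_arg hK 1 x.1
    dsimp only at h1 ⊢
    rw [Real.exp_log (by linarith)]
    simp only [Set.Icc.coe_one, one_mul, add_le_add_iff_left]
    rw [hk]
    refine Finset.single_le_sum (f := fun p : {p : Fin n × Fin n // p.1 ≠ p.2} =>
      K / max (R.dist (x.1 p.1.1)) (R.dist (x.1 p.1.2))) (fun p _ => ?_)
      (Finset.mem_univ ⟨(i, j), hij⟩)
    exact div_nonneg hK ((R.dist_nonneg _).trans (le_max_left _ _))
  rcases max_choice (R.dist (x.1 i)) (R.dist (x.1 j)) with h | h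
  · exact key i h.symm hi
  · exact key j h.symm hj

/-- The inclusion of the configurations with at most one point in the star is a homotopy
equivalence: configurations are stretched away from the center. -/
theorem isHomotopyEquiv_incl (hd : 0 ≤ d) (hdl : d < l) (n : ℕ) :
    IsHomotopyEquiv (ConfLE.incl n 1 (R.star d)) ∧
      IsHomotopyEquiv (UConfLE.incl n 1 (R.star d)) := by
  have hl : 0 < l := by linarith
  have hK : 0 ≤ l * d / (l - d) := div_nonneg (mul_nonneg hl.le hd) (by linarith)
  let H : C(unitInterval × Conf n X, Conf n X) := R.spreadOut hK
  have hperm : ∀ s a a', a ≈ a' → H (s, a) ≈ H (s, a') := fun s a a' ⟨π, h⟩ =>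
    ⟨π, fun i => by simp only [H, spreadOut_apply, R.rate_perm a.1 a'.1 π h, h]⟩
  let r : C(Conf n X, ConfLE n 1 X (R.star d)) :=
    ⟨fun x => ⟨(H (1, x)).1, (H (1, x)).2, R.spreadOut_one hd hdl hK rfl x⟩,
      Continuous.subtype_mk (continuous_subtype_val.comp (H.continuous.comp (by fun_prop))) _⟩
  let ru : C(UConf n X, UConfLE n 1 X (R.star d)) :=
    ⟨Quotient.map r fun a a' h => hperm 1 a a' h, r.continuous.quotient_map' _⟩
  let H' : C(unitInterval × ConfLE n 1 X (R.star d), ConfLE n 1 X (R.star d)) :=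
    ⟨fun p => ⟨(H (p.1, ConfLE.incl n 1 _ p.2)).1, (H (p.1, ConfLE.incl n 1 _ p.2)).2,
        R.spreadOut_ncard_le hl hK p.1 _ p.2.2.2⟩,
      Continuous.subtype_mk (continuous_subtype_val.comp (H.continuous.comp
        (continuous_fst.prodMk ((ConfLE.incl n 1 _).continuous.comp continuous_snd)))) _⟩
  have h0 : ∀ x, H (0, x) = x := R.spreadOut_zero hK
  have h0' : ∀ x, H' (0, x) = x := fun x => Subtype.ext (congrArg Subtype.val (h0 (ConfLE.incl n 1 _ x)) :)
  constructor
  · refine .of_homotopic r (.symm ⟨⟨H', h0', fun x => rfl⟩⟩) (.symm ⟨⟨H, h0, fun x => rfl⟩⟩)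
  · refine .of_homotopic ru (.symm (homotopic_quotient H' (fun s a a' h => hperm s _ _ h)
      (fun a => ?_) fun a => rfl)) (.symm (homotopic_quotient H hperm (fun a => ?_) fun a => rfl))
    · exact congrArg (Quotient.mk _) (h0' a).symm
    · exact congrArg (Quotient.mk _) (h0 a).symm

/-- The Alexander trick: a map that is the identity outside a star is homotopic to the identity,
by a homotopy that preserves the star and is constant outside. -/
theorem pushHomotopic_id [CompactSpace X] (hd : 0 < d) (hdl : d < l) (h : C(X, X))
    (hm : Set.MapsTo h (R.star d) (R.star d)) (hfix : ∀ x ∉ R.star d, h x = x) :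
    PushHomotopic h (.id X) (R.star d) (R.star d) := by
  have hl : 0 < l := by linarith
  set K := l * d / (l - d) with hK
  -- The conjugates of `h` by the flow, with `0` for time `-∞`; the homotopy runs from `s = 1` to
  -- `s = 0`, and continuity at `s = 0` is the point.
  let F : unitInterval × X → X := fun p =>
    if p.1 = 0 then p.2 else R.flow (Real.log p.1) (h (R.flow (-Real.log p.1) p.2))
  have hlog : ∀ s : unitInterval, s ≠ 0 → Real.exp (Real.log s) = s := fun s hs =>
    Real.exp_log (lt_of_le_of_ne s.2.1 fun h => hs (Subtype.ext h.symm))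
  have hinv : ∀ a x, R.flow a (R.flow (-a) x) = x := fun a x => by
    rw [R.flow_flow, add_neg_cancel, R.flow_zero]
  have hsmall : ∀ (s : unitInterval) (x : X), s ≠ 0 → x ∈ R.star d →
      R.dist (R.flow (Real.log s) x) ≤ s * K := fun s x hs hx => by
    rw [R.dist_flow]
    refine (stretch_le_of_lt (R.dist_nonneg _) hx hdl hK).trans ?_
    rw [hlog s hs]
  -- The conjugate at `s` is the identity except within distance `s * K` of the center.
  have hF : ∀ s x, F (s, x) = x ∨ (R.dist x ≤ s * K ∧ R.dist (F (s, x)) ≤ s * K) := by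
    intro s x
    by_cases hs : s = 0
    · left; simp [F, hs]
    · simp only [F, hs, if_false]
      by_cases hx : R.flow (-Real.log s) x ∈ R.star d
      · right
        refine ⟨?_, hsmall s _ hs (hm hx)⟩
        have := hsmall s _ hs hx
        rwa [hinv] at this
      · left
        rw [hfix _ hx, hinv]
  have hcont : Continuous F := by
    rw [continuous_iff_continuousAt]
    rintro ⟨s, x⟩
    by_cases hs : s = 0
    · subst hs
      have hF0 : F (0, x) = x := by simp [F]
      by_cases hx : R.dist x = 0
      · rw [ContinuousAt, hF0, Filter.tendsto_def]
        intro O hO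
        obtain ⟨O', hO'O, hO', hxO'⟩ := mem_nhds_iff.1 hO
        -- By compactness, small stars are contained in any neighbourhood of the center.
        obtain ⟨η, hη, hball⟩ : ∃ η > 0, ∀ y, R.dist y < η → y ∈ O' := by
          by_cases hne : (O'ᶜ).Nonempty
          · obtain ⟨y, hy, hmin⟩ := hO'.isClosed_compl.isCompact.exists_isMinOn hne
              R.continuous_dist.continuousOn
            refine ⟨R.dist y, lt_of_le_of_ne (R.dist_nonneg y) fun h0 => ?_, fun z hz => ?_⟩
            · exact hy (R.eq_of_dist x y hx h0.symm ▸ hxO')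
            · by_contra hz'
              exact absurd hz (not_lt.2 (hmin hz'))
          · exact ⟨1, one_pos, fun y _ => by
              by_contra hy; exact hne ⟨y, hy⟩⟩
        have h1 : ∀ᶠ p : unitInterval × X in nhds (0, x), R.dist p.2 < η :=
          (R.continuous_dist.comp continuous_snd).continuousAt.eventually_lt continuousAt_const
            (by simpa [hx] using hη)
        have h2 : ∀ᶠ p : unitInterval × X in nhds (0, x), (p.1 : ℝ) * K < η :=
          ((continuous_subtype_val.comp continuous_fst).mul
            continuous_const).continuousAt.eventually_lt continuousAt_const (by simpa using hη)
        filter_upwards [h1, h2] with p hp1 hp2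
        apply hO'O
        rcases hF p.1 p.2 with h | h
        · exact h ▸ hball _ hp1
        · exact hball _ (h.2.trans_lt hp2)
      · have hx' : 0 < R.dist x := lt_of_le_of_ne (R.dist_nonneg x) (Ne.symm hx)
        have h1 : ∀ᶠ p : unitInterval × X in nhds (0, x), (p.1 : ℝ) * K < R.dist p.2 :=
          ((continuous_subtype_val.comp continuous_fst).mul
            continuous_const).continuousAt.eventually_lt
            (R.continuous_dist.comp continuous_snd).continuousAt (by simpa using hx')
        refine continuousAt_snd.congr ?_
        filter_upwards [h1] with p hp
        rcases hF p.1 p.2 with h | h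
        · exact h.symm
        · exact absurd hp (not_lt.2 h.1)
    · have h1 : ∀ᶠ p : unitInterval × X in nhds (s, x), p.1 ≠ 0 :=
        continuousAt_fst.eventually_ne hs
      have h2 : ContinuousAt (fun p : unitInterval × X =>
          R.flow (Real.log p.1) (h (R.flow (-Real.log p.1) p.2))) (s, x) := by
        have hl : ContinuousAt (fun p : unitInterval × X => Real.log p.1) (s, x) :=
          (continuous_subtype_val.comp continuous_fst).continuousAt.log
            fun h => hs (Subtype.ext h)
        have h3 : ContinuousAt (fun p : unitInterval × X => h (R.flow (-Real.log p.1) p.2))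
            (s, x) :=
          h.continuous.continuousAt.comp (R.continuous_flow.continuousAt.comp
            (f := fun p : unitInterval × X => (-Real.log p.1, p.2)) (hl.neg.prodMk continuousAt_snd))
        exact R.continuous_flow.continuousAt.comp
          (f := fun p : unitInterval × X => (Real.log p.1, h (R.flow (-Real.log p.1) p.2)))
          (hl.prodMk h3)
      refine h2.congr ?_
      filter_upwards [h1] with p hp
      simp [F, hp]
  refine ⟨⟨fun p => F (unitInterval.symm p.1, p.2), hcont.comp (by fun_prop)⟩,
    fun x => ?_, fun x => ?_, fun s => ?_⟩
  · simp [F, R.flow_zero]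
  · simp [F]
  · have hmem : ∀ (s : unitInterval) x, F (s, x) = x ∨
        (x ∈ R.star d ∧ F (s, x) ∈ R.star d) := by
      intro s x
      by_cases hs : s = 0
      · left; simp [F, hs]
      · simp only [F, hs, if_false]
        by_cases hx : R.flow (-Real.log s) x ∈ R.star d
        · right
          have hlog0 : 0 ≤ -Real.log s := neg_nonneg.2 (Real.log_nonpos s.2.1 s.2.2)
          have hdec : ∀ y ∈ R.star d, R.flow (Real.log s) y ∈ R.star d := fun y hy => by
            refine lt_of_le_of_lt ?_ (R.mem_star.1 hy)
            have := le_stretch (a := -Real.log s) hl (R.dist_nonneg (R.flow (Real.log s) y))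
              (R.dist_le _) hlog0
            rwa [← R.dist_flow, R.flow_flow, neg_add_cancel, R.flow_zero] at this
          refine ⟨?_, hdec _ (hm hx)⟩
          have := hdec _ hx
          rwa [hinv] at this
        · left
          rw [hfix _ hx, hinv]
    refine Pushable.of_fix (fun x hx => ?_) fun x hx => ?_
    · rcases hmem (unitInterval.symm s) x with h | h
      · change F (unitInterval.symm s, x) ∈ _
        rwa [h]
      · exact h.2
    · exact (hmem (unitInterval.symm s) x).resolve_right fun h => hx h.1

end RadialFlow

/-! ### Maps out of the realization of a graph -/

namespace Multigraph

variable {V E : Type} (Γ : Multigraph V E)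

/-- The function on the realization given by its values on vertices and edges. -/
def desc {Y : Sort*} (fv : V → Y) (fe : E → unitInterval → Y)
    (h0 : ∀ e, fe e 0 = fv (Γ.vert e false)) (h1 : ∀ e, fe e 1 = fv (Γ.vert e true)) :
    Γ.Space → Y :=
  Quot.lift (fun p => match p with
    | .inl ⟨v, _⟩ => fv v
    | .inr ⟨e, t⟩ => fe e t) (by
      rintro _ _ (e | e)
      · exact h0 e
      · exact h1 e)

variable {Γ}

theorem space_cases {p : Γ.Space → Prop} (hv : ∀ v, p (Γ.vertexPt v))
    (he : ∀ e t, p (Γ.edgePt e t)) (x : Γ.Space) : p x := by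
  rcases x with ⟨⟨v, -⟩ | ⟨e, t⟩⟩
  · exact hv v
  · exact he e t

theorem continuous_prod_space {Z Y : Type*} [TopologicalSpace Z] [TopologicalSpace Y]
    [LocallyCompactSpace Z] {f : Z × Γ.Space → Y}
    (hv : ∀ v, Continuous fun z => f (z, Γ.vertexPt v))
    (he : ∀ e, Continuous fun p : Z × unitInterval => f (p.1, Γ.edgePt e p.2)) :
    Continuous f := by
  have hz : ∀ x : Γ.Space, Continuous fun z => f (z, x) :=
    space_cases hv fun e t => (he e).comp (by fun_prop : Continuous fun z : Z => (z, t))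
  let F : Γ.Space → C(Z, Y) := fun x => ⟨fun z => f (z, x), hz x⟩
  have hF : Continuous F := by
    refine isQuotientMap_quot_mk.continuous_iff.2 (continuous_sum_dom.2 ⟨?_, ?_⟩)
    · exact continuous_sigma fun v => continuous_of_discreteTopology
    · refine continuous_sigma fun e => ?_
      exact (ContinuousMap.curry (⟨fun p : unitInterval × Z => f (p.2, Γ.edgePt e p.1),
        (he e).comp continuous_swap⟩ : C(unitInterval × Z, Y))).continuous
  exact (ContinuousMap.continuous_uncurry_of_continuous ⟨F, hF⟩).comp continuous_swap

theorem continuous_space {Y : Type*} [TopologicalSpace Y] {f : Γ.Space → Y}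
    (he : ∀ e, Continuous fun t => f (Γ.edgePt e t)) : Continuous f := by
  refine isQuotientMap_quot_mk.continuous_iff.2 (continuous_sum_dom.2 ⟨?_, ?_⟩)
  · exact continuous_sigma fun v => continuous_of_discreteTopology
  · exact continuous_sigma he

instance [Finite V] [Finite E] : CompactSpace Γ.Space :=
  inferInstanceAs (CompactSpace (Quot Γ.Glue))

/-- The coordinate on an edge seen from its end `b`. -/
def fromEnd (b : Bool) (t : unitInterval) : unitInterval := if b then unitInterval.symm t else t

theorem fromEnd_false (t : unitInterval) : fromEnd false t = t := rfl

theorem fromEnd_true (t : unitInterval) : fromEnd true t = unitInterval.symm t := rfl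

theorem fromEnd_fromEnd (b : Bool) (t : unitInterval) : fromEnd b (fromEnd b t) = t := by
  cases b <;> simp [fromEnd]

theorem continuous_fromEnd (b : Bool) : Continuous (fromEnd b) := by
  unfold fromEnd; cases b
  · exact continuous_id
  · exact unitInterval.continuous_symm

theorem halfEdgePt_eq (e : E) (b : Bool) (t : unitInterval) :
    Γ.halfEdgePt e b t = Γ.edgePt e (fromEnd b t) := rfl

theorem halfEdgePt_zero (e : E) (b : Bool) : Γ.halfEdgePt e b 0 = Γ.vertexPt (Γ.vert e b) := by
  cases b
  · exact Γ.edgePt_zero e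
  · simp [halfEdgePt, edgePt_one]

theorem halfEdgePt_one (e : E) (b : Bool) : Γ.halfEdgePt e b 1 = Γ.vertexPt (Γ.vert e !b) := by
  cases b
  · simp [halfEdgePt, edgePt_one]
  · simp [halfEdgePt, edgePt_zero]

theorem continuous_halfEdgePt (e : E) (b : Bool) : Continuous (Γ.halfEdgePt e b) :=
  (Γ.continuous_edgePt e).comp (continuous_fromEnd b)

/-! ### The radial flow around a vertex -/

section reach
variable {l : ℝ} (hl : l ∈ Set.Ioc (0 : ℝ) 1)

/-- The radial flow on an edge that starts at the center. It is supported in `[0, l]`. -/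
def reach (a : ℝ) (t : unitInterval) : unitInterval :=
  ⟨stretch l a (min (t : ℝ) l) + ((t : ℝ) - min (t : ℝ) l), by
    have h0 := stretch_nonneg (a := a) hl.1 (le_min t.2.1 hl.1.le) (min_le_right (t : ℝ) l)
    have h1 := stretch_le (a := a) hl.1 (le_min t.2.1 hl.1.le) (min_le_right (t : ℝ) l)
    have h2 := min_le_left (t : ℝ) l
    refine ⟨by linarith, ?_⟩
    rcases le_total (t : ℝ) l with h | h
    · rw [min_eq_left h] at h1 ⊢
      linarith [hl.2]
    · rw [min_eq_right h, stretch_self hl.1]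
      linarith [t.2.2]⟩

theorem coe_reach (a : ℝ) (t : unitInterval) :
    (reach hl a t : ℝ) = stretch l a (min (t : ℝ) l) + ((t : ℝ) - min (t : ℝ) l) := rfl

theorem coe_reach_of_le {a : ℝ} {t : unitInterval} (h : (t : ℝ) ≤ l) :
    (reach hl a t : ℝ) = stretch l a t := by
  rw [coe_reach, min_eq_left h]; ring

theorem reach_of_le {a : ℝ} {t : unitInterval} (h : l ≤ t) : reach hl a t = t :=
  Subtype.ext (by rw [coe_reach, min_eq_right h, stretch_self hl.1]; ring)

theorem reach_le {a : ℝ} {t : unitInterval} (h : (t : ℝ) ≤ l) : (reach hl a t : ℝ) ≤ l := by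
  rw [coe_reach_of_le hl h]; exact stretch_le hl.1 t.2.1 h

theorem min_reach (a : ℝ) (t : unitInterval) :
    min (reach hl a t : ℝ) l = stretch l a (min (t : ℝ) l) := by
  rcases le_total (t : ℝ) l with h | h
  · rw [min_eq_left (reach_le hl h), min_eq_left h, coe_reach_of_le hl h]
  · rw [reach_of_le hl h, min_eq_right h, stretch_self hl.1]

theorem reach_zero (t : unitInterval) : reach hl 0 t = t :=
  Subtype.ext (by rw [coe_reach, stretch_zero_left hl.1]; ring)

theorem reach_zero_right (a : ℝ) : reach hl a 0 = 0 :=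
  Subtype.ext (by rw [coe_reach_of_le hl (by simpa using hl.1.le)]; simp [stretch_zero_right])

theorem reach_one (a : ℝ) : reach hl a 1 = 1 := reach_of_le hl hl.2

theorem reach_reach (a b : ℝ) (t : unitInterval) :
    reach hl a (reach hl b t) = reach hl (a + b) t := by
  rcases le_total (t : ℝ) l with h | h
  · refine Subtype.ext ?_
    rw [coe_reach_of_le hl (reach_le hl h), coe_reach_of_le hl h, coe_reach_of_le hl h,
      stretch_add hl.1 t.2.1 h]
  · rw [reach_of_le hl h, reach_of_le hl h, reach_of_le hl h]

theorem continuous_reach :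
    Continuous fun p : ℝ × unitInterval => reach hl p.1 p.2 := by
  refine Continuous.subtype_mk ?_ _
  have hm : Continuous fun p : ℝ × unitInterval => min (p.2 : ℝ) l := by fun_prop
  refine Continuous.add ?_ ((continuous_subtype_val.comp continuous_snd).sub hm)
  unfold stretch
  refine Continuous.div (by fun_prop) (by fun_prop) fun p => ?_
  exact (stretch_denom_pos hl.1 (le_min p.2.2.1 hl.1.le) (min_le_right (p.2 : ℝ) l)).ne'

end reach

section radial
variable {l : ℝ} (hl : l ∈ Set.Ioc (0 : ℝ) 1) (o : V)

open Classical in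
/-- The effect of the radial flow on an edge, as far as its end `b` is concerned. -/
def endFlow (e : E) (b : Bool) (a : ℝ) (t : unitInterval) : unitInterval :=
  if Γ.vert e b = o then fromEnd b (reach hl a (fromEnd b t)) else t

open Classical in
/-- The distance from the center on an edge, as far as its end `b` is concerned. -/
def endDist (l : ℝ) (o : V) (e : E) (b : Bool) (t : unitInterval) : ℝ :=
  if Γ.vert e b = o then min (fromEnd b t : ℝ) l else l

theorem continuous_endFlow (e : E) (b : Bool) :
    Continuous fun p : ℝ × unitInterval => Γ.endFlow hl o e b p.1 p.2 := by
  unfold endFlow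
  split_ifs
  · exact (continuous_fromEnd b).comp ((continuous_reach hl).comp
      (continuous_fst.prodMk ((continuous_fromEnd b).comp continuous_snd)))
  · exact continuous_snd

theorem continuous_endDist (e : E) (b : Bool) : Continuous (Γ.endDist l o e b) := by
  unfold endDist
  split_ifs
  · exact (continuous_subtype_val.comp (continuous_fromEnd b)).min continuous_const
  · exact continuous_const

/-- The effect of the radial flow on an edge. -/
def edgeFlow (e : E) (a : ℝ) (t : unitInterval) : unitInterval :=
  Γ.endFlow hl o e true a (Γ.endFlow hl o e false a t)

theorem edgeFlow_zero_right (e : E) (a : ℝ) : Γ.edgeFlow hl o e a 0 = 0 := by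
  unfold edgeFlow endFlow
  split_ifs <;> simp [fromEnd, reach_zero_right, reach_one]

theorem edgeFlow_one_right (e : E) (a : ℝ) : Γ.edgeFlow hl o e a 1 = 1 := by
  unfold edgeFlow endFlow
  split_ifs <;> simp [fromEnd, reach_zero_right, reach_one]

theorem edgeFlow_zero (e : E) (t : unitInterval) : Γ.edgeFlow hl o e 0 t = t := by
  unfold edgeFlow endFlow
  split_ifs <;> simp [fromEnd, reach_zero]

theorem endFlow_endFlow (e : E) (b : Bool) (a a' : ℝ) (t : unitInterval) :
    Γ.endFlow hl o e b a (Γ.endFlow hl o e b a' t) = Γ.endFlow hl o e b (a + a') t := by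
  unfold endFlow
  split_ifs
  · rw [fromEnd_fromEnd, reach_reach]
  · rfl

theorem endFlow_of_le {e : E} {b : Bool} {a : ℝ} {t : unitInterval} (h : l ≤ fromEnd b t) :
    Γ.endFlow hl o e b a t = t := by
  unfold endFlow
  split_ifs
  · rw [reach_of_le hl h, fromEnd_fromEnd]
  · rfl

theorem coe_fromEnd_not (b : Bool) (t : unitInterval) :
    (fromEnd (!b) t : ℝ) = 1 - fromEnd b t := by
  cases b <;> simp [fromEnd]

/-- If both ends of an edge are at the center, the flow around one end does not reach the half
of the edge at the other end. -/
theorem fromEnd_endFlow_not (hloop : ∀ e, (∀ b, Γ.vert e b = o) → l ≤ 1 / 2) {e : E}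
    (h : ∀ b, Γ.vert e b = o) {b : Bool} {a : ℝ} {t : unitInterval} (ht : l ≤ fromEnd b t) :
    l ≤ fromEnd b (Γ.endFlow hl o e (!b) a t) := by
  have hl' := hloop e h
  have h1 := coe_fromEnd_not (!b) t
  have h2 := coe_fromEnd_not (!b) (Γ.endFlow hl o e (!b) a t)
  rw [Bool.not_not] at h1 h2
  rcases le_total l (fromEnd (!b) t) with h3 | h3
  · rwa [endFlow_of_le hl o h3]
  · rw [h2]
    unfold endFlow
    rw [if_pos (h _), fromEnd_fromEnd]
    have := reach_le hl (a := a) h3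
    linarith

theorem endFlow_comm (hloop : ∀ e, (∀ b, Γ.vert e b = o) → l ≤ 1 / 2) (e : E) (b : Bool)
    (a a' : ℝ) (t : unitInterval) :
    Γ.endFlow hl o e b a (Γ.endFlow hl o e (!b) a' t) =
      Γ.endFlow hl o e (!b) a' (Γ.endFlow hl o e b a t) := by
  by_cases h : ∀ b, Γ.vert e b = o
  · rcases le_total l (fromEnd b t) with ht | ht
    · rw [endFlow_of_le hl o ht, endFlow_of_le hl o (fromEnd_endFlow_not hl o hloop h ht)]
    · have ht' : l ≤ fromEnd (!b) t := by
        have := hloop e h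
        rw [coe_fromEnd_not]; linarith
      have := fromEnd_endFlow_not hl o hloop h (b := !b) (a := a) ht'
      rw [Bool.not_not] at this
      rw [endFlow_of_le hl o ht', endFlow_of_le hl o this]
  · have h' : ¬ Γ.vert e b = o ∨ ¬ Γ.vert e (!b) = o := by
      by_contra hc
      push Not at hc
      refine h fun b' => ?_
      rcases Bool.eq_or_eq_not b' b with rfl | rfl
      · exact hc.1
      · exact hc.2
    unfold endFlow
    rcases h' with h' | h' <;> simp [h']

theorem edgeFlow_edgeFlow (hloop : ∀ e, (∀ b, Γ.vert e b = o) → l ≤ 1 / 2) (e : E) (a b : ℝ)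
    (t : unitInterval) :
    Γ.edgeFlow hl o e a (Γ.edgeFlow hl o e b t) = Γ.edgeFlow hl o e (a + b) t := by
  unfold edgeFlow
  have h := endFlow_comm hl o hloop e false a b (Γ.endFlow hl o e false b t)
  rw [Bool.not_false] at h
  rw [h, endFlow_endFlow, endFlow_endFlow]

theorem endDist_endFlow (e : E) (b : Bool) (a : ℝ) (t : unitInterval) :
    Γ.endDist l o e b (Γ.endFlow hl o e b a t) = stretch l a (Γ.endDist l o e b t) := by
  unfold endDist endFlow
  split_ifs
  · rw [fromEnd_fromEnd, min_reach]
  · rw [stretch_self hl.1]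

theorem endDist_endFlow_not (hloop : ∀ e, (∀ b, Γ.vert e b = o) → l ≤ 1 / 2) (e : E) (b : Bool)
    (a : ℝ) (t : unitInterval) :
    Γ.endDist l o e b (Γ.endFlow hl o e (!b) a t) = Γ.endDist l o e b t := by
  by_cases h : ∀ b, Γ.vert e b = o
  · rcases le_total l (fromEnd b t) with ht | ht
    · have := fromEnd_endFlow_not hl o hloop h (a := a) ht
      unfold endDist
      rw [if_pos (h _), if_pos (h _), min_eq_right ht, min_eq_right this]
    · have ht' : l ≤ fromEnd (!b) t := by
        have := hloop e h
        rw [coe_fromEnd_not]; linarith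
      rw [endFlow_of_le hl o ht']
  · by_cases h1 : Γ.vert e b = o
    · have h2 : Γ.vert e (!b) ≠ o := by
        refine fun h2 => h fun b' => ?_
        rcases Bool.eq_or_eq_not b' b with rfl | rfl
        · exact h1
        · exact h2
      unfold endFlow; rw [if_neg h2]
    · unfold endDist; rw [if_neg h1, if_neg h1]

theorem endDist_nonneg (hl : 0 < l) (e : E) (b : Bool) (t : unitInterval) :
    0 ≤ Γ.endDist l o e b t := by
  unfold endDist
  split_ifs
  · exact le_min (fromEnd b t).2.1 hl.le
  · exact hl.le

theorem endDist_le (e : E) (b : Bool) (t : unitInterval) : Γ.endDist l o e b t ≤ l := by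
  unfold endDist
  split_ifs
  · exact min_le_right _ _
  · exact le_rfl

open Classical in
/-- The distance from the vertex `o`, cut off at `l`. -/
def radius (hl : l ∈ Set.Ioc (0 : ℝ) 1) : Γ.Space → ℝ :=
  Γ.desc (fun v => if v = o then 0 else l)
    (fun e t => min (Γ.endDist l o e false t) (Γ.endDist l o e true t))
    (fun e => by
      unfold endDist
      rw [fromEnd_false, fromEnd_true, unitInterval.symm_zero]
      split_ifs <;> simp [hl.1.le, hl.2])
    (fun e => by
      unfold endDist
      rw [fromEnd_false, fromEnd_true, unitInterval.symm_one]
      split_ifs <;> simp [hl.1.le, hl.2])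

open Classical in
theorem radius_vertexPt (v : V) : Γ.radius o hl (Γ.vertexPt v) = if v = o then 0 else l := rfl

theorem radius_edgePt (e : E) (t : unitInterval) : Γ.radius o hl (Γ.edgePt e t) =
    min (Γ.endDist l o e false t) (Γ.endDist l o e true t) := rfl

theorem radius_lt_iff {d : ℝ} (hd : d ≤ l) (e : E) (t : unitInterval) :
    Γ.radius o hl (Γ.edgePt e t) < d ↔ ∃ b, Γ.vert e b = o ∧ (fromEnd b t : ℝ) < d := by
  have key : ∀ b, Γ.endDist l o e b t < d ↔ Γ.vert e b = o ∧ (fromEnd b t : ℝ) < d := by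
    intro b
    unfold endDist
    split_ifs with h
    · simp [h, hd.not_gt]
    · simp [h, hd]
  rw [radius_edgePt, min_lt_iff, key, key, Bool.exists_bool]

/-- The radial flow around the vertex `o`. -/
def radialFlow (hloop : ∀ e, (∀ b, Γ.vert e b = o) → l ≤ 1 / 2) : RadialFlow Γ.Space l where
  flow a := Γ.desc Γ.vertexPt (fun e t => Γ.edgePt e (Γ.edgeFlow hl o e a t))
    (fun e => by rw [edgeFlow_zero_right, edgePt_zero])
    (fun e => by rw [edgeFlow_one_right, edgePt_one])
  dist := Γ.radius o hl
  continuous_flow := continuous_prod_space (fun v => continuous_const) fun e =>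
    (Γ.continuous_edgePt e).comp ((Γ.continuous_endFlow hl o e true).comp
      (continuous_fst.prodMk (Γ.continuous_endFlow hl o e false)))
  continuous_dist := continuous_space fun e =>
    (Γ.continuous_endDist o e false).min (Γ.continuous_endDist o e true)
  flow_zero := space_cases (fun v => rfl) fun e t => by
    change Γ.edgePt e _ = _
    rw [edgeFlow_zero]
  flow_flow a b := space_cases (fun v => rfl) fun e t => by
    change Γ.edgePt e _ = Γ.edgePt e _
    rw [edgeFlow_edgeFlow hl o hloop]
  dist_flow a := space_cases (fun v => by
      change Γ.radius o hl (Γ.vertexPt v) = _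
      rw [radius_vertexPt]
      split_ifs
      · rw [stretch_zero_right]
      · rw [stretch_self hl.1]) fun e t => by
    change Γ.radius o hl (Γ.edgePt e _) = _
    rw [radius_edgePt, radius_edgePt]
    unfold edgeFlow
    have hf := endDist_endFlow_not hl o hloop e false a (Γ.endFlow hl o e false a t)
    have ht := endDist_endFlow_not hl o hloop e true a t
    rw [Bool.not_false] at hf
    rw [Bool.not_true] at ht
    rw [endDist_endFlow, hf, endDist_endFlow, ht]
    have h1 := endDist_nonneg (Γ := Γ) o hl.1 e false t
    have h2 := endDist_nonneg (Γ := Γ) o hl.1 e true t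
    have h3 := endDist_le (Γ := Γ) (l := l) o e false t
    have h4 := endDist_le (Γ := Γ) (l := l) o e true t
    rcases le_total (Γ.endDist l o e false t) (Γ.endDist l o e true t) with h | h
    · rw [min_eq_left h, min_eq_left (stretch_mono hl.1 h1 h h4)]
    · rw [min_eq_right h, min_eq_right (stretch_mono hl.1 h2 h h3)]
  dist_nonneg := space_cases (fun v => by
      rw [radius_vertexPt]
      split_ifs
      · exact le_rfl
      · exact hl.1.le) fun e t =>
    le_min (endDist_nonneg o hl.1 e false t) (endDist_nonneg o hl.1 e true t)
  dist_le := space_cases (fun v => by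
      rw [radius_vertexPt]
      split_ifs
      · exact hl.1.le
      · exact le_rfl) fun e t =>
    min_le_of_left_le (endDist_le o e false t)
  eq_of_dist := by
    have key : ∀ x, Γ.radius o hl x = 0 → x = Γ.vertexPt o := by
      refine space_cases (fun v h => ?_) fun e t h => ?_
      · rw [radius_vertexPt] at h
        split_ifs at h with hv
        · rw [hv]
        · exact absurd h hl.1.ne'
      · obtain ⟨b, hb, h0⟩ : ∃ b, Γ.vert e b = o ∧ (fromEnd b t : ℝ) = 0 := by
          have h5 : ∀ b, Γ.endDist l o e b t = 0 → Γ.vert e b = o ∧ (fromEnd b t : ℝ) = 0 := by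
            intro b hb
            unfold endDist at hb
            split_ifs at hb with hv
            · refine ⟨hv, ?_⟩
              rcases min_choice (fromEnd b t : ℝ) l with h6 | h6 <;> rw [h6] at hb
              · exact hb
              · exact absurd hb hl.1.ne'
            · exact absurd hb hl.1.ne'
          rw [radius_edgePt] at h
          rcases min_choice (Γ.endDist l o e false t) (Γ.endDist l o e true t) with h6 | h6 <;>
            rw [h6] at h
          · exact ⟨_, h5 _ h⟩
          · exact ⟨_, h5 _ h⟩
        rw [← hb, ← halfEdgePt_zero e b, halfEdgePt_eq, ← fromEnd_fromEnd b t, show fromEnd b t = 0 from Subtype.ext h0]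
    exact fun x y hx hy => (key x hx).trans (key y hy).symm

end radial

end Multigraph

/-- A map with a left homotopy inverse `b`, which in turn has a left homotopy inverse, is a homotopy
equivalence. -/
theorem isHomotopyEquiv_of_two_sided {A B : Type} [TopologicalSpace A] [TopologicalSpace B]
    {a a₀ : C(A, B)} {b : C(B, A)} (h : (b.comp a).Homotopic (.id A))
    (h₀ : (a₀.comp b).Homotopic (.id B)) : IsHomotopyEquiv a ∧ a.Homotopic a₀ := by
  have h1 : a.Homotopic a₀ := by
    have h2 : ((a₀.comp b).comp a).Homotopic ((ContinuousMap.id B).comp a) :=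
      h₀.comp (.refl a)
    have h3 : (a₀.comp (b.comp a)).Homotopic (a₀.comp (.id A)) := .comp (.refl a₀) h
    exact h2.symm.trans h3
  exact ⟨.of_homotopic b h ((ContinuousMap.Homotopic.comp h1 (.refl b)).trans h₀), h1⟩

namespace Multigraph

variable {V E : Type} {Γ : Multigraph V E}

/-! ### Neighbourhoods of a subgraph -/

namespace Subgraph

variable (T : Γ.Subgraph) {ε : ℝ}

theorem mem_nhd_iff (hε : 0 < ε) (hε' : ε ≤ 1) : (∀ v, Γ.vertexPt v ∈ T.nhd ε ↔ v ∈ T.verts) ∧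
    ∀ e t, Γ.edgePt e t ∈ T.nhd ε ↔
      e ∈ T.edges ∨ ∃ b, Γ.vert e b ∈ T.verts ∧ (fromEnd b t : ℝ) < ε := by
  let P : Γ.Space → Prop := Γ.desc (fun v => v ∈ T.verts)
    (fun e t => e ∈ T.edges ∨ ∃ b, Γ.vert e b ∈ T.verts ∧ (fromEnd b t : ℝ) < ε)
    (fun e => by
      refine propext ⟨?_, fun h => .inr ⟨false, h, by simpa [fromEnd] using hε⟩⟩
      rintro (h | ⟨b, h, h'⟩)
      · exact T.vert_mem e h _
      · cases b
        · exact h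
        · simp [fromEnd] at h'; linarith)
    (fun e => by
      refine propext ⟨?_, fun h => .inr ⟨true, h, by simpa [fromEnd] using hε⟩⟩
      rintro (h | ⟨b, h, h'⟩)
      · exact T.vert_mem e h _
      · cases b
        · simp [fromEnd] at h'; linarith
        · exact h)
  have hP : ∀ x, x ∈ T.nhd ε ↔ P x := by
    intro x
    constructor
    · rintro (⟨v, hv, rfl⟩ | ⟨e, he, t, rfl⟩ | ⟨e, b, t, hv, ht, rfl⟩)
      · exact hv
      · exact .inl he
      · exact .inr ⟨b, hv, by rwa [← fromEnd_fromEnd b t] at ht⟩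
    · refine space_cases (p := fun x => P x → x ∈ T.nhd ε) (fun v hv => .inl ⟨v, hv, rfl⟩)
        (fun e t h => ?_) x
      rcases h with h | ⟨b, h, h'⟩
      · exact .inr (.inl ⟨e, h, t, rfl⟩)
      · exact .inr (.inr ⟨e, b, fromEnd b t, h, h', by rw [halfEdgePt_eq, fromEnd_fromEnd]⟩)
  exact ⟨fun v => hP _, fun e t => hP _⟩

theorem vertexPt_mem_nhd (hε : 0 < ε) (hε' : ε ≤ 1) {v : V} :
    Γ.vertexPt v ∈ T.nhd ε ↔ v ∈ T.verts := (T.mem_nhd_iff hε hε').1 v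

theorem edgePt_mem_nhd (hε : 0 < ε) (hε' : ε ≤ 1) {e : E} {t : unitInterval} :
    Γ.edgePt e t ∈ T.nhd ε ↔
      e ∈ T.edges ∨ ∃ b, Γ.vert e b ∈ T.verts ∧ (fromEnd b t : ℝ) < ε :=
  (T.mem_nhd_iff hε hε').2 e t

variable [DecidableEq V] [DecidableEq E]

theorem collapse_vertexPt (v : V) :
    T.collapse (Γ.vertexPt v) = T.contract.vertexPt (T.collapseVert v) := rfl

theorem collapse_edgePt {e : E} (h : e ∉ T.edges) (t : unitInterval) :
    T.collapse (Γ.edgePt e t) = T.contract.edgePt ⟨e, h⟩ t := dif_neg h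

theorem collapse_edgePt_of_mem {e : E} (h : e ∈ T.edges) (t : unitInterval) :
    T.collapse (Γ.edgePt e t) = T.contract.vertexPt ⊥ := dif_pos h

theorem collapseVert_eq_bot {v : V} : T.collapseVert v = ⊥ ↔ v ∈ T.verts := by
  unfold collapseVert; split_ifs with h <;> simp [h]

theorem contract_vert_eq_bot {e : {e : E // e ∉ T.edges}} {b : Bool} :
    T.contract.vert e b = ⊥ ↔ Γ.vert e.1 b ∈ T.verts := T.collapseVert_eq_bot

variable {l : ℝ} (hl : l ∈ Set.Ioc (0 : ℝ) 1)

theorem radius_collapse_lt (hε : 0 < ε) (hεl : ε ≤ l) (x : Γ.Space) :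
    T.contract.radius ⊥ hl (T.collapse x) < ε ↔ x ∈ T.nhd ε := by
  refine space_cases (p := fun x => T.contract.radius ⊥ hl (T.collapse x) < ε ↔ x ∈ T.nhd ε)
    (fun v => ?_) (fun e t => ?_) x
  · rw [vertexPt_mem_nhd T hε (hεl.trans hl.2), collapse_vertexPt, radius_vertexPt,
      collapseVert_eq_bot]
    split_ifs with h
    · simp [h, hε]
    · simp [h, hεl]
  · rw [edgePt_mem_nhd T hε (hεl.trans hl.2)]
    by_cases h : e ∈ T.edges
    · rw [collapse_edgePt_of_mem T h, radius_vertexPt]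
      simp [h, hε]
    · rw [collapse_edgePt T h, radius_lt_iff _ _ hεl]
      simp only [contract_vert_eq_bot, h, false_or]

theorem loop_of_contract (hloop : (∃ e ∉ T.edges, ∀ b, Γ.vert e b ∈ T.verts) → l ≤ 1 / 2)
    (e : {e : E // e ∉ T.edges}) (h : ∀ b, T.contract.vert e b = ⊥) : l ≤ 1 / 2 :=
  hloop ⟨e.1, e.2, fun b => T.contract_vert_eq_bot.1 (h b)⟩

/-- The radial flow around the vertex `[T]` of `Γ / T`. -/
def contractFlow (hloop : (∃ e ∉ T.edges, ∀ b, Γ.vert e b ∈ T.verts) → l ≤ 1 / 2) :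
    RadialFlow T.contract.Space l :=
  T.contract.radialFlow hl ⊥ (T.loop_of_contract hloop)

variable {T}

theorem nhdContract_eq (hT : T.verts.Nonempty)
    (hloop : (∃ e ∉ T.edges, ∀ b, Γ.vert e b ∈ T.verts) → l ≤ 1 / 2) (hε : 0 < ε) (hεl : ε ≤ l) :
    T.nhdContract ε = (T.contractFlow hl hloop).star ε := by
  ext y
  constructor
  · rintro ⟨x, hx, rfl⟩
    exact (T.radius_collapse_lt hl hε hεl x).2 hx
  · intro hy
    obtain ⟨x, rfl⟩ := T.collapse_surjective hT y
    exact ⟨x, (T.radius_collapse_lt hl hε hεl x).1 hy, rfl⟩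

/-- The neighbourhood of the tree is saturated with respect to the collapse map. -/
theorem collapse_mem_nhdContract (hε : 0 < ε) (hε' : ε ≤ 1)
    {x : Γ.Space} : T.collapse x ∈ T.nhdContract ε ↔ x ∈ T.nhd ε := by
  refine ⟨?_, fun h => ⟨x, h, rfl⟩⟩
  rintro ⟨y, hy, h⟩
  have h1 : (1 : ℝ) ∈ Set.Ioc (0 : ℝ) 1 := by simp
  rw [← T.radius_collapse_lt h1 hε hε'] at hy ⊢
  rwa [← h]

/-- A radius for a radial flow around `[T]` that exceeds `ε`. -/
theorem exists_radius (hε : 0 < ε) (hε' : ε ≤ 1 / 2)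
    (hloop : (∃ e ∉ T.edges, ∀ b, Γ.vert e b ∈ T.verts) → ε < 1 / 2) :
    ∃ l, l ∈ Set.Ioc (0 : ℝ) 1 ∧ ε < l ∧
      ((∃ e ∉ T.edges, ∀ b, Γ.vert e b ∈ T.verts) → l ≤ 1 / 2) := by
  by_cases h : ∃ e ∉ T.edges, ∀ b, Γ.vert e b ∈ T.verts
  -- The flow has to leave the midpoints of loops at `[T]` fixed.
  · exact ⟨1 / 2, by norm_num, hloop h, fun _ => le_rfl⟩
  · exact ⟨1, by norm_num, by linarith, fun h' => (h h').elim⟩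

theorem isHomotopyEquiv_incl (hT : T.verts.Nonempty) (hε : 0 < ε) (hε' : ε ≤ 1 / 2)
    (hloop : (∃ e ∉ T.edges, ∀ b, Γ.vert e b ∈ T.verts) → ε < 1 / 2) (n : ℕ) :
    IsHomotopyEquiv (ConfLE.incl n 1 (T.nhdContract ε)) ∧
      IsHomotopyEquiv (UConfLE.incl n 1 (T.nhdContract ε)) := by
  obtain ⟨l, hl, hεl, hl'⟩ := exists_radius hε hε' hloop
  rw [nhdContract_eq hl hT hl' hε hεl.le]
  exact (T.contractFlow hl hl').isHomotopyEquiv_incl hε.le hεl n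

theorem pushHomotopic_id [Finite V] [Finite E] (hT : T.verts.Nonempty) (hε : 0 < ε)
    (hε' : ε ≤ 1 / 2) (hloop : (∃ e ∉ T.edges, ∀ b, Γ.vert e b ∈ T.verts) → ε < 1 / 2)
    (h : C(T.contract.Space, T.contract.Space))
    (hm : Set.MapsTo h (T.nhdContract ε) (T.nhdContract ε))
    (hfix : ∀ x ∉ T.nhdContract ε, h x = x) :
    PushHomotopic h (.id _) (T.nhdContract ε) (T.nhdContract ε) := by
  obtain ⟨l, hl, hεl, hl'⟩ := exists_radius hε hε' hloop
  rw [nhdContract_eq hl hT hl' hε hεl.le] at hm hfix ⊢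
  have : Finite (WithBot {v : V // v ∉ T.verts}) := inferInstanceAs (Finite (Option _))
  exact (T.contractFlow hl hl').pushHomotopic_id hε hεl h hm hfix

theorem IsExpansion.collapse_pushable {f : C(T.contract.Space, Γ.Space)}
    (hf : T.IsExpansion ε f) (hε : 0 < ε) (hε' : ε ≤ 1) :
    Pushable T.collapse (T.nhd ε) (T.nhdContract ε) where
  mapsTo x hx := ⟨x, hx, rfl⟩
  mapsTo_compl x hx h := hx ((collapse_mem_nhdContract hε hε').1 h)
  injOn x hx y hy h := by rw [← hf.fix x hx, h, hf.fix y hy]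

/-- All expansions are homotopic after passing to configurations with at most one point in the
neighbourhood, and they are homotopy inverse to the collapse map, as soon as this
holds for one of them. -/
theorem IsExpansion.isHomotopyEquiv_push [Finite V] [Finite E] (hT : T.verts.Nonempty) (hε : 0 < ε)
    (hε' : ε ≤ 1 / 2) (hloop : (∃ e ∉ T.edges, ∀ b, Γ.vert e b ∈ T.verts) → ε < 1 / 2)
    {f₀ f : C(T.contract.Space, Γ.Space)} (hf₀ : T.IsExpansion ε f₀) (hf : T.IsExpansion ε f)
    (h₀ : PushHomotopic (f₀.comp T.collapse) (.id _) (T.nhd ε) (T.nhd ε)) (n : ℕ) :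
    IsHomotopyEquiv (ConfLE.push n (hf.pushable hT)) ∧
      IsHomotopyEquiv (UConfLE.push n (hf.pushable hT)) ∧
      (UConfLE.push n (hf.pushable hT)).Homotopic (UConfLE.push n (hf₀.pushable hT)) := by
  have hq := hf₀.collapse_pushable hε (by linarith)
  have hid : ∀ {X : Type} [TopologicalSpace X] (U : Set X), Pushable (.id X) U U := fun U =>
    .of_fix (Set.mapsTo_id U) fun _ _ => rfl
  have h : PushHomotopic (T.collapse.comp f) (.id _) (T.nhdContract ε) (T.nhdContract ε) := by
    refine pushHomotopic_id hT hε hε' hloop _ (hq.mapsTo.comp (hf.pushable hT).mapsTo) ?_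
    intro y hy
    obtain ⟨x, rfl⟩ := T.collapse_surjective hT y
    rw [ContinuousMap.comp_apply, hf.fix x fun hx => hy ⟨x, hx, rfl⟩]
  have c1 := h.conf n (hq.comp (hf.pushable hT)) (hid _)
  have c2 := h₀.conf n ((hf₀.pushable hT).comp hq) (hid _)
  have u1 := h.uconf n (hq.comp (hf.pushable hT)) (hid _)
  have u2 := h₀.uconf n ((hf₀.pushable hT).comp hq) (hid _)
  rw [UConfLE.push_id n (hid _) fun _ => rfl, UConfLE.push_comp n (hf.pushable hT) hq] at u1
  rw [UConfLE.push_id n (hid _) fun _ => rfl, UConfLE.push_comp n hq (hf₀.pushable hT)] at u2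
  rw [ConfLE.push_id n (hid _) fun _ => rfl] at c1 c2
  have hc := isHomotopyEquiv_of_two_sided (a := ConfLE.push n (hf.pushable hT))
    (b := ConfLE.push n hq) (a₀ := ConfLE.push n (hf₀.pushable hT)) c1 c2
  have hu := isHomotopyEquiv_of_two_sided u1 u2
  exact ⟨hc.1, hu.1, hu.2⟩

end Subgraph
end Multigraph

namespace Multigraph

variable {V E : Type} {Γ : Multigraph V E}

/-! ### Edge paths as maps into the realization -/

/-- The realization of an edge path, at unit speed. The vertex `v` is its starting point. The path
is constant before time `0` and after its length. -/
def pathPt (Γ : Multigraph V E) (v : V) : List (E × Bool) → ℝ → Γ.Space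
  | [], _ => Γ.vertexPt v
  | d :: l, τ => if τ ≤ 1 then Γ.halfEdgePt d.1 d.2 (Set.projIcc 0 1 zero_le_one τ)
      else pathPt Γ (Γ.vert d.1 !d.2) l (τ - 1)

theorem pathPt_of_nonpos {v w : V} {l : List (E × Bool)} (hl : Γ.IsWalk v l w) {τ : ℝ}
    (h : τ ≤ 0) : Γ.pathPt v l τ = Γ.vertexPt v := by
  cases l with
  | nil => rfl
  | cons d l =>
    rw [pathPt, if_pos (h.trans zero_le_one), Set.projIcc_of_le_left _ h, ← hl.1]
    exact halfEdgePt_zero d.1 d.2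

theorem pathPt_of_length_le {v w : V} {l : List (E × Bool)} (hl : Γ.IsWalk v l w) {τ : ℝ}
    (h : l.length ≤ τ) : Γ.pathPt v l τ = Γ.vertexPt w := by
  induction l generalizing v τ with
  | nil => rw [show v = w from hl]; rfl
  | cons d l ih =>
    rw [List.length_cons, Nat.cast_add, Nat.cast_one] at h
    rw [pathPt]
    split_ifs with h1
    · have h2 : (l.length : ℝ) = 0 := le_antisymm (by linarith) (Nat.cast_nonneg _)
      have h3 : τ = 1 := by linarith
      have h4 : l = [] := List.length_eq_zero_iff.1 (by exact_mod_cast h2)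
      subst h4 h3
      rw [Set.projIcc_right]
      refine (halfEdgePt_one d.1 d.2).trans ?_
      rw [show Γ.vert d.1 (!d.2) = w from hl.2]
    · exact ih hl.2 (by linarith)

theorem pathPt_append_left {v w : V} {l : List (E × Bool)} (hl : Γ.IsWalk v l w)
    (l' : List (E × Bool)) {u : V} (hl' : Γ.IsWalk w l' u) {τ : ℝ} (h : τ ≤ l.length) :
    Γ.pathPt v (l ++ l') τ = Γ.pathPt v l τ := by
  induction l generalizing v τ with
  | nil =>
    have hv : v = w := hl
    subst hv
    exact pathPt_of_nonpos hl' (by simpa using h)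
  | cons d l ih =>
    rw [List.length_cons, Nat.cast_add, Nat.cast_one] at h
    rw [List.cons_append, pathPt, pathPt]
    split_ifs
    · rfl
    · exact ih hl.2 (by linarith)

theorem pathPt_append_right {v w : V} {l : List (E × Bool)} (hl : Γ.IsWalk v l w)
    (l' : List (E × Bool)) {u : V} (hl' : Γ.IsWalk w l' u) {τ : ℝ} (h : l.length ≤ τ) :
    Γ.pathPt v (l ++ l') τ = Γ.pathPt w l' (τ - l.length) := by
  induction l generalizing v τ with
  | nil => simp [show v = w from hl]
  | cons d l ih =>
    rw [List.length_cons, Nat.cast_add, Nat.cast_one] at h ⊢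
    rw [List.cons_append, pathPt]
    split_ifs with h1
    · have h2 : (l.length : ℝ) = 0 := le_antisymm (by linarith) (Nat.cast_nonneg _)
      have h3 : τ = 1 := by linarith
      have h4 : l = [] := List.length_eq_zero_iff.1 (by exact_mod_cast h2)
      subst h4 h3
      rw [Set.projIcc_right, pathPt_of_nonpos hl' (by simp)]
      refine (halfEdgePt_one d.1 d.2).trans ?_
      rw [show Γ.vert d.1 (!d.2) = w from hl.2]
    · rw [ih hl.2 (by linarith)]
      congr 1
      ring

theorem continuous_pathPt {v w : V} {l : List (E × Bool)} (hl : Γ.IsWalk v l w) :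
    Continuous (Γ.pathPt v l) := by
  induction l generalizing v with
  | nil => exact continuous_const
  | cons d l ih =>
    refine Continuous.if_le ((continuous_halfEdgePt d.1 d.2).comp continuous_projIcc)
      ((ih hl.2).comp (continuous_id.sub continuous_const)) continuous_id continuous_const ?_
    rintro τ rfl
    rw [Set.projIcc_right, sub_self, pathPt_of_nonpos hl.2 le_rfl]
    exact halfEdgePt_one d.1 d.2

theorem isWalk_append {v w u : V} {l l' : List (E × Bool)} (hl : Γ.IsWalk v l w)
    (hl' : Γ.IsWalk w l' u) : Γ.IsWalk v (l ++ l') u := by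
  induction l generalizing v with
  | nil => rwa [show v = w from hl]
  | cons d l ih => exact ⟨hl.1, ih hl.2⟩

theorem isWalk_of_append {v u : V} {l l' : List (E × Bool)} (h : Γ.IsWalk v (l ++ l') u) :
    ∃ w, Γ.IsWalk v l w ∧ Γ.IsWalk w l' u := by
  induction l generalizing v with
  | nil => exact ⟨v, rfl, h⟩
  | cons d l ih =>
    obtain ⟨w, h1, h2⟩ := ih h.2
    exact ⟨w, ⟨h.1, h1⟩, h2⟩

theorem isWalk_single (e : E) (b : Bool) : Γ.IsWalk (Γ.vert e b) [(e, b)] (Γ.vert e !b) :=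
  ⟨rfl, rfl⟩

theorem pathPt_single (e : E) (b : Bool) (t : unitInterval) :
    Γ.pathPt (Γ.vert e b) [(e, b)] t = Γ.halfEdgePt e b t := by
  rw [pathPt, if_pos t.2.2, Set.projIcc_val]

namespace Subgraph

variable {T : Γ.Subgraph}

/-- The realization of a subgraph. -/
def carrier (T : Γ.Subgraph) : Set Γ.Space :=
  {x | (∃ v ∈ T.verts, x = Γ.vertexPt v) ∨ ∃ e ∈ T.edges, ∃ t, x = Γ.edgePt e t}

theorem carrier_subset_nhd (ε : ℝ) : T.carrier ⊆ T.nhd ε := fun _ h =>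
  h.elim .inl fun h => .inr (.inl h)

theorem pathPt_mem_carrier {v : V} (hv : v ∈ T.verts) {l : List (E × Bool)}
    (h : ∀ d ∈ l, d.1 ∈ T.edges) (τ : ℝ) : Γ.pathPt v l τ ∈ T.carrier := by
  induction l generalizing v τ with
  | nil => exact .inl ⟨v, hv, rfl⟩
  | cons d l ih =>
    have hd := h d List.mem_cons_self
    rw [pathPt]
    split_ifs
    · exact .inr ⟨d.1, hd, _, rfl⟩
    · exact ih (T.vert_mem _ hd _) (fun d' hd' => h d' (List.mem_cons_of_mem _ hd')) _

end Subgraph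

/-! ### Paths in a tree -/

namespace Subgraph

variable {T : Γ.Subgraph} [Fintype V] [LinearOrder V] [DecidableEq E] (hT : T.IsTree)
  {r : V} (hr : r ∈ T.verts)
include hT hr

theorem path_unique {v : V} (hv : v ∈ T.verts) {l : List (E × Bool)} (h : T.IsPath r l v) :
    l = T.path r v :=
  (hT.2 r hr v hv).unique h (isPath_path hT hr hv)

/-- Every edge of a rooted tree has an end `b` that is closer to the root. -/
theorem exists_parent {e : E} (he : e ∈ T.edges) :
    ∃ b, T.path r (Γ.vert e !b) = T.path r (Γ.vert e b) ++ [(e, b)] := by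
  obtain ⟨h1, h2, h3⟩ := isPath_path hT hr (T.vert_mem e he false)
  rcases List.eq_nil_or_concat (T.path r (Γ.vert e false)) with h | ⟨l, d, h⟩
  · refine ⟨false, (path_unique hT hr (T.vert_mem e he _) ⟨isWalk_append h1
      (isWalk_single e false), ?_, ?_⟩).symm⟩
    · rw [h]; exact List.isChain_singleton _
    · rw [h]; simpa using he
  · rw [List.concat_eq_append] at h
    by_cases hd : d = (e, true)
    · refine ⟨true, ?_⟩
      subst hd
      rw [Bool.not_true, h]
      congr 1
      rw [h] at h1 h2 h3
      obtain ⟨w, h4, h5⟩ := isWalk_of_append h1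
      have hw : Γ.vert e true = w := h5.1
      subst hw
      exact path_unique hT hr (T.vert_mem e he _) ⟨h4, h2.left_of_append,
        fun d hd => h3 d (List.mem_append_left _ hd)⟩
    · refine ⟨false, (path_unique hT hr (T.vert_mem e he _) ⟨isWalk_append h1
        (isWalk_single e false), ?_, ?_⟩).symm⟩
      · refine List.isChain_append.2 ⟨h2, List.isChain_singleton _, ?_⟩
        intro x hx y hy
        rw [h] at hx
        simp only [List.getLast?_append, List.getLast?_singleton, Option.some_or,
          Option.mem_def, Option.some.injEq, List.head?_cons] at hx hy
        subst hx hy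
        intro hxy
        apply hd
        refine Prod.ext (congrArg Prod.fst hxy).symm ?_
        have := congrArg Prod.snd hxy
        simpa using this
      · intro d' hd'
        rcases List.mem_append.1 hd' with h' | h'
        · exact h3 d' h'
        · rw [List.mem_singleton.1 h']; exact he

end Subgraph
end Multigraph

namespace Multigraph

variable {V E : Type} {Γ : Multigraph V E}

/-! ### The contraction of a neighbourhood of the tree to the root -/

section hairTime

/-- The position, on the path that leads from the root to the end `x = 0` of a half-edge and then
along this half-edge, of the point `x` at time `s` of the contraction. Here `m` is the length of
the path from the root, and the contraction is supported in `x ≤ δ`. At time `s`, the points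
`x ≤ s * δ / 2` are in the tree. -/
def hairTime (δ s m x : ℝ) : ℝ :=
  min (1 - s + 2 * x / δ) 1 * m + max 0 (min x ((x - s * δ / 2) / (1 - s / 2)))

variable {δ s m x : ℝ}

theorem hairTime_zero_right (hδ : 0 < δ) (h0 : 0 ≤ s) (h1 : s ≤ 1) :
    hairTime δ s m 0 = (1 - s) * m := by
  have h : (0 - s * δ / 2) / (1 - s / 2) ≤ 0 :=
    div_nonpos_of_nonpos_of_nonneg (by nlinarith) (by linarith)
  rw [hairTime, min_eq_right h, max_eq_left h, mul_zero, zero_div, add_zero, add_zero,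
    min_eq_left (by linarith)]

theorem hairTime_of_le (hδ : 0 < δ) (h0 : 0 ≤ s) (h1 : s ≤ 1) (hx : δ ≤ x) :
    hairTime δ s m x = m + x := by
  have h2 : x ≤ (x - s * δ / 2) / (1 - s / 2) := by
    rw [le_div_iff₀ (by linarith)]
    nlinarith
  have h3 : 2 ≤ 2 * x / δ := by rw [le_div_iff₀ hδ]; linarith
  rw [hairTime, min_eq_left h2, max_eq_right (by linarith), min_eq_right (by linarith), one_mul]

theorem hairTime_zero (hδ : 0 < δ) (hx : 0 ≤ x) : hairTime δ 0 m x = m + x := by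
  have h3 : 0 ≤ 2 * x / δ := by positivity
  rw [hairTime, min_eq_right (by linarith)]
  simp [hx]

theorem hairTime_le (hm : 0 ≤ m) (hx : 0 ≤ x) : hairTime δ s m x ≤ m + x := by
  have h1 : min (1 - s + 2 * x / δ) 1 * m ≤ 1 * m := by gcongr; exact min_le_right _ _
  have h2 : max 0 (min x ((x - s * δ / 2) / (1 - s / 2))) ≤ x :=
    max_le hx (min_le_left _ _)
  unfold hairTime; linarith

theorem continuous_hairTime {Z : Type*} [TopologicalSpace Z] (δ m : ℝ) {s x : Z → ℝ}
    (hs : Continuous s) (hx : Continuous x) (h1 : ∀ z, s z ≤ 1) :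
    Continuous fun z => hairTime δ (s z) m (x z) := by
  have h2 : Continuous fun z => (x z - s z * δ / 2) / (1 - s z / 2) :=
    Continuous.div (by fun_prop) (by fun_prop) fun z => by have := h1 z; linarith
  unfold hairTime
  fun_prop

end hairTime

namespace Subgraph

variable (T : Γ.Subgraph) [Fintype V] [LinearOrder V] [DecidableEq E] (r : V)

/-- The end of an edge of the tree that is closer to the root `r`. -/
def parentEnd (e : E) : Bool :=
  if T.path r (Γ.vert e true) = T.path r (Γ.vert e false) ++ [(e, false)] then false else true

/-- The point at position `τ` on the path from `r` to the vertex of a half-edge and then along the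
half-edge. -/
def hairPt (e : E) (b : Bool) (τ : ℝ) : Γ.Space :=
  Γ.pathPt r (T.path r (Γ.vert e b) ++ [(e, b)]) τ

/-- The contraction on an edge outside the tree, as far as its end `b` is concerned. -/
def endSlide (δ : ℝ) (e : E) (b : Bool) (s t : unitInterval) : Γ.Space :=
  if Γ.vert e b ∈ T.verts then
    T.hairPt r e b (hairTime δ s (T.path r (Γ.vert e b)).length (fromEnd b t))
  else Γ.edgePt e t

/-- The contraction on an edge. An edge of the tree is pulled along the path from the root to its end
that is further away. On other edges, the two halves are treated separately. -/
def edgeSlide (δ : ℝ) (e : E) (s t : unitInterval) : Γ.Space :=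
  if e ∈ T.edges then
    Γ.pathPt r (T.path r (Γ.vert e !(T.parentEnd r e))) ((1 - s) *
      ((T.path r (Γ.vert e (T.parentEnd r e))).length + fromEnd (T.parentEnd r e) t))
  else if (t : ℝ) ≤ 1 / 2 then T.endSlide r δ e false s t else T.endSlide r δ e true s t

/-- The contraction on a vertex. -/
def vertSlide (s : unitInterval) (v : V) : Γ.Space :=
  if v ∈ T.verts then Γ.pathPt r (T.path r v) ((1 - s) * (T.path r v).length) else Γ.vertexPt v

variable {T r} (hT : T.IsTree) (hr : r ∈ T.verts) {δ : ℝ} (hδ : 0 < δ) (hδ' : δ ≤ 1 / 2)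

section
include hT hr

theorem path_parentEnd {e : E} (he : e ∈ T.edges) :
    T.path r (Γ.vert e !(T.parentEnd r e)) =
      T.path r (Γ.vert e (T.parentEnd r e)) ++ [(e, T.parentEnd r e)] := by
  unfold parentEnd
  split_ifs with h
  · exact h
  · obtain ⟨b, hb⟩ := exists_parent hT hr he
    cases b
    · exact absurd hb h
    · exact hb

theorem hairPt_of_le {e : E} {b : Bool} (hv : Γ.vert e b ∈ T.verts) {τ : ℝ}
    (h : τ ≤ (T.path r (Γ.vert e b)).length) :
    T.hairPt r e b τ = Γ.pathPt r (T.path r (Γ.vert e b)) τ :=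
  pathPt_append_left (isPath_path hT hr hv).1 _ (isWalk_single e b) h

theorem hairPt_add {e : E} {b : Bool} (hv : Γ.vert e b ∈ T.verts) (t : unitInterval) :
    T.hairPt r e b ((T.path r (Γ.vert e b)).length + t) = Γ.halfEdgePt e b t := by
  unfold hairPt
  rw [pathPt_append_right (isPath_path hT hr hv).1 _ (isWalk_single e b)
    (by linarith [t.2.1]), add_sub_cancel_left, pathPt_single]

theorem continuous_hairPt {e : E} {b : Bool} (hv : Γ.vert e b ∈ T.verts) :
    Continuous (T.hairPt r e b) :=
  continuous_pathPt (isWalk_append (isPath_path hT hr hv).1 (isWalk_single e b))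

theorem pathPt_path_mem {v : V} (hv : v ∈ T.verts) (τ : ℝ) :
    Γ.pathPt r (T.path r v) τ ∈ T.carrier :=
  pathPt_mem_carrier hr (isPath_path hT hr hv).2.2 τ

theorem vertSlide_zero (v : V) : T.vertSlide r 0 v = Γ.vertexPt v := by
  unfold vertSlide
  split_ifs with hv
  · exact pathPt_of_length_le (isPath_path hT hr hv).1 (by simp)
  · rfl

theorem vertSlide_one {v : V} (hv : v ∈ T.verts) : T.vertSlide r 1 v = Γ.vertexPt r := by
  unfold vertSlide
  rw [if_pos hv]
  exact pathPt_of_nonpos (isPath_path hT hr hv).1 (by simp)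

include hδ

theorem endSlide_of_eq_zero {e : E} {b : Bool} {s t : unitInterval} (h : fromEnd b t = 0) :
    T.endSlide r δ e b s t = T.vertSlide r s (Γ.vert e b) := by
  unfold endSlide vertSlide
  split_ifs with hv
  · rw [h, Set.Icc.coe_zero, hairTime_zero_right hδ s.2.1 s.2.2, hairPt_of_le hT hr hv]
    have := s.2.1
    have : (0 : ℝ) ≤ (T.path r (Γ.vert e b)).length := Nat.cast_nonneg _
    nlinarith
  · rw [← fromEnd_fromEnd b t, h]
    exact halfEdgePt_zero e b

theorem endSlide_of_le {e : E} {b : Bool} {s t : unitInterval} (h : δ ≤ fromEnd b t) :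
    T.endSlide r δ e b s t = Γ.edgePt e t := by
  unfold endSlide
  split_ifs with hv
  · rw [hairTime_of_le hδ s.2.1 s.2.2 h, hairPt_add hT hr hv, halfEdgePt_eq, fromEnd_fromEnd]
  · rfl

theorem endSlide_zero {e : E} {b : Bool} {t : unitInterval} :
    T.endSlide r δ e b 0 t = Γ.edgePt e t := by
  unfold endSlide
  split_ifs with hv
  · rw [Set.Icc.coe_zero, hairTime_zero hδ (fromEnd b t).2.1, hairPt_add hT hr hv,
      halfEdgePt_eq, fromEnd_fromEnd]
  · rfl

theorem endSlide_mem (hδ' : δ ≤ 1) {e : E} {b : Bool} {s t : unitInterval} :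
    T.endSlide r δ e b s t = Γ.edgePt e t ∨
      (Γ.edgePt e t ∈ T.nhd δ ∧ T.endSlide r δ e b s t ∈ T.nhd δ) := by
  rcases le_or_gt δ (fromEnd b t) with h | h
  · exact .inl (endSlide_of_le hT hr hδ h)
  by_cases hv : Γ.vert e b ∈ T.verts
  · right
    refine ⟨(T.edgePt_mem_nhd hδ hδ').2 (.inr ⟨b, hv, h⟩), ?_⟩
    unfold endSlide
    rw [if_pos hv]
    set m := (T.path r (Γ.vert e b)).length
    have hm : (0 : ℝ) ≤ m := Nat.cast_nonneg _
    have h1 := hairTime_le (δ := δ) (s := s) hm (fromEnd b t).2.1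
    rcases le_total (hairTime δ s m (fromEnd b t)) m with h2 | h2
    · rw [hairPt_of_le hT hr hv h2]
      exact carrier_subset_nhd _ (pathPt_path_mem hT hr hv _)
    · have h3 : hairTime δ s m (fromEnd b t) - m ∈ unitInterval :=
        ⟨by linarith, by linarith⟩
      have h4 := hairPt_add hT hr hv ⟨_, h3⟩
      rw [add_sub_cancel] at h4
      rw [h4]
      exact .inr (.inr ⟨e, b, _, hv, by dsimp only; linarith, rfl⟩)
  · left
    unfold endSlide
    rw [if_neg hv]

theorem continuous_endSlide (e : E) (b : Bool) :
    Continuous fun p : unitInterval × unitInterval => T.endSlide r δ e b p.1 p.2 := by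
  unfold endSlide
  split_ifs with hv
  · refine (continuous_hairPt hT hr hv).comp (continuous_hairTime _ _ (by fun_prop) ?_
      fun z => z.1.2.2)
    exact continuous_subtype_val.comp ((continuous_fromEnd b).comp continuous_snd)
  · exact (Γ.continuous_edgePt e).comp continuous_snd

theorem edgeSlide_of_eq_zero {e : E} {b : Bool} {s t : unitInterval} (h : fromEnd b t = 0) :
    T.edgeSlide r δ e s t = T.vertSlide r s (Γ.vert e b) := by
  unfold edgeSlide
  split_ifs with he ht
  · have hpe := path_parentEnd hT hr he
    set b' := T.parentEnd r e
    have hs := s.2.1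
    have hm : (0 : ℝ) ≤ (T.path r (Γ.vert e b')).length := Nat.cast_nonneg _
    unfold vertSlide
    rw [if_pos (T.vert_mem e he b)]
    rcases Bool.eq_or_eq_not b b' with rfl | hb
    · rw [h, Set.Icc.coe_zero, add_zero, hpe]
      exact pathPt_append_left (isPath_path hT hr (T.vert_mem e he _)).1 _ (isWalk_single e _)
        (by nlinarith)
    · have hb' : b' = !b := by rw [hb, Bool.not_not]
      have h1 := coe_fromEnd_not b t
      rw [h, Set.Icc.coe_zero, sub_zero, ← hb'] at h1
      have h2 := congrArg List.length hpe
      rw [List.length_append, List.length_singleton] at h2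
      rw [h1, hb, h2]
      push_cast
      rfl
  · cases b
    · exact endSlide_of_eq_zero hT hr hδ h
    · have : t = 1 := by rw [← fromEnd_fromEnd true t, h]; exact unitInterval.symm_zero
      subst this
      norm_num at ht
  · cases b
    · have : t = 0 := h
      subst this
      norm_num at ht
    · exact endSlide_of_eq_zero hT hr hδ h

theorem edgeSlide_zero (e : E) (t : unitInterval) : T.edgeSlide r δ e 0 t = Γ.edgePt e t := by
  unfold edgeSlide
  split_ifs with he ht
  · have hpe := path_parentEnd hT hr he
    set b' := T.parentEnd r e
    rw [Set.Icc.coe_zero, sub_zero, one_mul, hpe]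
    refine (hairPt_add hT hr (T.vert_mem e he b') _).trans ?_
    rw [halfEdgePt_eq, fromEnd_fromEnd]
  · exact endSlide_zero hT hr hδ
  · exact endSlide_zero hT hr hδ

theorem edgeSlide_one {e : E} (he : e ∈ T.edges) (t : unitInterval) :
    T.edgeSlide r δ e 1 t = Γ.vertexPt r := by
  unfold edgeSlide
  rw [if_pos he]
  exact pathPt_of_nonpos (isPath_path hT hr (T.vert_mem e he _)).1 (by simp)

theorem edgeSlide_mem (hδ' : δ ≤ 1) {e : E} {s t : unitInterval} :
    T.edgeSlide r δ e s t = Γ.edgePt e t ∨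
      (Γ.edgePt e t ∈ T.nhd δ ∧ T.edgeSlide r δ e s t ∈ T.nhd δ) := by
  unfold edgeSlide
  split_ifs with he ht
  · exact .inr ⟨(T.edgePt_mem_nhd hδ hδ').2 (.inl he),
      carrier_subset_nhd _ (pathPt_path_mem hT hr (T.vert_mem e he _) _)⟩
  · exact endSlide_mem hT hr hδ hδ'
  · exact endSlide_mem hT hr hδ hδ'

include hδ'

/-- On the half of an edge outside the tree that belongs to its end `b`, the contraction depends
on this end only. -/
theorem edgeSlide_of_le_half {e : E} (he : e ∉ T.edges) {b : Bool} {s t : unitInterval}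
    (h : (fromEnd b t : ℝ) ≤ 1 / 2) : T.edgeSlide r δ e s t = T.endSlide r δ e b s t := by
  unfold edgeSlide
  rw [if_neg he]
  have h1 := coe_fromEnd_not b t
  cases b
  · exact if_pos h
  · split_ifs with ht
    · have h2 : (t : ℝ) = 1 - fromEnd true t := h1
      rw [endSlide_of_le hT hr hδ, endSlide_of_le hT hr hδ]
      · linarith
      · rw [fromEnd_false]; linarith
    · rfl

theorem continuous_edgeSlide (e : E) :
    Continuous fun p : unitInterval × unitInterval => T.edgeSlide r δ e p.1 p.2 := by
  unfold edgeSlide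
  split_ifs with he
  · refine (continuous_pathPt (isPath_path hT hr (T.vert_mem e he _)).1).comp ?_
    have h : Continuous fun p : unitInterval × unitInterval =>
        (fromEnd (T.parentEnd r e) p.2 : ℝ) :=
      continuous_subtype_val.comp ((continuous_fromEnd _).comp continuous_snd)
    fun_prop
  · refine Continuous.if_le (continuous_endSlide hT hr hδ e false)
      (continuous_endSlide hT hr hδ e true) (by fun_prop) continuous_const ?_
    rintro ⟨s, t⟩ h
    dsimp only at h ⊢
    rw [endSlide_of_le hT hr hδ (by rw [fromEnd_false]; linarith), endSlide_of_le hT hr hδ]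
    rw [fromEnd_true, unitInterval.coe_symm_eq]
    linarith

end

/-- The contraction, at time `s`. -/
def slide (s : unitInterval) : Γ.Space → Γ.Space :=
  Γ.desc (T.vertSlide r s) (fun e t => T.edgeSlide r δ e s t)
    (fun _ => edgeSlide_of_eq_zero hT hr hδ (b := false) rfl)
    (fun _ => edgeSlide_of_eq_zero hT hr hδ (b := true) unitInterval.symm_one)

theorem slide_zero (x : Γ.Space) : slide hT hr hδ 0 x = x :=
  space_cases (p := fun x => slide hT hr hδ 0 x = x) (vertSlide_zero hT hr)
    (edgeSlide_zero hT hr hδ) x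

/-- The contraction moves points of the `δ`-neighbourhood of the tree only, and keeps them there. -/
theorem slide_mem (hδ' : δ ≤ 1) (s : unitInterval) (x : Γ.Space) : slide hT hr hδ s x = x ∨
    (x ∈ T.nhd δ ∧ slide hT hr hδ s x ∈ T.nhd δ) := by
  refine space_cases (p := fun x => slide hT hr hδ s x = x ∨
    (x ∈ T.nhd δ ∧ slide hT hr hδ s x ∈ T.nhd δ)) (fun v => ?_)
    (fun e t => edgeSlide_mem hT hr hδ hδ') x
  by_cases hv : v ∈ T.verts
  · right
    refine ⟨(T.vertexPt_mem_nhd hδ hδ').2 hv, ?_⟩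
    change T.vertSlide r s v ∈ _
    unfold vertSlide
    rw [if_pos hv]
    exact carrier_subset_nhd _ (pathPt_path_mem hT hr hv _)
  · left
    change T.vertSlide r s v = _
    unfold vertSlide
    rw [if_neg hv]

include hδ' in
theorem continuous_slide : Continuous fun p : unitInterval × Γ.Space => slide hT hr hδ p.1 p.2 := by
  refine continuous_prod_space (fun v => ?_) fun e => continuous_edgeSlide hT hr hδ hδ' e
  change Continuous fun s => T.vertSlide r s v
  unfold vertSlide
  split_ifs with hv
  · exact (continuous_pathPt (isPath_path hT hr hv).1).comp (by fun_prop)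
  · exact continuous_const

/-- The expansion `Γ / T → Γ` through which the contraction at time `1` factors. -/
def expansion : C(T.contract.Space, Γ.Space) where
  toFun := T.contract.desc
    (fun v => WithBot.recBotCoe (C := fun _ => Γ.Space) (Γ.vertexPt r) (fun v => Γ.vertexPt v.1) v)
    (fun e t => T.edgeSlide r δ e.1 1 t)
    (fun e => by
      rw [edgeSlide_of_eq_zero hT hr hδ (b := false) rfl]
      change _ = WithBot.recBotCoe (C := fun _ => Γ.Space) _ _ (T.collapseVert (Γ.vert e.1 false))
      unfold collapseVert
      split_ifs with h
      · exact vertSlide_one hT hr h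
      · exact if_neg h)
    (fun e => by
      rw [edgeSlide_of_eq_zero hT hr hδ (b := true) unitInterval.symm_one]
      change _ = WithBot.recBotCoe (C := fun _ => Γ.Space) _ _ (T.collapseVert (Γ.vert e.1 true))
      unfold collapseVert
      split_ifs with h
      · exact vertSlide_one hT hr h
      · exact if_neg h)
  continuous_toFun := continuous_space fun e =>
    (continuous_edgeSlide hT hr hδ hδ' e.1).comp (by fun_prop : Continuous fun t => ((1 : unitInterval), t))

theorem expansion_collapse (x : Γ.Space) :
    expansion hT hr hδ hδ' (T.collapse x) = slide hT hr hδ 1 x := by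
  refine space_cases (p := fun x => expansion hT hr hδ hδ' (T.collapse x) = slide hT hr hδ 1 x)
    (fun v => ?_) (fun e t => ?_) x
  · rw [collapse_vertexPt]
    change _ = T.vertSlide r 1 v
    unfold collapseVert
    split_ifs with h
    · exact (vertSlide_one hT hr h).symm
    · exact (if_neg h).symm
  · by_cases h : e ∈ T.edges
    · rw [collapse_edgePt_of_mem T h]
      exact (edgeSlide_one hT hr hδ h t).symm
    · rw [collapse_edgePt T h]; rfl

theorem nhd_mono {ε ε' : ℝ} (h : ε ≤ ε') : T.nhd ε ⊆ T.nhd ε' := by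
  rintro x (h1 | h1 | ⟨e, b, t, hv, ht, h1⟩)
  · exact .inl h1
  · exact .inr (.inl h1)
  · exact .inr (.inr ⟨e, b, t, hv, ht.trans_le h, h1⟩)

theorem slide_pushable {ε : ℝ} (hδε : δ ≤ ε) (hε' : ε ≤ 1) (s : unitInterval) (x : Γ.Space) :
    (x ∈ T.nhd ε → slide hT hr hδ s x ∈ T.nhd ε) ∧ (x ∉ T.nhd ε → slide hT hr hδ s x = x) := by
  rcases slide_mem hT hr hδ (hδε.trans hε') s x with h | ⟨h1, h2⟩
  · exact ⟨fun hx => by rwa [h], fun _ => h⟩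
  · exact ⟨fun _ => nhd_mono hδε h2, fun hx => (hx (nhd_mono hδε h1)).elim⟩

theorem isExpansion_expansion {ε : ℝ} (hδε : δ ≤ ε) (hε' : ε ≤ 1) :
    T.IsExpansion ε (expansion hT hr hδ hδ') where
  mapsTo := by
    rintro _ ⟨x, hx, rfl⟩
    rw [expansion_collapse]
    exact (slide_pushable hT hr hδ hδε hε' 1 x).1 hx
  fix x hx := by
    rw [expansion_collapse]
    exact (slide_pushable hT hr hδ hδε hε' 1 x).2 hx

theorem pushHomotopic_expansion {ε : ℝ} (hδε : δ ≤ ε) (hε' : ε ≤ 1) :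
    PushHomotopic ((expansion hT hr hδ hδ').comp T.collapse) (.id _) (T.nhd ε) (T.nhd ε) := by
  refine ⟨⟨fun p => slide hT hr hδ (unitInterval.symm p.1) p.2,
    (continuous_slide hT hr hδ hδ').comp ((unitInterval.continuous_symm.comp continuous_fst).prodMk
      continuous_snd)⟩, fun x => ?_, fun x => ?_, fun s => ?_⟩
  · change slide hT hr hδ (unitInterval.symm 0) x = _
    rw [unitInterval.symm_zero]
    exact (expansion_collapse hT hr hδ hδ' x).symm
  · change slide hT hr hδ (unitInterval.symm 1) x = _
    rw [unitInterval.symm_one]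
    exact slide_zero hT hr hδ x
  · exact .of_fix (fun x hx => (slide_pushable hT hr hδ hδε hε' _ x).1 hx)
      fun x hx => (slide_pushable hT hr hδ hδε hε' _ x).2 hx

end Subgraph
end Multigraph

namespace Multigraph

variable {V E : Type} {Γ : Multigraph V E} [Fintype V] [LinearOrder V] [DecidableEq E]

/-! ### The contraction on reduced complexes -/

namespace Gen

variable {g : Γ.Gen}

theorem sign_congr {g' : Γ.Gen} {v : V} (h : ∀ w < v, g'.st w = g.st w) : g'.sign v = g.sign v := by
  unfold sign
  congr 2
  ext w
  simp only [Finset.mem_filter, mem_active_iff]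
  exact and_congr_left fun hw => by rw [h w hw]

theorem sign_setState (v : V) (s : LocalState E) (hs) :
    (g.setState v s hs).sign v = g.sign v :=
  sign_congr fun w hw => by simp [setState, hw.ne]

theorem sign_mul_sign (v : V) : g.sign v * g.sign v = 1 := by
  unfold sign; rw [← pow_add, ← two_mul, pow_mul]; simp

theorem setState_setState (v : V) (s s' : LocalState E) (hs hs') :
    (g.setState v s hs).setState v s' hs' = g.setState v s' hs' :=
  Gen.ext (by simp [setState]) rfl

theorem setState_comm {v w : V} (h : v ≠ w) (s s' : LocalState E) (hs hs') :
    (g.setState v s hs).setState w s' hs' = (g.setState w s' hs').setState v s hs :=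
  Gen.ext (Function.update_comm h.symm _ _ _).symm rfl

theorem setState_eq_self {v : V} {s : LocalState E} (hs) (h : g.st v = s) :
    g.setState v s hs = g :=
  Gen.ext (by simp [setState, ← h]) rfl

/-- Removal of the half-edge at `w`. -/
def clear (g : Γ.Gen) (w : V) : Γ.Gen := g.setState w .empty (by simp)

theorem clear_st_self (w : V) : (g.clear w).st w = .empty := by simp [clear, setState]

theorem clear_st_of_ne {v w : V} (h : v ≠ w) : (g.clear w).st v = g.st v := by
  simp [clear, setState, h]

end Gen

/-- The derivation of degree `-1` that maps the half-edges at `w` to the trivial element `∅`. -/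
def dropHalf (w : V) : Γ.Swiat →ₗ[ℤ] Γ.Swiat :=
  Finsupp.linearCombination ℤ fun g =>
    if (g.st w).isHalf then g.sign w • Finsupp.single (g.clear w) 1 else 0

theorem dropHalf_single (w : V) (g : Γ.Gen) : dropHalf w (Finsupp.single g 1) =
    if (g.st w).isHalf then g.sign w • Finsupp.single (g.clear w) 1 else 0 := by
  simp [dropHalf]

theorem dropHalf_apply [Fintype E] (w : V) (c : Γ.Swiat) {g : Γ.Gen} (hg : g.st w = .empty) :
    dropHalf w c g = g.sign w * ∑ h : {h : E × Bool // Γ.vert h.1 h.2 = w},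
      c (g.setState w (.half h.1.1 h.1.2) (by rintro e b ⟨⟩; exact h.2)) := by
  induction c using Finsupp.induction_linear with
  | zero => simp
  | add c c' h h' =>
    simp only [map_add, Finsupp.add_apply, h, h', Finset.sum_add_distrib, mul_add]
  | single g' a =>
    rw [← mul_one a, ← smul_eq_mul, ← Finsupp.smul_single, map_smul, dropHalf_single]
    simp only [Finsupp.smul_apply, ← Finset.smul_sum, mul_smul_comm]
    congr 1
    cases hs : g'.st w with
    | half e b =>
      have hv := g'.vert_eq w e b hs
      simp only [LocalState.isHalf, if_true, Finsupp.smul_apply, smul_eq_mul]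
      rw [Finset.sum_eq_single (⟨(e, b), hv⟩ : {h : E × Bool // Γ.vert h.1 h.2 = w})]
      · by_cases h : g'.clear w = g
        · subst h
          have h1 : (g'.clear w).setState w (.half e b) (by rintro e b ⟨⟩; exact hv) = g' := by
            rw [Gen.clear, Gen.setState_setState, Gen.setState_eq_self _ hs]
          rw [h1]
          simp [Gen.clear, Gen.sign_setState]
        · rw [Finsupp.single_eq_of_ne (Ne.symm h), Finsupp.single_eq_of_ne, mul_zero, mul_zero]
          rintro h1
          apply h
          rw [← h1, Gen.clear, Gen.setState_setState, Gen.setState_eq_self _ hg]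
      · rintro ⟨⟨e', b'⟩, hv'⟩ _ h
        rw [Finsupp.single_eq_of_ne]
        rintro rfl
        simp only [Gen.setState, Function.update_self, LocalState.half.injEq] at hs
        exact h (Subtype.ext (Prod.ext hs.1 hs.2))
      · simp
    | _ =>
      simp only [LocalState.isHalf, Bool.false_eq_true, if_false, Finsupp.zero_apply]
      rw [Finset.sum_eq_zero, mul_zero]
      rintro h -
      rw [Finsupp.single_eq_of_ne]
      rintro rfl
      simp [Gen.setState] at hs

variable (Γ) in
/-- The span of the generators without occupied vertices. -/
def noOccupied : Submodule ℤ Γ.Swiat := Finsupp.supported ℤ ℤ {g | ∀ v, g.st v ≠ .occupied}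

theorem single_mem_noOccupied {g : Γ.Gen} (h : ∀ v, g.st v ≠ .occupied) :
    Finsupp.single g 1 ∈ Γ.noOccupied := Finsupp.single_mem_supported ℤ 1 h

theorem noOccupied_le {N : Submodule ℤ Γ.Swiat}
    (h : ∀ g : Γ.Gen, (∀ v, g.st v ≠ .occupied) → Finsupp.single g 1 ∈ N) : Γ.noOccupied ≤ N := by
  rw [noOccupied, Finsupp.supported_eq_span_single, Submodule.span_le]
  rintro _ ⟨g, hg, rfl⟩
  exact h g hg

/-- The reduced complex is cut out by the operators `dropHalf`, since an element of the span of the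
half-edges at a vertex is a combination of differences if and only if its coefficients sum to `0`. -/
theorem mem_reducedSwiat_iff [Fintype E] (c : Γ.Swiat) :
    c ∈ Γ.reducedSwiat ↔ c ∈ Γ.noOccupied ∧ ∀ w, dropHalf w c = 0 := by
  refine and_congr ?_ ⟨fun h w => ?_, fun h g w => ?_⟩
  · rw [noOccupied, Finsupp.mem_supported]
    constructor
    · intro h g hg v hv
      exact Finsupp.mem_support_iff.1 hg (h g v hv)
    · intro h g v hv
      by_contra hc
      exact h (Finsupp.mem_support_iff.2 hc) v hv
  · ext g
    by_cases hg : g.st w = .empty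
    · rw [dropHalf_apply w c hg, h g w, mul_zero]; rfl
    · have : ∀ c : Γ.Swiat, dropHalf w c g = 0 := by
        intro c
        induction c using Finsupp.induction_linear with
        | zero => simp
        | add c c' h h' => rw [map_add, Finsupp.add_apply, h, h', add_zero]
        | single g' a =>
          rw [← mul_one a, ← smul_eq_mul, ← Finsupp.smul_single, map_smul, dropHalf_single]
          split_ifs
          · rw [Finsupp.smul_apply, Finsupp.smul_apply, Finsupp.single_eq_of_ne, smul_zero,
              smul_zero]
            rintro rfl
            exact hg (Gen.clear_st_self w)
          · simp
      exact this c
  · have h1 := dropHalf_apply w c (g := g.clear w) (Gen.clear_st_self w)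
    rw [h w] at h1
    have h2 : (g.clear w).sign w ≠ 0 := fun h0 => by
      have := Gen.sign_mul_sign (g := g.clear w) w
      rw [h0] at this; simp at this
    have h3 := (mul_eq_zero.1 h1.symm).resolve_left h2
    simpa only [Gen.clear, Gen.setState_setState] using h3

section drop
variable {g : Γ.Gen}

theorem dropHalf_putHalf_self {e : E} {b : Bool} (hv : g.st (Γ.vert e b) = .empty) :
    dropHalf (Γ.vert e b) (g.putHalf e b) = Finsupp.single g 1 := by
  unfold Gen.putHalf
  rw [map_smul, dropHalf_single, if_pos (by simp [Gen.setState, LocalState.isHalf]),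
    Gen.sign_setState, smul_smul, Gen.sign_mul_sign, one_smul, Gen.clear, Gen.setState_setState,
    Gen.setState_eq_self _ hv]

theorem dropHalf_putHalf_of_empty {e : E} {b : Bool} {w : V} (hv : g.st (Γ.vert e b) = .empty)
    (hw : g.st w = .empty) :
    dropHalf w (g.putHalf e b) = if Γ.vert e b = w then Finsupp.single g 1 else 0 := by
  split_ifs with h
  · subst h; exact dropHalf_putHalf_self hv
  · unfold Gen.putHalf
    rw [map_smul, dropHalf_single, if_neg, smul_zero]
    simp [Gen.setState, Ne.symm h, hw, LocalState.isHalf]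

theorem dropHalf_putHalf_of_ne {e : E} {b : Bool} {w : V} (hv : g.st (Γ.vert e b) = .empty)
    (hw : w ≠ Γ.vert e b) : dropHalf w (g.putHalf e b) =
      if (g.st w).isHalf then -(g.sign w • (g.clear w).putHalf e b) else 0 := by
  have hs : ∀ e' b', LocalState.half e b = .half e' b' → Γ.vert e' b' = Γ.vert e b := by
    rintro _ _ ⟨⟩; rfl
  obtain ⟨hna, ha⟩ := Gen.active_setState_half hv hs
  have hst : (g.setState (Γ.vert e b) (.half e b) hs).st w = g.st w := by
    simp [Gen.setState, hw]
  unfold Gen.putHalf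
  rw [map_smul, dropHalf_single, hst]
  split_ifs with h
  · have h1 : (g.clear w).active = g.active.erase w :=
      Gen.active_of_update (s := .empty) rfl rfl
    rw [Gen.sign_insert hna ha, Gen.sign_of_erase (Gen.mem_active_iff.2 h) h1, Gen.clear,
      Gen.clear, Gen.setState_comm hw.symm]
    rcases lt_or_gt_of_ne hw with h2 | h2
    · simp only [h2, h2.not_gt, if_true, if_false]
      module
    · simp only [h2, h2.not_gt, if_true, if_false]
      module
  · rw [smul_zero]

theorem dropHalf_putPath_of_empty {l : List (E × Bool)} {u x w : V} (hl : Γ.IsWalk u l x)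
    (h : ∀ d ∈ l, ∀ b, g.st (Γ.vert d.1 b) = .empty) (hw : g.st w = .empty) :
    dropHalf w (g.putPath l) = (if u = w then Finsupp.single g 1 else 0) -
      (if x = w then Finsupp.single g 1 else 0) := by
  induction l generalizing u with
  | nil => rw [show u = x from hl]; simp [Gen.putPath]
  | cons d l ih =>
    have hd := h d List.mem_cons_self
    have hcons : g.putPath (d :: l) =
        (g.putHalf d.1 d.2 - g.putHalf d.1 (!d.2)) + g.putPath l := by simp [Gen.putPath]
    rw [hcons, map_add, map_sub, dropHalf_putHalf_of_empty (hd _) hw,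
      dropHalf_putHalf_of_empty (hd _) hw, ih hl.2 fun d' hd' => h d' (List.mem_cons_of_mem _ hd'),
      hl.1]
    abel

theorem dropHalf_putPath_of_ne {l : List (E × Bool)} {w : V}
    (h : ∀ d ∈ l, ∀ b, g.st (Γ.vert d.1 b) = .empty ∧ w ≠ Γ.vert d.1 b) :
    dropHalf w (g.putPath l) =
      if (g.st w).isHalf then -(g.sign w • (g.clear w).putPath l) else 0 := by
  induction l with
  | nil => simp [Gen.putPath]
  | cons d l ih =>
    have hd := h d List.mem_cons_self
    have hcons : ∀ g : Γ.Gen, g.putPath (d :: l) =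
        (g.putHalf d.1 d.2 - g.putHalf d.1 (!d.2)) + g.putPath l := fun g => by simp [Gen.putPath]
    rw [hcons, hcons, map_add, map_sub, dropHalf_putHalf_of_ne (hd _).1 (hd _).2,
      dropHalf_putHalf_of_ne (hd _).1 (hd _).2, ih fun d' hd' => h d' (List.mem_cons_of_mem _ hd')]
    split_ifs
    · module
    · simp

theorem putHalf_mem_noOccupied {e : E} {b : Bool} (h : ∀ v, g.st v ≠ .occupied) :
    g.putHalf e b ∈ Γ.noOccupied := by
  refine Submodule.smul_mem _ _ (single_mem_noOccupied fun v => ?_)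
  simp only [Gen.setState]
  by_cases hv : v = Γ.vert e b
  · subst hv; simp
  · simp [hv, h]

theorem putPath_mem_noOccupied {l : List (E × Bool)} (h : ∀ v, g.st v ≠ .occupied) :
    g.putPath l ∈ Γ.noOccupied := by
  refine list_sum_mem fun x hx => ?_
  obtain ⟨d, hd, rfl⟩ := List.mem_map.1 hx
  exact Submodule.sub_mem _ (putHalf_mem_noOccupied h) (putHalf_mem_noOccupied h)

end drop

namespace Subgraph

variable {T : Γ.Subgraph} (hT : T.IsTree) {r : V} (hr : r ∈ T.verts)

theorem liftGen_noOccupied {g : T.contract.Gen} (h : ∀ v, g.st v ≠ .occupied) (v : V) :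
    (T.liftGen g).st v ≠ .occupied := by
  by_cases hv : v ∈ T.verts
  · rw [liftGen_st_of_mem hv]; simp
  · rw [liftGen_st (g := g) ⟨v, hv⟩]
    have := h ((⟨v, hv⟩ : {v : V // v ∉ T.verts}) : WithBot _)
    cases hs : g.st ((⟨v, hv⟩ : {v : V // v ∉ T.verts}) : WithBot _) <;>
      simp_all [LocalState.val]

theorem swiatContract_mem_noOccupied (r : V) (c : T.contract.Swiat)
    (hc : c ∈ T.contract.noOccupied) : T.swiatContract r c ∈ Γ.noOccupied := by
  refine noOccupied_le (N := Γ.noOccupied.comap (T.swiatContract r)) (fun g hg => ?_) hc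
  rw [Submodule.mem_comap, swiatContract_single]
  have h := liftGen_noOccupied hg
  cases hs : g.st ⊥ with
  | empty => exact single_mem_noOccupied h
  | occupied => exact absurd hs (hg _)
  | half e b => exact Submodule.add_mem _ (putHalf_mem_noOccupied h) (putPath_mem_noOccupied h)

theorem liftGen_clear_bot (g : T.contract.Gen) : T.liftGen (g.clear ⊥) = T.liftGen g :=
  Gen.ext (liftGen_of_bot rfl) rfl

theorem liftGen_clear (g : T.contract.Gen) (v : {v : V // v ∉ T.verts}) :
    T.liftGen (g.clear v) = (T.liftGen g).clear v.1 :=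
  Gen.ext (liftGen_face (s := .empty) rfl) rfl

include hT hr

/-- At a vertex `w` of the tree, the half-edges by which a path arrives and leaves cancel. -/
theorem dropHalf_swiatContract_of_mem {w : V} (hw : w ∈ T.verts) (c : T.contract.Swiat) :
    dropHalf w (T.swiatContract r c) =
      if r = w then T.swiatContract r (dropHalf ⊥ c) else 0 := by
  induction c using Finsupp.induction_linear with
  | zero => simp
  | add c c' h h' => rw [map_add, map_add, h, h']; split_ifs <;> simp
  | single g a =>
    rw [← mul_one a, ← smul_eq_mul, ← Finsupp.smul_single]
    simp only [map_smul]
    rw [← smul_zero a, ← smul_ite]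
    congr 1
    rw [swiatContract_single, dropHalf_single]
    have hl := liftGen_st_of_mem (g := g) hw
    have hlr := liftGen_st_of_mem (g := g) hr
    cases hs : g.st ⊥ with
    | empty =>
      change dropHalf w (Finsupp.single _ 1) = _
      rw [dropHalf_single, hl]
      simp [LocalState.isHalf]
    | occupied =>
      change dropHalf w (Finsupp.single _ 1) = _
      rw [dropHalf_single, if_neg]
      · simp [LocalState.isHalf]
      · by_cases hwr : w = r
        · subst hwr; simp [Gen.setState, LocalState.isHalf]
        · simp [Gen.setState, hwr, hl, LocalState.isHalf]
    | half e b =>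
      have hv := vert_mem_of_bot hs
      obtain ⟨hp1, -, hp2⟩ := isPath_path hT hr hv
      have h1 : g.sign ⊥ = 1 := by simp [Gen.sign]
      change dropHalf w ((T.liftGen g).putHalf e b + (T.liftGen g).putPath _) = _
      rw [map_add, dropHalf_putHalf_of_empty (liftGen_st_of_mem hv) hl,
        dropHalf_putPath_of_empty hp1
          (fun d hd b => liftGen_st_of_mem (T.vert_mem _ (hp2 d hd) b)) hl]
      rw [if_pos (show (LocalState.half e b).isHalf = true from rfl), h1, one_smul,
        swiatContract_single, Gen.clear_st_self,
        liftGen_clear_bot]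
      change _ = if r = w then Finsupp.single (T.liftGen g) 1 else 0
      abel

theorem dropHalf_swiatContract (v : {v : V // v ∉ T.verts}) (c : T.contract.Swiat) :
    dropHalf v.1 (T.swiatContract r c) =
      T.swiatContract r (dropHalf (v : WithBot {v : V // v ∉ T.verts}) c) := by
  induction c using Finsupp.induction_linear with
  | zero => simp
  | add c c' h h' => simp only [map_add, h, h']
  | single g a =>
    rw [← mul_one a, ← smul_eq_mul, ← Finsupp.smul_single]
    simp only [map_smul]
    congr 1
    rw [swiatContract_single, dropHalf_single]
    have hst := liftGen_st (g := g) v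
    have hhalf : ((T.liftGen g).st v.1).isHalf = (g.st v).isHalf := by
      rw [hst, LocalState.isHalf_val]
    have hlr := liftGen_st_of_mem (g := g) hr
    have hsign := sign_lift (g := g) v
    have hne : ∀ w ∈ T.verts, v.1 ≠ w := fun w hw h => v.2 (h ▸ hw)
    have hrhs : T.swiatContract r (if (g.st v).isHalf then
        g.sign v • Finsupp.single (g.clear v) 1 else 0) = if (g.st v).isHalf then
        g.sign v • T.putLocal r (g.st ⊥) ((T.liftGen g).clear v.1) else 0 := by
      split_ifs
      · rw [map_smul, swiatContract_single, Gen.clear_st_of_ne WithBot.bot_ne_coe, liftGen_clear]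
      · rw [map_zero]
    rw [hrhs, hsign]
    cases hs : g.st ⊥ with
    | empty =>
      have hb : ⊥ ∉ g.active := by rw [Gen.mem_active_iff, hs]; simp [LocalState.isHalf]
      change dropHalf v.1 (Finsupp.single _ 1) = _
      rw [dropHalf_single, hhalf, if_neg hb, one_mul]
      rfl
    | occupied =>
      have hb : ⊥ ∉ g.active := by rw [Gen.mem_active_iff, hs]; simp [LocalState.isHalf]
      change dropHalf v.1 (Finsupp.single _ 1) = _
      have h1 : ((T.liftGen g).setState r .occupied (by simp)).st v.1 = (T.liftGen g).st v.1 := by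
        simp [Gen.setState, hne r hr]
      have h2 : ((T.liftGen g).setState r .occupied (by simp)).sign v.1 =
          (T.liftGen g).sign v.1 := by
        unfold Gen.sign
        rw [Gen.active_setState_occupied hlr]
      rw [dropHalf_single, h1, hhalf, if_neg hb, one_mul, h2, Gen.clear,
        Gen.setState_comm (hne r hr).symm]
      rfl
    | half e b =>
      have hb : ⊥ ∈ g.active := Gen.mem_active.2 ⟨e, b, hs⟩
      have hv := vert_mem_of_bot hs
      obtain ⟨hp1, -, hp2⟩ := isPath_path hT hr hv
      change dropHalf v.1 ((T.liftGen g).putHalf e b + (T.liftGen g).putPath _) =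
        if _ then _ • (((T.liftGen g).clear v.1).putHalf e b +
          ((T.liftGen g).clear v.1).putPath _) else _
      rw [map_add, dropHalf_putHalf_of_ne (liftGen_st_of_mem hv) (hne _ hv),
        dropHalf_putPath_of_ne fun d hd b => ⟨liftGen_st_of_mem (T.vert_mem _ (hp2 d hd) b),
          hne _ (T.vert_mem _ (hp2 d hd) b)⟩, hhalf, if_pos hb]
      split_ifs
      · module
      · simp

/-- The chain inserted along a path in the tree depends on the end points of the path only. -/
theorem putPath_eq {l : List (E × Bool)} {u x : V} (hl : Γ.IsWalk u l x)
    (h : ∀ d ∈ l, d.1 ∈ T.edges) (g : Γ.Gen) :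
    g.putPath l = g.putPath (T.path r x) - g.putPath (T.path r u) := by
  induction l generalizing u with
  | nil => rw [show u = x from hl]; simp [Gen.putPath]
  | cons d l ih =>
    have hd := h d List.mem_cons_self
    have hcons : g.putPath (d :: l) =
        (g.putHalf d.1 d.2 - g.putHalf d.1 (!d.2)) + g.putPath l := by simp [Gen.putPath]
    have happ : ∀ (l : List (E × Bool)) (e : E) (b : Bool), g.putPath (l ++ [(e, b)]) =
        g.putPath l + (g.putHalf e b - g.putHalf e (!b)) := fun l e b => by simp [Gen.putPath]
    rw [hcons, ih hl.2 fun d' hd' => h d' (List.mem_cons_of_mem _ hd'), ← hl.1]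
    obtain ⟨b, hb⟩ := exists_parent hT hr hd
    have h1 := congrArg g.putPath hb
    rw [happ] at h1
    rcases Bool.eq_or_eq_not b d.2 with rfl | rfl
    · rw [h1]; abel
    · rw [Bool.not_not] at h1
      rw [h1]; abel

/-- Changing the root from `r'` to `r` changes every half-edge at `⊥` by the same chain, that of the
path between the roots. -/
theorem swiatContract_sub {r' : V} (hr' : r' ∈ T.verts) (c : T.contract.Swiat)
    (hc : c ∈ T.contract.noOccupied) : T.swiatContract r c - T.swiatContract r' c =
      -Finsupp.linearCombination ℤ (fun g => (T.liftGen g).putPath (T.path r' r))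
        (dropHalf ⊥ c) := by
  let F : T.contract.Swiat →ₗ[ℤ] Γ.Swiat :=
    Finsupp.linearCombination ℤ fun g => (T.liftGen g).putPath (T.path r' r)
  refine LinearMap.mem_eqLocus.1 (noOccupied_le (N := LinearMap.eqLocus
    (T.swiatContract r - T.swiatContract r') (-(F ∘ₗ dropHalf ⊥))) (fun g hg => ?_) hc)
  rw [LinearMap.mem_eqLocus, LinearMap.sub_apply, LinearMap.neg_apply, LinearMap.comp_apply,
    swiatContract_single, swiatContract_single, dropHalf_single]
  cases hs : g.st ⊥ with
  | empty => simp [putLocal, LocalState.isHalf]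
  | occupied => exact absurd hs (hg _)
  | half e b =>
    have h1 : g.sign ⊥ = 1 := by simp [Gen.sign]
    rw [if_pos (by rfl), h1, one_smul]
    have h2 : F (Finsupp.single (g.clear ⊥) 1) = (T.liftGen g).putPath (T.path r' r) := by
      simp [F, liftGen_clear_bot]
    obtain ⟨hp1, -, hp2⟩ := isPath_path hT hr (vert_mem_of_bot hs)
    rw [h2]
    change (_ + (T.liftGen g).putPath (T.path r (Γ.vert e.1 b))) -
      (_ + (T.liftGen g).putPath (T.path r' (Γ.vert e.1 b))) = _
    rw [putPath_eq hT hr' hp1 hp2]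
    abel

theorem swiatContract_reduced [Fintype E] {r' : V} (hr' : r' ∈ T.verts) (c : T.contract.Swiat)
    (hc : c ∈ T.contract.reducedSwiat) :
    T.swiatContract r c ∈ Γ.reducedSwiat ∧ T.swiatContract r c = T.swiatContract r' c := by
  obtain ⟨h1, h2⟩ := (mem_reducedSwiat_iff c).1 hc
  constructor
  · refine (mem_reducedSwiat_iff _).2 ⟨swiatContract_mem_noOccupied r c h1, fun w => ?_⟩
    by_cases hw : w ∈ T.verts
    · rw [dropHalf_swiatContract_of_mem hT hr hw, h2, map_zero, ite_self]
    · rw [dropHalf_swiatContract hT hr ⟨w, hw⟩, h2, map_zero]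
  · rw [← sub_eq_zero, swiatContract_sub hT hr hr' c h1, h2, map_zero, neg_zero]

end Subgraph
end Multigraph

/-! ### Singular chains of cubes and continuous maps -/

section singMap

variable {X Y : Type} [TopologicalSpace X] [TopologicalSpace Y]

theorem singMap_simplexChain (f : C(X, Y)) {k : ℕ} (s : C(stdSimplex ℝ (Fin (k + 1)), X)) :
    ((singMap f).f k).hom (simplexChain (X := TopCat.of X) s) =
      simplexChain (X := TopCat.of Y) (f.comp s) := by
  have h := SSet.ι_chainComplexMap_f (f := TopCat.toSSet.map (TopCat.ofHom f)) (R := ModuleCat.of ℤ ℤ)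
    (x := ((TopCat.of X).toSSetObjEquiv (.op (SimplexCategory.mk k))).symm s)
  have h2 := congrArg (fun f => f.hom (1 : ℤ)) h
  exact h2

theorem singMap_cubeChain (f : C(X, Y)) {k : ℕ} (c : C(Fin k → unitInterval, X)) :
    ((singMap f).f k).hom (cubeChain (X := TopCat.of X) c) =
      cubeChain (X := TopCat.of Y) (f.comp c) := by
  unfold cubeChain
  rw [map_sum]
  refine Finset.sum_congr rfl fun σ _ => ?_
  rw [map_zsmul]
  exact congrArg _ (singMap_simplexChain f (c.comp (cubeSimplex σ)))

theorem singMap_comp {Z : Type} [TopologicalSpace Z] (f : C(X, Y)) (g : C(Y, Z)) :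
    singMap (g.comp f) = singMap f ≫ singMap g :=
  ((AlgebraicTopology.singularChainComplexFunctor (ModuleCat.{0} ℤ)).obj
    (ModuleCat.of ℤ ℤ)).map_comp (TopCat.ofHom f) (TopCat.ofHom g)

/-- Homotopic maps agree on homology. -/
theorem homologyMap_singMap_eq {f g : C(X, Y)} (h : f.Homotopic g) (k : ℕ) :
    HomologicalComplex.homologyMap (singMap f) k = HomologicalComplex.homologyMap (singMap g) k := by
  obtain ⟨H⟩ := h
  have H' : TopCat.Homotopy (TopCat.ofHom f) (TopCat.ofHom g) := H
  exact TopCat.Homotopy.congr_homologyMap_singularChainComplexFunctor H' (ModuleCat.of ℤ ℤ) k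

/-- A permutation of the coordinates changes the chain of a cube by its sign. -/
theorem cubeChain_perm {X : TopCat.{0}} {k : ℕ} (c d : C(Fin k → unitInterval, X))
    (π : Equiv.Perm (Fin k)) (h : ∀ t, d t = c (fun i => t (π i))) :
    cubeChain d = (Equiv.Perm.sign π : ℤ) • cubeChain c := by
  unfold cubeChain
  refine Eq.trans ?_ (map_sum (zsmulAddGroupHom (α := (singChains X).X k)
    (Equiv.Perm.sign π : ℤ)) _ _).symm
  rw [← (Equiv.mulLeft π).bijective.sum_comp]
  refine Finset.sum_congr rfl fun σ _ => ?_
  rw [Equiv.coe_mulLeft, Equiv.Perm.sign_mul, Units.val_mul, mul_zsmul]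
  refine congrArg (zsmulAddGroupHom (α := (singChains X).X k) (Equiv.Perm.sign π : ℤ)) ?_
  refine congrArg (fun y => (Equiv.Perm.sign σ : ℤ) • simplexChain (X := X) y) ?_
  ext x
  refine (h _).trans (congrArg c (funext fun i => Subtype.ext ?_))
  change ∑ l with ((π * σ).symm (π i)).castSucc < l, x l = ∑ l with (σ.symm i).castSucc < l, x l
  have : (π * σ).symm (π i) = σ.symm i := by
    rw [Equiv.symm_apply_eq]; simp
  rw [this]

/-- Moving the first coordinate of a cube to the position `p`. -/
theorem cubeChain_insertNth {X : TopCat.{0}} {k : ℕ} (c d : C(Fin (k + 1) → unitInterval, X))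
    (p : Fin (k + 1)) (h : ∀ t, d t = c (p.insertNth (t 0) fun j => t j.succ)) :
    cubeChain d = (-1 : ℤ) ^ (p : ℕ) • cubeChain c := by
  have h1 := cubeChain_perm c d p.cycleRange fun t => by
    rw [h]
    congr 1
    funext i
    refine Fin.succAboveCases p ?_ (fun j => ?_) i
    · simp [Fin.cycleRange_self]
    · simp [Fin.cycleRange_succAbove]
  rw [h1, Fin.sign_cycleRange]
  simp

end singMap

/-- Two chain maps that are related by a chain homotopy agree on homology. -/
theorem homologyMap_eq_of_homotopy {C D : ChainComplex (ModuleCat.{0} ℤ) ℕ} (φ ψ : C ⟶ D)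
    (h : ∀ k, C.X k ⟶ D.X (k + 1)) (h0 : φ.f 0 = h 0 ≫ D.d 1 0 + ψ.f 0)
    (hs : ∀ k, φ.f (k + 1) = C.d (k + 1) k ≫ h k + h (k + 1) ≫ D.d (k + 2) (k + 1) + ψ.f (k + 1))
    (k : ℕ) : HomologicalComplex.homologyMap φ k = HomologicalComplex.homologyMap ψ k := by
  let hh : ∀ i j, (ComplexShape.down ℕ).Rel j i → (C.X i ⟶ D.X j) := fun i j hij =>
    h i ≫ eqToHom (congrArg D.X hij)
  have key : φ - ψ = Homotopy.nullHomotopicMap' hh := by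
    ext k : 1
    rw [HomologicalComplex.sub_f_apply, sub_eq_iff_eq_add]
    cases k with
    | zero =>
      rw [Homotopy.nullHomotopicMap'_f_of_not_rel_left (k₁ := 1) (k₀ := 0) rfl (by simp), h0]
      simp [hh]
    | succ k =>
      rw [Homotopy.nullHomotopicMap'_f (k₂ := k + 2) (k₁ := k + 1) (k₀ := k) rfl rfl, hs]
      simp [hh]
  exact Homotopy.homologyMap_eq ((Homotopy.equivSubZero.symm
    ((Homotopy.ofEq key).trans (Homotopy.nullHomotopy' hh)))) k

namespace Multigraph

variable {V E : Type} (Γ : Multigraph V E) [Fintype V] [LinearOrder V] [DecidableEq E] [Fintype E]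

theorem Gen.bdry_eq_sum {Γ : Multigraph V E} {k : ℕ} {g : Γ.Gen} (hk : g.degree = k) {M : Type*} [AddCommGroup M]
    (F : V → M) : ∑ v ∈ g.active, g.sign v • F v =
      ∑ i : Fin k, (-1 : ℤ) ^ (i : ℕ) • F (g.active.orderEmbOfFin hk i) := by
  have h2 : g.active = Finset.univ.map (g.active.orderEmbOfFin hk).toEmbedding := by
    ext v
    simp only [Finset.mem_map, Finset.mem_univ, true_and, RelEmbedding.coe_toEmbedding]
    exact ⟨fun hv => Gen.exists_eq_orderEmb hk hv,
      fun ⟨i, hi⟩ => hi ▸ g.active.orderEmbOfFin_mem hk i⟩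
  conv_lhs => rw [h2, Finset.sum_map]
  refine Finset.sum_congr rfl fun i _ => ?_
  rw [RelEmbedding.coe_toEmbedding, Gen.sign_orderEmb]

theorem Gen.degree_release {Γ : Multigraph V E} {k : ℕ} {g : Γ.Gen} {v : V} (hk : g.degree = k + 1)
    (hv : v ∈ g.active) : (g.release v).degree = k := by
  have := degree_of_erase hv (release_active hv)
  omega

theorem Gen.degree_settle {Γ : Multigraph V E} {k : ℕ} {g : Γ.Gen} {v : V} (hk : g.degree = k + 1)
    (hv : v ∈ g.active) : (g.settle v).degree = k := by
  have := degree_of_erase hv (settle_active hv)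
  omega

/-- A singular cube in `X` for every generator of weight `n` of the Świątkowski complex,
whose faces are the cubes of the terms of the differential of the generator. -/
structure CubeSystem (n : ℕ) (X : Type) [TopologicalSpace X] where
  /-- The cube of a generator. -/
  cube : ∀ {k : ℕ} (g : Γ.Gen), g.weight = n → g.degree = k → C(Fin k → unitInterval, X)
  face_release : ∀ {k : ℕ} {g : Γ.Gen} (hn : g.weight = n) (hk : g.degree = k + 1) (i : Fin (k + 1))
    (hn' : (g.release (g.active.orderEmbOfFin hk i)).weight = n)
    (hk' : (g.release (g.active.orderEmbOfFin hk i)).degree = k),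
    (cube g hn hk).comp (cubeFace i 1) = cube _ hn' hk'
  face_settle : ∀ {k : ℕ} {g : Γ.Gen} (hn : g.weight = n) (hk : g.degree = k + 1) (i : Fin (k + 1))
    (hn' : (g.settle (g.active.orderEmbOfFin hk i)).weight = n)
    (hk' : (g.settle (g.active.orderEmbOfFin hk i)).degree = k),
    (cube g hn hk).comp (cubeFace i 0) = cube _ hn' hk'

namespace CubeSystem

variable {Γ} {n : ℕ} {X : Type} [TopologicalSpace X] (K : Γ.CubeSystem n X)

/-- The chain of the cube of a generator, which is zero if weight or degree are not right. -/
def genChain (k : ℕ) (g : Γ.Gen) : (singChains (TopCat.of X)).X k :=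
  if h : g.weight = n ∧ g.degree = k then cubeChain (K.cube g h.1 h.2) else 0

/-- The linear extension of `genChain`. -/
def toSing (k : ℕ) : Γ.Swiat →ₗ[ℤ] (singChains (TopCat.of X)).X k :=
  Finsupp.linearCombination ℤ (K.genChain k)

theorem toSing_single (k : ℕ) (g : Γ.Gen) : K.toSing k (Finsupp.single g 1) = K.genChain k g :=
  (Finsupp.linearCombination_single ℤ 1 g).trans (@one_smul ℤ _ _ (_) _)

theorem genChain_of {k : ℕ} {g : Γ.Gen} (hn : g.weight = n) (hk : g.degree = k) :
    K.genChain k g = cubeChain (X := TopCat.of X) (K.cube g hn hk) :=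
  dif_pos ⟨hn, hk⟩

theorem toSing_comm {k : ℕ} (c : Γ.Swiat) (hc : c ∈ Γ.swiatPart n (k + 1)) :
    ((singChains (TopCat.of X)).d (k + 1) k).hom (K.toSing (k + 1) c) =
      K.toSing k (Γ.swiatD c) := by
  refine LinearMap.mem_eqLocus.1 (swiatPart_le (N := LinearMap.eqLocus
    (((singChains (TopCat.of X)).d (k + 1) k).hom ∘ₗ K.toSing (k + 1))
    (K.toSing k ∘ₗ Γ.swiatD)) (fun g hg hk => ?_) hc)
  rw [LinearMap.mem_eqLocus, LinearMap.comp_apply, LinearMap.comp_apply, toSing_single,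
    swiatD_single, K.genChain_of hg hk, Gen.bdry, Gen.bdry_eq_sum hk, map_sum]
  refine (cubeChain_d _).trans (Finset.sum_congr rfl fun i _ => ?_)
  have hm := g.active.orderEmbOfFin_mem hk i
  have w1 := (Gen.release_weight hm).trans hg
  have w2 := (Gen.settle_weight hm).trans hg
  have d1 := Gen.degree_release hk hm
  have d2 := Gen.degree_settle hk hm
  rw [map_zsmul, map_sub, toSing_single, toSing_single, K.genChain_of w1 d1, K.genChain_of w2 d2,
    ← K.face_release hg hk i w1 d1, ← K.face_settle hg hk i w2 d2]

/-- The chain map given by a system of cubes. -/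
def chainMap : Γ.swiatComplex n ⟶ singChains (TopCat.of X) where
  f k := ModuleCat.ofHom (K.toSing k ∘ₗ (Γ.swiatPart n k).subtype)
  comm' := by
    rintro _ k rfl
    refine ModuleCat.hom_ext (LinearMap.ext fun c => ?_)
    rw [swiatComplex_d]
    exact K.toSing_comm c.1 c.2

end CubeSystem

variable {Γ}

/-- Linear maps that agree on generators agree on the part of given weight and degree. -/
theorem swiatPart_hom_ext {n k : ℕ} {M : ModuleCat.{0} ℤ} {φ ψ : (Γ.swiatComplex n).X k ⟶ M}
    (h : ∀ (g : Γ.Gen) (hn : g.weight = n) (hk : g.degree = k),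
      φ.hom (⟨Finsupp.single g 1, single_mem_swiatPart hn hk⟩ : Γ.swiatPart n k) =
        ψ.hom (⟨Finsupp.single g 1, single_mem_swiatPart hn hk⟩ : Γ.swiatPart n k)) : φ = ψ := by
  refine ModuleCat.hom_ext (LinearMap.ext fun c => ?_)
  let φ' : Γ.swiatPart n k →ₗ[ℤ] M := φ.hom
  let ψ' : Γ.swiatPart n k →ₗ[ℤ] M := ψ.hom
  have key : Γ.swiatPart n k ≤ (LinearMap.eqLocus φ' ψ').map (Γ.swiatPart n k).subtype :=
    swiatPart_le fun g hn hk => ⟨⟨Finsupp.single g 1, single_mem_swiatPart hn hk⟩, h g hn hk, rfl⟩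
  have c' : Γ.swiatPart n k := c
  obtain ⟨x, hx, hxc⟩ := key (show Γ.swiatPart n k from c).2
  have : x = (show Γ.swiatPart n k from c) := Subtype.ext hxc
  subst this
  exact hx

theorem swiatToSing_f_single {n k : ℕ} (g : Γ.Gen) (hn : g.weight = n) (hk : g.degree = k) :
    ((Γ.swiatToSing n).f k).hom (⟨Finsupp.single g 1, single_mem_swiatPart hn hk⟩ : Γ.swiatPart n k) =
      cubeChain (X := TopCat.of (UConf n Γ.Space)) (g.cube hn hk) :=
  (Γ.toSing_single n k g).trans (genChain_of hn hk)

theorem CubeSystem.chainMap_f_single {n k : ℕ} {X : Type} [TopologicalSpace X] (K : Γ.CubeSystem n X)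
    (g : Γ.Gen) (hn : g.weight = n) (hk : g.degree = k) :
    (K.chainMap.f k).hom (⟨Finsupp.single g 1, single_mem_swiatPart hn hk⟩ : Γ.swiatPart n k) =
      cubeChain (X := TopCat.of X) (K.cube g hn hk) :=
  (K.toSing_single k g).trans (K.genChain_of hn hk)

end Multigraph

/-! ### The first point of a configuration on a half-edge -/

namespace Multigraph

variable {V E : Type} {Γ : Multigraph V E}

theorem edgePt_eq_vertexPt {e : E} {t : unitInterval} {v : V} :
    Γ.edgePt e t = Γ.vertexPt v ↔ ∃ b, fromEnd b t = 0 ∧ Γ.vert e b = v := by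
  constructor
  · intro h
    have h' := congrArg Γ.normalForm h
    rw [normalForm_edgePt, normalForm_vertexPt] at h'
    split_ifs at h' with h0 h1
    · exact ⟨false, h0, Sum.inl_injective h'⟩
    · exact ⟨true, by rw [fromEnd_true, h1, unitInterval.symm_one], Sum.inl_injective h'⟩
  · rintro ⟨b, h0, rfl⟩
    rw [← halfEdgePt_zero, halfEdgePt_eq, ← h0, fromEnd_fromEnd]

theorem edgePt_inj {e e' : E} {t t' : unitInterval} (h0 : t ≠ 0) (h1 : t ≠ 1)
    (h : Γ.edgePt e t = Γ.edgePt e' t') : e = e' ∧ t = t' := by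
  have h' := congrArg Γ.normalForm h
  rw [normalForm_edgePt, normalForm_edgePt, if_neg h0, if_neg h1] at h'
  split_ifs at h'
  exact Prod.mk.inj (Sum.inr_injective h')

namespace Gen

variable [Fintype V] [LinearOrder V] [Fintype E] [DecidableEq E] {g : Γ.Gen}

/-- The index of the point on the edge `e` that is closest to the end `b`. -/
def firstIdx (g : Γ.Gen) (e : E) (b : Bool) : ℕ := if b then g.count e - 1 else 0

/-- The distance from the end `b` of the edge `e` to the closest point on `e`. -/
def lead (g : Γ.Gen) (t : V → unitInterval) (e : E) (b : Bool) : ℝ :=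
  g.gap t e b / (g.gap t e false + g.gap t e true + ((g.count e : ℝ) - 1))

/-- The position on an edge of the `j`-th point, as an element of the unit interval. -/
def pos (g : Γ.Gen) (t : V → unitInterval) (e : E) (j : ℕ) : unitInterval :=
  Set.projIcc 0 1 zero_le_one (g.coord t e j)

theorem HalfAt.count_pos {e : E} {b : Bool} (h : g.HalfAt e b) : 0 < g.count e := by
  unfold count
  cases b <;> simp [h]

theorem firstIdx_lt {e : E} {b : Bool} (h : 0 < g.count e) : g.firstIdx e b < g.count e := by
  unfold firstIdx
  split_ifs <;> omega

theorem coe_fromEnd_pos (t : V → unitInterval) {e : E} {j : ℕ} (hj : j < g.count e) (b : Bool) :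
    (fromEnd b (g.pos t e j) : ℝ) = (g.gap t e b + (if b then (g.count e : ℝ) - 1 - j else j)) /
      (g.gap t e false + g.gap t e true + ((g.count e : ℝ) - 1)) := by
  have h1 := one_le_denom (g := g) t (e := e) (by omega)
  have h2 := projIcc_coord (g := g) t hj
  cases b
  · exact h2
  · rw [fromEnd_true, unitInterval.coe_symm_eq, pos, h2, coord, eq_div_iff (by linarith), sub_mul,
      div_mul_cancel₀ _ (by linarith)]
    simp only [if_true]
    ring

theorem coe_fromEnd_firstIdx (t : V → unitInterval) {e : E} {b : Bool} (h : 0 < g.count e) :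
    (fromEnd b (g.pos t e (g.firstIdx e b)) : ℝ) = g.lead t e b := by
  rw [coe_fromEnd_pos t (firstIdx_lt h), lead, firstIdx]
  cases b
  · simp
  · have : ((g.count e - 1 : ℕ) : ℝ) = (g.count e : ℝ) - 1 := by
      rw [Nat.cast_sub (by omega)]; simp
    simp [this]

theorem lead_nonneg (t : V → unitInterval) {e : E} {b : Bool} (h : 0 < g.count e) :
    0 ≤ g.lead t e b := by
  rw [← coe_fromEnd_firstIdx t h]; exact (fromEnd b _).2.1

theorem lead_lt_one (t : V → unitInterval) {e : E} {b : Bool} (h : g.HalfAt e b) :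
    g.lead t e b < 1 := by
  have h1 := one_le_denom (g := g) t h.count_pos
  have h0 := gap_nonneg (g := g) t e (!b)
  have hc : (1 : ℝ) ≤ g.count e := by exact_mod_cast h.count_pos
  have h2 : 0 < g.gap t e (!b) + ((g.count e : ℝ) - 1) := by
    by_cases hb : g.HalfAt e (!b)
    · have : (2 : ℝ) ≤ g.count e := by
        have : 2 ≤ g.count e := by
          unfold count
          cases b <;> simp_all
        exact_mod_cast this
      linarith
    · have : g.gap t e (!b) = 1 := if_neg hb
      linarith
  unfold lead
  rw [div_lt_one (by linarith)]
  cases b <;> simp at h2 <;> linarith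

theorem lead_of_eq_zero {t : V → unitInterval} {e : E} {b : Bool} (h : g.HalfAt e b)
    (ht : t (Γ.vert e b) = 0) : g.lead t e b = 0 := by
  rw [lead, gap, if_pos h, ht]; simp

theorem count_le_weight (e : E) : g.count e ≤ g.weight := by
  rw [← card_label, ← Fintype.card_fin (g.count e)]
  exact Fintype.card_le_of_injective (fun j => (Sum.inr ⟨e, j⟩ : g.Label)) fun i j h => by
    simpa using h

theorem denom_le (t : V → unitInterval) (e : E) :
    g.gap t e false + g.gap t e true + ((g.count e : ℝ) - 1) ≤ g.weight + 1 := by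
  have h0 := gap_le_one (g := g) t e false
  have h1 := gap_le_one (g := g) t e true
  have : (g.count e : ℝ) ≤ g.weight := by exact_mod_cast count_le_weight e
  linarith

/-- All points on an edge, except possibly one on an active half-edge at the end `b`, have a
definite distance from the end `b`. -/
theorem le_coe_fromEnd_pos (t : V → unitInterval) {e : E} {j : ℕ} (hj : j < g.count e) {b : Bool}
    (h : ¬ (g.HalfAt e b ∧ j = g.firstIdx e b)) :
    1 / ((g.weight : ℝ) + 1) ≤ fromEnd b (g.pos t e j) := by
  have h1 := one_le_denom (g := g) t (e := e) (by omega)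
  have h2 := denom_le (g := g) t e
  have h0 := gap_nonneg (g := g) t e b
  have hj' : (j : ℝ) + 1 ≤ g.count e := by exact_mod_cast hj
  rw [coe_fromEnd_pos t hj]
  have key : 1 ≤ g.gap t e b + (if b then (g.count e : ℝ) - 1 - j else j) := by
    by_cases hb : g.HalfAt e b
    · have hne : j ≠ g.firstIdx e b := fun h' => h ⟨hb, h'⟩
      unfold firstIdx at hne
      cases b
      · have : 1 ≤ j := by simp at hne; omega
        have : (1 : ℝ) ≤ j := by exact_mod_cast this
        simp only [Bool.false_eq_true, if_false]; linarith
      · have : j + 2 ≤ g.count e := by simp at hne; omega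
        have : (j : ℝ) + 2 ≤ g.count e := by exact_mod_cast this
        simp only [if_true]; linarith
    · have : g.gap t e b = 1 := if_neg hb
      rw [this]
      cases b
      · simp
      · simp only [if_true]; linarith
  exact div_le_div₀ (by linarith) key (by linarith) h2

theorem eq_firstIdx (t : V → unitInterval) {e : E} {j : ℕ} (hj : j < g.count e) {b : Bool}
    (h : (fromEnd b (g.pos t e j) : ℝ) ≤ g.lead t e b) : j = g.firstIdx e b := by
  have h1 := one_le_denom (g := g) t (e := e) (by omega)
  rw [coe_fromEnd_pos t hj, lead, div_le_div_iff_of_pos_right (by linarith)] at h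
  unfold firstIdx
  cases b
  · have : (j : ℝ) ≤ 0 := by simpa using h
    have : j ≤ 0 := by exact_mod_cast this
    simpa using this
  · have : (g.count e : ℝ) ≤ 1 + j := by simp at h; linarith
    have : g.count e ≤ 1 + j := by exact_mod_cast this
    simp; omega

theorem fromEnd_pos_eq_zero {t : V → unitInterval} {e : E} {j : ℕ} (hj : j < g.count e) {b : Bool}
    (h : fromEnd b (g.pos t e j) = 0) : g.HalfAt e b ∧ j = g.firstIdx e b := by
  by_contra h'
  have := le_coe_fromEnd_pos t hj h'
  rw [h] at this
  have h2 : 0 < 1 / ((g.weight : ℝ) + 1) := by positivity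
  exact absurd this (by simpa using h2)

theorem continuous_gap (e : E) (b : Bool) : Continuous fun t : V → unitInterval => g.gap t e b := by
  unfold gap
  split_ifs
  · exact continuous_subtype_val.comp (continuous_apply _)
  · exact continuous_const

theorem continuous_lead {e : E} (b : Bool) (h : 0 < g.count e) :
    Continuous fun t : V → unitInterval => g.lead t e b :=
  (continuous_gap e b).div (((continuous_gap e _).add (continuous_gap e _)).add continuous_const)
    fun t => by have := one_le_denom (g := g) t h; linarith

theorem continuous_pos (e : E) {j : ℕ} (hj : j < g.count e) :
    Continuous fun t : V → unitInterval => g.pos t e j :=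
  continuous_projIcc.comp (((continuous_gap e _).add continuous_const).div
    (((continuous_gap e _).add (continuous_gap e _)).add continuous_const)
    fun t => by have := one_le_denom (g := g) t (e := e) (by omega); linarith)

/-- The label of the point on an active half-edge. -/
def firstLabel {e : E} {b : Bool} (h : g.HalfAt e b) : g.Label :=
  .inr ⟨e, ⟨g.firstIdx e b, firstIdx_lt h.count_pos⟩⟩

theorem point_firstLabel {e : E} {b : Bool} (h : g.HalfAt e b) (t : V → unitInterval) :
    g.point t (firstLabel h) = Γ.halfEdgePt e b (Set.projIcc 0 1 zero_le_one (g.lead t e b)) := by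
  refine congrArg (Γ.edgePt e) ?_
  rw [← coe_fromEnd_firstIdx t h.count_pos, Set.projIcc_val]
  exact (fromEnd_fromEnd b _).symm

theorem point_eq_vertexPt {v : V} (t : V → unitInterval) {e : E} {b : Bool} (h : g.HalfAt e b)
    (hv : Γ.vert e b = v) {l : g.Label} (hl : g.point t l = Γ.vertexPt v) : l = firstLabel h := by
  subst hv
  rcases l with v | ⟨e', j⟩
  · have h1 : v.1 = Γ.vert e b := Sum.inl_injective (congrArg Γ.normalForm hl)
    have h2 := v.2
    rw [h1, h] at h2
    cases h2
  · obtain ⟨b', h0, h1⟩ := edgePt_eq_vertexPt.1 hl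
    obtain ⟨h2, h3⟩ := fromEnd_pos_eq_zero j.2 h0
    have h4 : LocalState.half e b = .half e' b' := by
      rw [← show g.st (Γ.vert e b) = .half e b from h, ← h1]; exact h2
    obtain ⟨rfl, rfl⟩ := LocalState.half.inj h4
    obtain ⟨j, hj⟩ := j
    dsimp only at h3
    subst h3
    rfl

theorem point_eq_halfEdgePt (t : V → unitInterval) {e : E} {b : Bool} (h : g.HalfAt e b)
    {x : unitInterval} (h0 : 0 < (x : ℝ)) (hx : (x : ℝ) ≤ g.lead t e b) {l : g.Label}
    (hl : g.point t l = Γ.halfEdgePt e b x) : l = firstLabel h := by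
  have h1 := lead_lt_one t h
  have hx0 : fromEnd b x ≠ 0 ∧ fromEnd b x ≠ 1 := by
    have e0 : x ≠ 0 := by rintro rfl; simp at h0
    have e1 : x ≠ 1 := by rintro rfl; simp at hx; linarith
    cases b
    · exact ⟨e0, e1⟩
    · exact ⟨by simpa [fromEnd_true] using e1, by simpa [fromEnd_true] using e0⟩
  rcases l with v | ⟨e', j⟩
  · have := congrArg Γ.normalForm hl
    rw [halfEdgePt_eq, normalForm_edgePt, if_neg hx0.1, if_neg hx0.2] at this
    cases this
  · obtain ⟨rfl, h3⟩ := edgePt_inj hx0.1 hx0.2 hl.symm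
    obtain ⟨j, hj⟩ := j
    have h4 : j = g.firstIdx e b := eq_firstIdx t hj (by
      change _ = g.pos t e j at h3
      rw [← h3, fromEnd_fromEnd]; exact hx)
    subst h4
    rfl

end Gen
end Multigraph

/-! ### Configurations in which one point slides along a hair -/

/-- The unordered configuration of the points with labels in a finite type, depending
continuously on a parameter. -/
def confOfLabels {Z X L : Type} [TopologicalSpace Z] [TopologicalSpace X] [Fintype L] {n : ℕ}
    (hL : Fintype.card L = n) (p : L → Z → X) (hp : ∀ l, Continuous (p l))
    (hi : ∀ z, Function.Injective fun l => p l z) : C(Z, UConf n X) where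
  toFun z := Quotient.mk _ (⟨fun i => p ((Fintype.equivFinOfCardEq hL).symm i) z,
    (hi z).comp (Equiv.injective _)⟩ : Conf n X)
  continuous_toFun := continuous_quot_mk.comp
    (Continuous.subtype_mk (continuous_pi fun _ => hp _) _)

theorem mk_eq_confOfLabels {Z X L : Type} [TopologicalSpace Z] [TopologicalSpace X] [Fintype L] {n : ℕ}
    (hL : Fintype.card L = n) (p : L → Z → X) (hp : ∀ l, Continuous (p l))
    (hi : ∀ z, Function.Injective fun l => p l z) (x : Conf n X) (z : Z) :
    (Quotient.mk _ x : UConf n X) = confOfLabels hL p hp hi z ↔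
      Set.range x.1 = Set.range fun l => p l z := by
  refine (Conf.mk_eq_iff _ _).trans (Eq.congr_right ?_)
  exact (Fintype.equivFinOfCardEq hL).symm.surjective.range_comp fun l => p l z

namespace Multigraph.Subgraph

variable {V E : Type} {Γ : Multigraph V E} [Fintype V] [LinearOrder V] [Fintype E] [DecidableEq E]
  {T : Γ.Subgraph}

/-- The (discontinuous) section of the collapse map that maps the vertex `⊥` to `r`. -/
def liftPt (T : Γ.Subgraph) (r : V) (x : T.contract.Space) : Γ.Space :=
  match T.contract.normalForm x with
  | .inl v => WithBot.recBotCoe (C := fun _ => Γ.Space) (Γ.vertexPt r) (fun v => Γ.vertexPt v.1) v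
  | .inr p => Γ.edgePt p.1.1 p.2

variable {r : V}

theorem liftPt_bot : T.liftPt r (T.contract.vertexPt ⊥) = Γ.vertexPt r := rfl

theorem liftPt_coe (v : {v : V // v ∉ T.verts}) :
    T.liftPt r (T.contract.vertexPt (v : WithBot _)) = Γ.vertexPt v.1 := rfl

theorem liftPt_collapseVert {v : V} (hv : v ∉ T.verts) :
    T.liftPt r (T.contract.vertexPt (T.collapseVert v)) = Γ.vertexPt v := by
  rw [collapseVert, dif_neg hv]; rfl

theorem liftPt_edgePt (e : {e : E // e ∉ T.edges}) (t : unitInterval)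
    (h : ∀ b, fromEnd b t = 0 → Γ.vert e.1 b ∉ T.verts) :
    T.liftPt r (T.contract.edgePt e t) = Γ.edgePt e.1 t := by
  by_cases h0 : ∃ b, fromEnd b t = 0
  · obtain ⟨b, hb⟩ := h0
    have h1 : ∀ {V E : Type} (Γ : Multigraph V E) (e : E), Γ.edgePt e t = Γ.vertexPt (Γ.vert e b) :=
      fun Γ e => edgePt_eq_vertexPt.2 ⟨b, hb, rfl⟩
    rw [h1, h1]
    exact liftPt_collapseVert (h b hb)
  · have e0 : t ≠ 0 := fun h' => h0 ⟨false, h'⟩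
    have e1 : t ≠ 1 := fun h' => h0 ⟨true, by rw [h', fromEnd_true, unitInterval.symm_one]⟩
    rw [liftPt, normalForm_edgePt, if_neg e0, if_neg e1]

theorem collapse_liftPt (hr : r ∈ T.verts) (x : T.contract.Space) :
    T.collapse (T.liftPt r x) = x := by
  refine space_cases (p := fun x => T.collapse (T.liftPt r x) = x) (fun v => ?_) (fun e t => ?_) x
  · induction v using WithBot.recBotCoe with
    | bot => rw [liftPt_bot, collapse_vertexPt, T.collapseVert_eq_bot.2 hr]
    | coe v => rw [liftPt_coe, collapse_vertexPt, collapseVert, dif_neg v.2]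
  · by_cases h : ∀ b, fromEnd b t = 0 → Γ.vert e.1 b ∉ T.verts
    · rw [liftPt_edgePt e t h, collapse_edgePt _ e.2]
    · push Not at h
      obtain ⟨b, hb, hv⟩ := h
      have h1 : T.contract.edgePt e t = T.contract.vertexPt ⊥ :=
        edgePt_eq_vertexPt.2 ⟨b, hb, T.contract_vert_eq_bot.2 hv⟩
      rw [h1, liftPt_bot, collapse_vertexPt, T.collapseVert_eq_bot.2 hr]

theorem liftPt_injective (hr : r ∈ T.verts) : Function.Injective (T.liftPt r) :=
  Function.LeftInverse.injective (collapse_liftPt hr)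

section slide

variable {g : T.contract.Gen} {e : {e : E // e ∉ T.edges}} {b : Bool} (hg : g.st ⊥ = .half e b)

include hg in
theorem halfAt_of_bot : g.HalfAt e b := Gen.halfAt_of_half hg

/-- Away from the point on the half-edge at `⊥`, lifting the points of a configuration does
not depend on choices. -/
theorem liftPt_point_inr (u : WithBot {v : V // v ∉ T.verts} → unitInterval)
    (p : Sigma fun e => Fin (g.count e)) (hp : .inr p ≠ Gen.firstLabel (halfAt_of_bot hg)) :
    T.liftPt r (g.point u (.inr p)) = Γ.edgePt p.1.1 (g.pos u p.1 p.2) := by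
  refine liftPt_edgePt _ _ fun b' hb' hv => hp ?_
  refine Gen.point_eq_vertexPt u (halfAt_of_bot hg) (g.vert_eq _ _ _ hg) ?_
  exact edgePt_eq_vertexPt.2 ⟨b', hb', T.contract_vert_eq_bot.2 hv⟩

variable (r) in
/-- The points of a configuration in `Γ` given by a generator with a half-edge at `⊥`: the point
on this half-edge is at the time `p.1` of its hair, all others are as in `Γ / T`. Times beyond the
position of this point are cut off, since the sliding point would run into the next one. -/
def slidePt (l : g.Label)
    (p : ℝ × (WithBot {v : V // v ∉ T.verts} → unitInterval)) : Γ.Space :=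
  if l = Gen.firstLabel (halfAt_of_bot hg) then
    T.hairPt r e.1 b (min p.1 ((T.path r (Γ.vert e.1 b)).length + g.lead p.2 e b))
  else T.liftPt r (g.point p.2 l)

variable (hT : T.IsTree) (hr : r ∈ T.verts)
include hT hr

theorem continuous_slidePt (l : g.Label) : Continuous (slidePt r hg l) := by
  unfold slidePt
  split_ifs with hl
  · exact (continuous_hairPt hT hr (vert_mem_of_bot hg)).comp (continuous_fst.min
      (continuous_const.add ((Gen.continuous_lead b (halfAt_of_bot hg).count_pos).comp
        continuous_snd)))
  · rcases l with v | p
    · exact continuous_const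
    · simp only [liftPt_point_inr hg _ p hl]
      exact (Γ.continuous_edgePt _).comp ((Gen.continuous_pos p.1 p.2.2).comp continuous_snd)

include hg in
theorem collapse_hairPt {x τ : ℝ} (hx : x < 1)
    (hτ : τ ≤ (T.path r (Γ.vert e.1 b)).length + x) :
    T.collapse (T.hairPt r e.1 b τ) = T.contract.vertexPt ⊥ ∨ ∃ y : unitInterval, 0 < (y : ℝ) ∧
      (y : ℝ) ≤ x ∧ T.collapse (T.hairPt r e.1 b τ) = T.contract.halfEdgePt e b y := by
  have hv := vert_mem_of_bot hg
  rcases le_or_gt τ (T.path r (Γ.vert e.1 b)).length with h | h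
  · left
    rw [hairPt_of_le hT hr hv h]
    rcases pathPt_path_mem hT hr hv τ with ⟨v, hv, h⟩ | ⟨e, he, t, h⟩
    · rw [h, collapse_vertexPt, T.collapseVert_eq_bot.2 hv]
    · rw [h, collapse_edgePt_of_mem _ he]
  · right
    refine ⟨⟨τ - (T.path r (Γ.vert e.1 b)).length, by linarith, by linarith⟩, by simpa using h,
      by simpa using by linarith, ?_⟩
    have h1 := hairPt_add hT hr hv
      ⟨τ - (T.path r (Γ.vert e.1 b)).length, by linarith, by linarith⟩
    simp only [add_sub_cancel] at h1
    rw [h1]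
    exact T.collapse_edgePt e.2 _

theorem slidePt_injective (p : ℝ × (WithBot {v : V // v ∉ T.verts} → unitInterval)) :
    Function.Injective fun l => slidePt r hg l p := by
  have hh := halfAt_of_bot hg
  have key : ∀ l, l ≠ Gen.firstLabel hh → T.liftPt r (g.point p.2 l) ≠
      T.hairPt r e.1 b (min p.1 ((T.path r (Γ.vert e.1 b)).length + g.lead p.2 e b)) := by
    intro l hl h
    have h' := congrArg T.collapse h
    rw [collapse_liftPt hr] at h'
    rcases collapse_hairPt hg hT hr (Gen.lead_lt_one p.2 hh) (min_le_right p.1 _) with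
      h1 | ⟨y, h0, hy, h1⟩
    · exact hl (Gen.point_eq_vertexPt p.2 hh (g.vert_eq _ _ _ hg) (h'.trans h1))
    · exact hl (Gen.point_eq_halfEdgePt p.2 hh h0 hy (h'.trans h1))
  intro l l' h
  dsimp only [slidePt] at h
  split_ifs at h with h1 h2 h2
  · rw [h1, h2]
  · exact (key _ h2 h.symm).elim
  · exact (key _ h1 h).elim
  · exact Gen.point_injective p.2 (liftPt_injective hr h)

/-- The configurations in `Γ` given by a generator with a half-edge at `⊥` and a time of the
corresponding hair, the path from the root to the half-edge and then along it. -/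
def slideConf {n : ℕ} (hn : g.weight = n) :
    C(ℝ × (WithBot {v : V // v ∉ T.verts} → unitInterval), UConf n Γ.Space) :=
  confOfLabels (Gen.card_label.trans hn) (slidePt r hg) (continuous_slidePt hg hT hr)
    (slidePt_injective hg hT hr)

omit hT hr in
theorem range_slidePt (p : ℝ × (WithBot {v : V // v ∉ T.verts} → unitInterval)) :
    Set.range (fun l => slidePt r hg l p) =
      insert (T.hairPt r e.1 b (min p.1 ((T.path r (Γ.vert e.1 b)).length + g.lead p.2 e b)))
        (T.liftPt r '' (Set.range (g.point p.2) \
          {T.contract.halfEdgePt e b (Set.projIcc 0 1 zero_le_one (g.lead p.2 e b))})) := by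
  have hh := halfAt_of_bot hg
  ext x
  simp only [Set.mem_range, Set.mem_insert_iff, Set.mem_image, Set.mem_sdiff, Set.mem_singleton_iff,
    ← Gen.point_firstLabel hh, slidePt]
  constructor
  · rintro ⟨l, rfl⟩
    split_ifs with hl
    · exact .inl rfl
    · exact .inr ⟨_, ⟨⟨l, rfl⟩, fun h => hl (Gen.point_injective _ h)⟩, rfl⟩
  · rintro (rfl | ⟨_, ⟨⟨l, rfl⟩, hl⟩, rfl⟩)
    · exact ⟨_, if_pos rfl⟩
    · exact ⟨l, if_neg fun h => hl (by rw [h])⟩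

theorem mk_eq_slideConf {n : ℕ} (hn : g.weight = n) (x : Conf n Γ.Space)
    (p : ℝ × (WithBot {v : V // v ∉ T.verts} → unitInterval)) :
    (Quotient.mk _ x : UConf n Γ.Space) = slideConf hg hT hr hn p ↔ Set.range x.1 =
      insert (T.hairPt r e.1 b (min p.1 ((T.path r (Γ.vert e.1 b)).length + g.lead p.2 e b)))
        (T.liftPt r '' (Set.range (g.point p.2) \
          {T.contract.halfEdgePt e b (Set.projIcc 0 1 zero_le_one (g.lead p.2 e b))})) := by
  rw [← range_slidePt hg]
  exact mk_eq_confOfLabels _ _ _ _ _ _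

theorem slideConf_eq_slideConf {g' : T.contract.Gen} (hg' : g'.st ⊥ = .half e b) {n : ℕ}
    (hn : g.weight = n) (hn' : g'.weight = n) (τ : ℝ)
    {u u' : WithBot {v : V // v ∉ T.verts} → unitInterval} (h : g.lead u e b = g'.lead u' e b)
    (h' : Set.range (g.point u) = Set.range (g'.point u')) :
    slideConf hg hT hr hn (τ, u) = slideConf hg' hT hr hn' (τ, u') := by
  refine (mk_eq_slideConf hg' hT hr hn' _ _).2 ?_
  rw [← h', ← h]
  exact (mk_eq_slideConf hg hT hr hn _ _).1 rfl

end slide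

end Multigraph.Subgraph

/-! ### The cubes of the contracted graph near the contracted vertex -/

theorem UConfLE.incl_injective {n k : ℕ} {X : Type} [TopologicalSpace X] (U : Set X) :
    Function.Injective (UConfLE.incl n k U) := by
  rintro ⟨x⟩ ⟨y⟩ h
  exact Quotient.sound (Quotient.exact (s := Conf.setoid n X)
    (a := ConfLE.incl n k U x) (b := ConfLE.incl n k U y) h)

namespace Multigraph.Subgraph

variable {V E : Type} {Γ : Multigraph V E} [Fintype V] [LinearOrder V] [Fintype E] [DecidableEq E]
  {T : Γ.Subgraph} {δ : ℝ} (hδ : 0 < δ) (hδ' : δ ≤ 1 / 2)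

include hδ hδ' in
theorem vertexPt_mem_nhdContract {v : WithBot {v : V // v ∉ T.verts}}
    (h : T.contract.vertexPt v ∈ T.nhdContract δ) : v = ⊥ := by
  induction v using WithBot.recBotCoe with
  | bot => rfl
  | coe v =>
    have h1 : T.collapse (Γ.vertexPt v.1) = T.contract.vertexPt (v : WithBot _) := by
      rw [collapse_vertexPt, collapseVert, dif_neg v.2]
    rw [← h1, collapse_mem_nhdContract hδ (by linarith), vertexPt_mem_nhd T hδ (by linarith)] at h
    exact (v.2 h).elim

include hδ hδ' in
theorem edgePt_mem_nhdContract {e : {e : E // e ∉ T.edges}} {t : unitInterval}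
    (h : T.contract.edgePt e t ∈ T.nhdContract δ) :
    ∃ b, T.contract.vert e b = ⊥ ∧ (fromEnd b t : ℝ) < δ := by
  rw [← T.collapse_edgePt e.2, collapse_mem_nhdContract hδ (by linarith),
    edgePt_mem_nhd T hδ (by linarith)] at h
  obtain ⟨b, hb, h⟩ := h.resolve_left e.2
  exact ⟨b, T.contract_vert_eq_bot.2 hb, h⟩

variable {g : T.contract.Gen} {n : ℕ} (hδn : δ < 1 / ((n : ℝ) + 1))

include hδ hδ' hδn in
/-- In a configuration of a cube, only a point on `⊥` or on a half-edge at `⊥` can be near `⊥`. -/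
theorem point_mem_nhdContract (hn : g.weight = n) {u : WithBot {v : V // v ∉ T.verts} → unitInterval}
    {l : g.Label} (h : g.point u l ∈ T.nhdContract δ) :
    (∃ h0 : g.st ⊥ = .occupied, l = .inl ⟨⊥, h0⟩) ∨
      ∃ e b, ∃ h0 : g.st ⊥ = .half e b, l = Gen.firstLabel (halfAt_of_bot h0) ∧
        g.lead u e b < δ := by
  rcases l with ⟨v, hv⟩ | ⟨e, j, hj⟩
  · obtain rfl := vertexPt_mem_nhdContract hδ hδ' h
    exact .inl ⟨hv, rfl⟩
  · right
    obtain ⟨b, hb, h1⟩ := edgePt_mem_nhdContract hδ hδ' h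
    have h2 : g.HalfAt e b ∧ j = g.firstIdx e b := by
      by_contra h'
      have := Gen.le_coe_fromEnd_pos u hj h'
      rw [hn] at this
      exact absurd h1 (by change ¬ (fromEnd b (g.pos u e j) : ℝ) < δ; linarith)
    obtain ⟨h2, rfl⟩ := h2
    refine ⟨e, b, hb ▸ h2, rfl, ?_⟩
    rw [← Gen.coe_fromEnd_firstIdx u h2.count_pos]
    exact h1

include hδ hδ' hδn in
theorem ncard_near_le (hn : g.weight = n)
    (u : WithBot {v : V // v ∉ T.verts} → unitInterval) {ι : Type*} [Finite ι] {p : ι → g.Label}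
    (hp : Function.Injective p) : {i | g.point u (p i) ∈ T.nhdContract δ}.ncard ≤ 1 := by
  refine (Set.ncard_le_one_iff (Set.toFinite _)).2 fun {i j} hi hj => hp ?_
  rcases point_mem_nhdContract hδ hδ' hδn hn hi with ⟨h0, h1⟩ | ⟨e, b, h0, h1, -⟩ <;>
  rcases point_mem_nhdContract hδ hδ' hδn hn hj with ⟨h0', h1'⟩ | ⟨e', b', h0', h1', -⟩
  · rw [h1, h1']
  · rw [h0] at h0'; cases h0'
  · rw [h0] at h0'; cases h0'
  · rw [h0] at h0'
    obtain ⟨rfl, rfl⟩ := LocalState.half.inj h0'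
    rw [h1, h1']

/-- The cubes in the configuration space of `Γ / T` consist of configurations with at most one
point in a sufficiently small neighbourhood of the vertex `⊥`. -/
def nearCube {k : ℕ} (g : T.contract.Gen) (hn : g.weight = n) (hk : g.degree = k) :
    C(Fin k → unitInterval, UConfLE n 1 T.contract.Space (T.nhdContract δ)) where
  toFun t := Quotient.mk _ (⟨(g.ordCube hn hk t).1, (g.ordCube hn hk t).2,
    ncard_near_le hδ hδ' hδn hn _ (Equiv.injective _)⟩ :
      ConfLE n 1 T.contract.Space (T.nhdContract δ))
  continuous_toFun := continuous_quot_mk.comp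
    (Continuous.subtype_mk (continuous_subtype_val.comp (g.ordCube hn hk).continuous) _)

theorem incl_comp_nearCube {k : ℕ} (g : T.contract.Gen) (hn : g.weight = n)
    (hk : g.degree = k) : (UConfLE.incl n 1 (T.nhdContract δ)).comp
      (nearCube hδ hδ' hδn g hn hk) = g.cube hn hk := rfl

/-- The system of the cubes `nearCube`. -/
def nearCubes :
    T.contract.CubeSystem n (UConfLE n 1 T.contract.Space (T.nhdContract δ)) where
  cube := nearCube hδ hδ' hδn
  face_release hn hk i hn' hk' := by
    have hm := Finset.orderEmbOfFin_mem _ hk i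
    ext t
    refine UConfLE.incl_injective _ ?_
    exact congrArg (fun c : C(_, _) => c t) (Gen.cube_face hn hk hn' hk' i 1
      (Gen.release_active hm) fun t ht => Gen.range_release hm ht)
  face_settle hn hk i hn' hk' := by
    have hm := Finset.orderEmbOfFin_mem _ hk i
    ext t
    refine UConfLE.incl_injective _ ?_
    exact congrArg (fun c : C(_, _) => c t) (Gen.cube_face hn hk hn' hk' i 0
      (Gen.settle_active hm) fun t ht => Gen.range_settle hm ht)

theorem nearCubes_chainMap :
    (nearCubes hδ hδ' hδn).chainMap ≫ singMap (UConfLE.incl n 1 (T.nhdContract δ)) =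
      T.contract.swiatToSing n := by
  ext k : 1
  refine swiatPart_hom_ext fun g hn hk => ?_
  rw [swiatToSing_f_single g hn hk, ← incl_comp_nearCube hδ hδ' hδn, ← singMap_cubeChain]
  exact congrArg ((singMap (UConfLE.incl n 1 (T.nhdContract δ))).f k).hom
    ((nearCubes hδ hδ' hδn).chainMap_f_single g hn hk)

variable {r : V} (hT : T.IsTree) (hr : r ∈ T.verts)

theorem expansion_of_notMem {x : T.contract.Space} (hx : x ∉ T.nhdContract δ) :
    expansion hT hr hδ hδ' x = T.liftPt r x := by
  have h1 := collapse_liftPt hr x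
  conv_lhs => rw [← h1]
  refine (isExpansion_expansion hT hr hδ hδ' le_rfl (by linarith)).fix _ fun h => hx ?_
  rw [← h1]
  exact ⟨_, h, rfl⟩

include hδn in
theorem expansion_point_of_ne (hn : g.weight = n) (u : WithBot {v : V // v ∉ T.verts} → unitInterval)
    (l : g.Label) (hl : ∀ e b, ∀ h0 : g.st ⊥ = .half e b, l ≠ Gen.firstLabel (halfAt_of_bot h0)) :
    expansion hT hr hδ hδ' (g.point u l) = T.liftPt r (g.point u l) := by
  by_cases h : g.point u l ∈ T.nhdContract δ
  · rcases point_mem_nhdContract hδ hδ' hδn hn h with ⟨h0, rfl⟩ | ⟨e, b, h0, h1, -⟩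
    · rfl
    · exact (hl e b h0 h1).elim
  · exact expansion_of_notMem hδ hδ' hT hr h

include hδn in
/-- The expansion moves the point on the half-edge at `⊥` along its hair. -/
theorem expansion_point_firstLabel (hn : g.weight = n) (u : WithBot {v : V // v ∉ T.verts} → unitInterval)
    {e : {e : E // e ∉ T.edges}} {b : Bool} (hg : g.st ⊥ = .half e b) :
    expansion hT hr hδ hδ' (g.point u (Gen.firstLabel (halfAt_of_bot hg))) =
      T.hairPt r e.1 b (hairTime δ 1 (T.path r (Γ.vert e.1 b)).length (g.lead u e b)) := by
  have hh := halfAt_of_bot hg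
  have h0 := Gen.lead_nonneg u (b := b) hh.count_pos
  have h1 := Gen.lead_lt_one u hh
  have hv := vert_mem_of_bot hg
  have hpos := Gen.coe_fromEnd_firstIdx (b := b) u hh.count_pos
  rcases lt_or_ge (g.lead u e b) δ with h | h
  · refine (edgeSlide_of_le_half hT hr hδ hδ' e.2 (b := b) (hpos.le.trans (by linarith))).trans ?_
    rw [endSlide, if_pos hv]
    rw [hpos]
    rfl
  · have hx : g.point u (Gen.firstLabel hh) ∉ T.nhdContract δ := fun hx => by
      rcases point_mem_nhdContract hδ hδ' hδn hn hx with ⟨h0, -⟩ | ⟨e', b', h0, -, h2⟩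
      · rw [hg] at h0; cases h0
      · rw [hg] at h0
        obtain ⟨rfl, rfl⟩ := LocalState.half.inj h0
        linarith
    rw [expansion_of_notMem hδ hδ' hT hr hx, hairTime_of_le hδ zero_le_one le_rfl h, ← hpos,
      hairPt_add hT hr hv, halfEdgePt_eq, fromEnd_fromEnd]
    refine liftPt_edgePt _ _ fun b' hb' hv' => ?_
    obtain ⟨h3, -⟩ := Gen.fromEnd_pos_eq_zero (Gen.firstIdx_lt hh.count_pos) hb'
    unfold Gen.HalfAt at h3
    rw [T.contract_vert_eq_bot.2 hv', hg] at h3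
    obtain ⟨-, rfl⟩ := LocalState.half.inj h3
    change fromEnd b (g.pos u e (g.firstIdx e b)) = 0 at hb'
    rw [hb'] at hpos
    simp at hpos
    linarith

include hδn in
/-- Cubes of generators without a half-edge at `⊥`, expanded to `Γ`. -/
theorem range_expansion_of_not_half (hn : g.weight = n) (hg : ∀ e b, g.st ⊥ ≠ .half e b)
    (u : WithBot {v : V // v ∉ T.verts} → unitInterval) :
    Set.range (fun l => expansion hT hr hδ hδ' (g.point u l)) = T.liftPt r '' Set.range (g.point u) := by
  rw [← Set.range_comp]
  refine congrArg Set.range (funext fun l => ?_)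
  exact expansion_point_of_ne hδ hδ' hδn hT hr hn u l fun e b h0 => (hg e b h0).elim

/-- Cubes of generators with a half-edge at `⊥`, expanded to `Γ`. -/
theorem push_nearCube_of_half {k : ℕ} (hn : g.weight = n) (hk : g.degree = k)
    {e : {e : E // e ∉ T.edges}} {b : Bool} (hg : g.st ⊥ = .half e b) (t : Fin k → unitInterval) :
    ((UConfLE.incl n 1 (T.nhd δ)).comp (UConfLE.push n ((isExpansion_expansion hT hr hδ hδ' le_rfl
      (by linarith)).pushable hT.1))) (nearCube hδ hδ' hδn g hn hk t) =
      slideConf hg hT hr hn (hairTime δ 1 (T.path r (Γ.vert e.1 b)).length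
        (g.lead (g.spread hk t) e b), g.spread hk t) := by
  have hh := halfAt_of_bot hg
  refine (mk_eq_confOfLabels (p := slidePt r hg) _ _ _ _ _).2 ?_
  refine ((Fintype.equivFinOfCardEq (Gen.card_label.trans hn)).symm.surjective.range_comp
    fun l => expansion hT hr hδ hδ' (g.point (g.spread hk t) l)).trans
      (congrArg Set.range (funext fun l => ?_))
  dsimp only [slidePt]
  split_ifs with hl
  · rw [hl, expansion_point_firstLabel hδ hδ' hδn hT hr hn _ hg, min_eq_left]
    exact hairTime_le (Nat.cast_nonneg _) (Gen.lead_nonneg _ hh.count_pos)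
  · refine expansion_point_of_ne hδ hδ' hδn hT hr hn _ l fun e' b' h0 => ?_
    have h2 := h0
    rw [hg] at h2
    obtain ⟨rfl, rfl⟩ := LocalState.half.inj h2
    exact hl

end Multigraph.Subgraph

/-! ### Points of the configurations given by the terms of the contraction -/

namespace Multigraph

variable {V E : Type} {Γ : Multigraph V E}

theorem pathPt_getElem {v w : V} {l : List (E × Bool)} (hl : Γ.IsWalk v l w) {i : ℕ}
    (hi : i < l.length) (x : unitInterval) :
    Γ.pathPt v l (i + x) = Γ.halfEdgePt l[i].1 l[i].2 x := by
  induction l generalizing v i with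
  | nil => simp at hi
  | cons d l ih =>
    cases i with
    | zero =>
      rw [pathPt, Nat.cast_zero, zero_add, if_pos x.2.2, Set.projIcc_val]
      rfl
    | succ i =>
      have h1 : Γ.IsWalk v [d] (Γ.vert d.1 !d.2) := ⟨hl.1, rfl⟩
      have h2 := pathPt_append_right h1 l hl.2 (τ := ((i + 1 : ℕ) : ℝ) + x)
        (by simp; linarith [x.2.1])
      rw [List.singleton_append] at h2
      rw [h2, List.getElem_cons_succ, ← ih hl.2 (by simpa using hi)]
      congr 1
      simp
      ring

theorem halfEdgePt_not (e : E) (b : Bool) (x : unitInterval) :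
    Γ.halfEdgePt e (!b) x = Γ.halfEdgePt e b (unitInterval.symm x) := by
  cases b <;> simp [halfEdgePt]

namespace Gen

variable [Fintype V] [LinearOrder V] [Fintype E] [DecidableEq E] {g : Γ.Gen}

theorem mem_range_point' {t : V → unitInterval} {x : Γ.Space} : x ∈ Set.range (g.point t) ↔
    (∃ v, g.st v = .occupied ∧ Γ.vertexPt v = x) ∨
      ∃ e, ∃ j < g.count e, Γ.edgePt e (g.pos t e j) = x := mem_range_point

theorem halfAt_setState {v : V} (hv : g.st v = .empty) (s : LocalState E) (hs) (e' : E) (b' : Bool) :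
    (g.setState v s hs).HalfAt e' b' ↔ g.HalfAt e' b' ∨ s = .half e' b' := by
  unfold HalfAt setState
  by_cases h : Γ.vert e' b' = v
  · rw [h, hv]; simp
  · simp only [Function.update_of_ne h]
    refine ⟨.inl, fun h' => h'.resolve_right fun h1 => h (hs _ _ h1)⟩

/-- Occupying a vertex adds a point. -/
theorem range_setState_occupied {v : V} (hv : g.st v = .empty) (t : V → unitInterval) :
    Set.range ((g.setState v .occupied (by simp)).point t) =
      insert (Γ.vertexPt v) (Set.range (g.point t)) := by
  have hh := halfAt_setState hv .occupied (by simp)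
  simp only [reduceCtorEq, or_false] at hh
  have hc : ∀ e, (g.setState v .occupied (by simp)).count e = g.count e := fun e => by
    simp only [count, hh]; rfl
  have hp : ∀ e j, (g.setState v .occupied (by simp)).pos t e j = g.pos t e j := fun e j => by
    simp only [pos, coord, gap, hh, hc]
  ext x
  rw [mem_range_point', Set.mem_insert_iff, mem_range_point', ← or_assoc]
  simp only [hc, hp]
  refine or_congr ?_ Iff.rfl
  constructor
  · rintro ⟨w, hw, rfl⟩
    by_cases h : w = v
    · exact .inl (by rw [h])
    · exact .inr ⟨w, by simpa [setState, h] using hw, rfl⟩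
  · rintro (rfl | ⟨w, hw, rfl⟩)
    · exact ⟨v, by simp [setState], rfl⟩
    · have h : w ≠ v := by rintro rfl; rw [hv] at hw; cases hw
      exact ⟨w, by simpa [setState, h] using hw, rfl⟩

/-- Activating a half-edge of an edge without points adds a point. -/
theorem range_setState_half {e : E} {b : Bool} (hv : g.st (Γ.vert e b) = .empty)
    (he : g.count e = 0) (t : V → unitInterval) (x : unitInterval)
    (hx : (x : ℝ) = t (Γ.vert e b) / (1 + t (Γ.vert e b))) (hs) :
    Set.range ((g.setState (Γ.vert e b) (.half e b) hs).point t) =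
      insert (Γ.halfEdgePt e b x) (Set.range (g.point t)) := by
  have hh := halfAt_setState hv (.half e b) hs
  set G := g.setState (Γ.vert e b) (.half e b) hs
  have hce : ∀ b', ¬ g.HalfAt e b' := fun b' h => by
    have := h.count_pos; omega
  have hme : g.mult e = 0 := by unfold count at he; omega
  have h1 : ∀ b', G.HalfAt e b' ↔ b' = b := fun b' => by simp [hh, hce, eq_comm]
  have h2 : ∀ e', e' ≠ e → ∀ b', G.HalfAt e' b' ↔ g.HalfAt e' b' := fun e' h' b' => by
    simp [hh, h'.symm]
  have hc1 : G.count e = 1 := by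
    have : G.mult e = 0 := hme
    unfold count
    simp only [h1, this]
    cases b <;> simp
  have hc2 : ∀ e', e' ≠ e → G.count e' = g.count e' := fun e' h' => by
    simp only [count, h2 e' h']; rfl
  have hp2 : ∀ e', e' ≠ e → ∀ j, G.pos t e' j = g.pos t e' j := fun e' h' j => by
    simp only [pos, coord, gap, h2 e' h', hc2 e' h']
  have hp1 : G.pos t e 0 = fromEnd b x := by
    have h3 : G.HalfAt e b := (h1 b).2 rfl
    have h4 := coe_fromEnd_firstIdx (b := b) t h3.count_pos
    have h5 : G.firstIdx e b = 0 := by unfold firstIdx; rw [hc1]; simp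
    rw [h5] at h4
    have h6 : fromEnd b (G.pos t e 0) = x := by
      refine Subtype.ext (h4.trans ?_)
      rw [hx, lead, hc1]
      unfold gap
      simp only [h1]
      cases b <;> simp [add_comm]
    rw [← h6, fromEnd_fromEnd]
  ext y
  rw [mem_range_point', Set.mem_insert_iff, mem_range_point']
  constructor
  · rintro (⟨w, hw, rfl⟩ | ⟨e', j, hj, rfl⟩)
    · have h : w ≠ Γ.vert e b := by
        rintro rfl
        simp [G, setState] at hw
      exact .inr (.inl ⟨w, by simpa [G, setState, h] using hw, rfl⟩)
    · by_cases h' : e' = e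
      · subst h'
        obtain rfl : j = 0 := by omega
        exact .inl (by rw [hp1]; rfl)
      · exact .inr (.inr ⟨e', j, by rwa [hc2 e' h'] at hj, by rw [hp2 e' h']⟩)
  · rintro (rfl | ⟨w, hw, rfl⟩ | ⟨e', j, hj, rfl⟩)
    · exact .inr ⟨e, 0, by omega, by rw [hp1]; rfl⟩
    · have h : w ≠ Γ.vert e b := by rintro rfl; rw [hv] at hw; cases hw
      exact .inl ⟨w, by simpa [G, setState, h] using hw, rfl⟩
    · have h' : e' ≠ e := by rintro rfl; omega
      exact .inr ⟨e', j, by rwa [hc2 e' h'], by rw [hp2 e' h']⟩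

end Gen

namespace Subgraph

variable [Fintype V] [LinearOrder V] [Fintype E] [DecidableEq E] {T : Γ.Subgraph} {r : V}
  (g : T.contract.Gen) (u : WithBot {v : V // v ∉ T.verts} → unitInterval)

/-- The points in `Γ` of the configuration given by `g`, except for a point on the vertex `⊥`. -/
def outerPts : Set Γ.Space :=
  {x | (∃ v : {v : V // v ∉ T.verts}, g.st (v : WithBot _) = .occupied ∧ Γ.vertexPt v.1 = x) ∨
    ∃ e, ∃ j < g.count e, Γ.edgePt e.1 (g.pos u e j) = x}

variable {g}

theorem range_point_of_matching {H : Γ.Gen} (hst : ∀ v : {v : V // v ∉ T.verts}, H.st v.1 = (g.st (v : WithBot _)).val)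
    (hT : ∀ v ∈ T.verts, H.st v ≠ .occupied) (hm : H.mult = (T.liftGen g).mult)
    (hh : ∀ (e : {e : E // e ∉ T.edges}) b, H.HalfAt e.1 b ↔ g.HalfAt e b)
    (hh' : ∀ e ∈ T.edges, ∀ b, ¬ H.HalfAt e b) :
    Set.range (H.point fun v => u (T.collapseVert v)) = outerPts g u := by
  have hc : ∀ e : {e : E // e ∉ T.edges}, H.count e.1 = g.count e := fun e => by
    simp only [Gen.count, hh, hm, liftGen, dif_neg e.2]
  have hp : ∀ (e : {e : E // e ∉ T.edges}) j,
      H.pos (fun v => u (T.collapseVert v)) e.1 j = g.pos u e j := fun e j => by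
    simp only [Gen.pos, Gen.coord, Gen.gap, hh, hc]; rfl
  have hc' : ∀ e ∈ T.edges, H.count e = 0 := fun e he => by
    simp [Gen.count, hh' e he, hm, liftGen, he]
  ext x
  rw [Gen.mem_range_point']
  constructor
  · rintro (⟨v, hv, rfl⟩ | ⟨e, j, hj, rfl⟩)
    · by_cases hvT : v ∈ T.verts
      · exact (hT v hvT hv).elim
      · refine .inl ⟨⟨v, hvT⟩, ?_, rfl⟩
        have := hst ⟨v, hvT⟩
        rw [hv] at this
        revert this
        cases g.st ((⟨v, hvT⟩ : {v : V // v ∉ T.verts}) : WithBot _) <;> simp [LocalState.val]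
    · by_cases he : e ∈ T.edges
      · rw [hc' e he] at hj; omega
      · exact .inr ⟨⟨e, he⟩, j, by rwa [← hc ⟨e, he⟩], by rw [← hp ⟨e, he⟩]⟩
  · rintro (⟨v, hv, rfl⟩ | ⟨e, j, hj, rfl⟩)
    · exact .inl ⟨v.1, by rw [hst v, hv]; rfl, rfl⟩
    · exact .inr ⟨e.1, j, by rwa [hc e], by rw [hp e]⟩

theorem halfAt_liftGen_of_notMem {e : {e : E // e ∉ T.edges}} {b : Bool} (h : Γ.vert e.1 b ∉ T.verts) :
    (T.liftGen g).HalfAt e.1 b ↔ g.HalfAt e b := by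
  have h1 : T.contract.vert e b = ((⟨Γ.vert e.1 b, h⟩ : {v : V // v ∉ T.verts}) : WithBot _) :=
    dif_neg h
  unfold Gen.HalfAt
  rw [h1, liftGen_st ⟨Γ.vert e.1 b, h⟩]
  cases g.st ((⟨Γ.vert e.1 b, h⟩ : {v : V // v ∉ T.verts}) : WithBot _) <;>
    simp [LocalState.val, Subtype.ext_iff]

theorem halfAt_liftGen_of_mem {e : E} {b : Bool} (h : Γ.vert e b ∈ T.verts) :
    ¬ (T.liftGen g).HalfAt e b := by
  unfold Gen.HalfAt
  rw [liftGen_st_of_mem h]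
  simp

theorem range_liftGen (hg : ∀ e b, g.st ⊥ ≠ .half e b) :
    Set.range ((T.liftGen g).point fun v => u (T.collapseVert v)) = outerPts g u := by
  refine range_point_of_matching u liftGen_st (fun v hv => ?_) rfl (fun e b => ?_) fun e he b => ?_
  · rw [liftGen_st_of_mem hv]; simp
  · by_cases h : Γ.vert e.1 b ∈ T.verts
    · refine iff_of_false (halfAt_liftGen_of_mem h) fun h' => hg e b ?_
      rw [← T.contract_vert_eq_bot.2 h]; exact h'
    · exact halfAt_liftGen_of_notMem h
  · exact halfAt_liftGen_of_mem (T.vert_mem e he b)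

theorem range_liftGen_half {e : {e : E // e ∉ T.edges}} {b : Bool} (hg : g.st ⊥ = .half e b) (hs) :
    Set.range (((T.liftGen g).setState (Γ.vert e.1 b) (.half e.1 b) hs).point
      fun v => u (T.collapseVert v)) = outerPts g u := by
  have hv := vert_mem_of_bot hg
  have hh := Gen.halfAt_setState (liftGen_st_of_mem (g := g) hv) _ hs
  refine range_point_of_matching u (fun v => ?_) (fun v hv' => ?_) rfl (fun e' b' => ?_)
    fun e' he b' => ?_
  · rw [← liftGen_st]
    exact Function.update_of_ne (fun h : v.1 = _ => v.2 (h ▸ hv)) _ _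
  · by_cases h : v = Γ.vert e.1 b
    · simp [Gen.setState, h]
    · simp [Gen.setState, h, liftGen_st_of_mem hv']
  · rw [hh]
    by_cases h : Γ.vert e'.1 b' ∈ T.verts
    · rw [or_iff_right (halfAt_liftGen_of_mem h)]
      unfold Gen.HalfAt
      rw [T.contract_vert_eq_bot.2 h, hg]
      simp [Subtype.ext_iff]
    · rw [halfAt_liftGen_of_notMem h]
      refine or_iff_left fun h' => ?_
      obtain ⟨h1, rfl⟩ := LocalState.half.inj h'
      rw [h1] at hv
      exact h hv
  · rw [hh]
    rintro (h | h)
    · exact halfAt_liftGen_of_mem (T.vert_mem e' he b') h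
    · obtain ⟨rfl, rfl⟩ := LocalState.half.inj h
      exact e.2 he

theorem outerPts_of_not_half (hg : ∀ e b, g.st ⊥ ≠ .half e b) :
    outerPts g u = T.liftPt r '' (Set.range (g.point u) \ {T.contract.vertexPt ⊥}) := by
  have key : ∀ (e : {e : E // e ∉ T.edges}) (j : ℕ), j < g.count e → ∀ b, fromEnd b (g.pos u e j) = 0 →
      Γ.vert e.1 b ∉ T.verts := fun e j hj b h0 h => by
    obtain ⟨h1, -⟩ := Gen.fromEnd_pos_eq_zero hj h0
    unfold Gen.HalfAt at h1
    rw [T.contract_vert_eq_bot.2 h] at h1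
    exact hg e b h1
  ext x
  simp only [Set.mem_image, Set.mem_sdiff, Gen.mem_range_point', Set.mem_singleton_iff]
  constructor
  · rintro (⟨v, hv, rfl⟩ | ⟨e, j, hj, rfl⟩)
    · refine ⟨_, ⟨.inl ⟨_, hv, rfl⟩, fun h => ?_⟩, liftPt_coe v⟩
      exact WithBot.coe_ne_bot (Sum.inl_injective (congrArg T.contract.normalForm h))
    · refine ⟨_, ⟨.inr ⟨e, j, hj, rfl⟩, fun h => ?_⟩, liftPt_edgePt _ _ (key e j hj)⟩
      obtain ⟨b, h0, h1⟩ := edgePt_eq_vertexPt.1 h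
      exact key e j hj b h0 (T.contract_vert_eq_bot.1 h1)
  · rintro ⟨_, ⟨⟨v, hv, rfl⟩ | ⟨e, j, hj, rfl⟩, h⟩, rfl⟩
    · obtain ⟨v, rfl⟩ := WithBot.ne_bot_iff_exists.1 (fun h' : v = ⊥ => h (by rw [h']))
      exact .inl ⟨v, hv, (liftPt_coe v).symm⟩
    · exact .inr ⟨e, j, hj, (liftPt_edgePt _ _ (key e j hj)).symm⟩

theorem outerPts_of_half {e : {e : E // e ∉ T.edges}} {b : Bool} (hg : g.st ⊥ = .half e b) :
    outerPts g u = insert (Γ.halfEdgePt e.1 b (Set.projIcc 0 1 zero_le_one (g.lead u e b)))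
      (T.liftPt r '' (Set.range (g.point u) \
        {T.contract.halfEdgePt e b (Set.projIcc 0 1 zero_le_one (g.lead u e b))})) := by
  have hh := halfAt_of_bot hg
  rw [← Gen.point_firstLabel hh]
  have h0 : Γ.halfEdgePt e.1 b (Set.projIcc 0 1 zero_le_one (g.lead u e b)) =
      Γ.edgePt e.1 (g.pos u e (g.firstIdx e b)) := by
    rw [← Gen.coe_fromEnd_firstIdx u hh.count_pos, Set.projIcc_val, halfEdgePt_eq, fromEnd_fromEnd]
  rw [h0]
  ext x
  simp only [Set.mem_insert_iff, Set.mem_image, Set.mem_sdiff, Set.mem_range, Set.mem_singleton_iff]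
  constructor
  · rintro (⟨v, hv, rfl⟩ | ⟨e', j, hj, rfl⟩)
    · exact .inr ⟨_, ⟨⟨.inl ⟨_, hv⟩, rfl⟩, fun h => by cases Gen.point_injective u h⟩, liftPt_coe v⟩
    · by_cases h : (Sum.inr ⟨e', ⟨j, hj⟩⟩ : g.Label) = Gen.firstLabel hh
      · left
        have h1 := Sum.inr_injective h
        obtain ⟨rfl, h2⟩ := Sigma.mk.inj_iff.1 h1
        have h3 := congrArg Fin.val (eq_of_heq h2)
        dsimp only at h3
        rw [h3]
      · exact .inr ⟨_, ⟨⟨.inr ⟨e', ⟨j, hj⟩⟩, rfl⟩, fun h' => h (Gen.point_injective u h')⟩,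
          liftPt_point_inr hg u _ h⟩
  · rintro (rfl | ⟨_, ⟨⟨v | ⟨e', j⟩, rfl⟩, h⟩, rfl⟩)
    · exact .inr ⟨e, _, Gen.firstIdx_lt hh.count_pos, rfl⟩
    · obtain ⟨v, hv⟩ := v
      obtain ⟨v, rfl⟩ := WithBot.ne_bot_iff_exists.1 (fun h' : v = ⊥ => by
        subst h'; rw [hg] at hv; cases hv)
      exact .inl ⟨v, hv, (liftPt_coe v).symm⟩
    · exact .inr ⟨e', j, j.2, (liftPt_point_inr hg u _ fun h' => h (by rw [h'])).symm⟩

theorem range_liftGen_of_half {e : {e : E // e ∉ T.edges}} {b : Bool} (hg : g.st ⊥ = .half e b)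
    (hu : u ⊥ = 0) : Set.range ((T.liftGen g).point fun v => u (T.collapseVert v)) =
      T.liftPt r '' (Set.range (g.point u) \ {T.contract.vertexPt ⊥}) := by
  have hb : ⊥ ∈ g.active := Gen.mem_active.2 ⟨e, b, hg⟩
  have hset : T.liftGen (g.settle ⊥) = T.liftGen g := by
    refine Gen.ext (liftGen_of_bot (Gen.settle_st hb)) ?_
    simp only [liftGen, Gen.settle_mult]
  have hst : ∀ e b, (g.settle ⊥).st ⊥ ≠ .half e b := fun e b => by
    rw [Gen.settle_st hb]; simp
  rw [← hset, range_liftGen u hst, outerPts_of_not_half u hst, Gen.range_settle hb hu]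

end Subgraph
end Multigraph

namespace Multigraph

variable {V E : Type} {Γ : Multigraph V E} [Fintype V] [LinearOrder V] [Fintype E] [DecidableEq E]

/-! ### Comparison of the cubes of the two complexes -/

namespace Gen

variable {g : Γ.Gen}

theorem lead_release {v : V} (hv : v ∈ g.active) {t : V → unitInterval} (ht : t v = 1) (e : E)
    (b : Bool) : (g.release v).lead t e b = g.lead t e b := by
  obtain ⟨e₀, b₀, h⟩ := mem_active.1 hv
  have hgap : ∀ e' b', (g.release v).gap t e' b' = g.gap t e' b' := by
    intro e' b'
    rw [gap_face h rfl (release_st hv)]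
    split_ifs with he
    · obtain ⟨rfl, rfl⟩ := Prod.mk.inj he
      rw [gap_self h, ht]; rfl
    · rfl
  simp only [lead, hgap, release_count hv]

theorem lead_settle {v : V} (hv : v ∈ g.active) {t : V → unitInterval} (ht : t v = 0) {e : E}
    {b : Bool} (hb : Γ.vert e b ≠ v) : (g.settle v).lead t e b = g.lead t e b := by
  obtain ⟨e₀, b₀, h⟩ := mem_active.1 hv
  have hgap := gap_face h rfl (settle_st hv) t
  have hcount := settle_count h e
  have hne : (e, b) ≠ (e₀, b₀) := by
    rintro ⟨⟩
    exact hb (g.vert_eq _ _ _ h)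
  have h1 : (g.settle v).gap t e b = g.gap t e b := by rw [hgap, if_neg hne]
  have h2 : (g.settle v).gap t e false + (g.settle v).gap t e true + (g.settle v).count e =
      g.gap t e false + g.gap t e true + g.count e := by
    have hself : g.gap t e₀ b₀ = 0 := by rw [gap_self h, ht]; rfl
    by_cases he : e = e₀
    · subst he
      rw [if_pos rfl] at hcount
      have hc : ((g.settle v).count e : ℝ) + 1 = g.count e := by exact_mod_cast hcount
      rw [hgap, hgap, ← hc]
      cases b₀ <;> simp [hself] <;> ring
    · rw [if_neg he, add_zero] at hcount
      rw [hgap, hgap, hcount]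
      simp [he]
  unfold lead
  rw [h1, ← add_sub_assoc, h2, add_sub_assoc]

theorem lead_congr {t t' : V → unitInterval} (h : ∀ v ∈ g.active, t v = t' v) (e : E) (b : Bool) :
    g.lead t e b = g.lead t' e b := by
  have hgap : ∀ b, g.gap t e b = g.gap t' e b := by
    intro b
    unfold gap
    split_ifs with hb
    · rw [h _ hb.active]
    · rfl
  simp only [lead, hgap]

theorem range_ordCube {n k : ℕ} (hn : g.weight = n) (hk : g.degree = k) (t : Fin k → unitInterval) :
    Set.range (g.ordCube hn hk t).1 = Set.range (g.point (g.spread hk t)) :=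
  (Fintype.equivFinOfCardEq (card_label.trans hn)).symm.surjective.range_comp
    (g.point (g.spread hk t))

end Gen

namespace Subgraph

variable {T : Γ.Subgraph}

theorem orderEmb_collapseVert {s : Finset V} (hs : ∀ v ∈ s, v ∉ T.verts)
    {s' : Finset (WithBot {v : V // v ∉ T.verts})} {k : ℕ} (hk : s.card = k) (hk' : s'.card = k)
    (h : ∀ v ∈ s, T.collapseVert v ∈ s') (i : Fin k) :
    s'.orderEmbOfFin hk' i = T.collapseVert (s.orderEmbOfFin hk i) := by
  refine (congrFun (Finset.orderEmbOfFin_unique hk'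
    (f := fun i => T.collapseVert (s.orderEmbOfFin hk i))
    (fun i => h _ (s.orderEmbOfFin_mem hk i)) fun i j hij => ?_) i).symm
  dsimp only
  rw [collapseVert, dif_neg (hs _ (s.orderEmbOfFin_mem hk i)), collapseVert,
    dif_neg (hs _ (s.orderEmbOfFin_mem hk j)), WithBot.coe_lt_coe]
  exact (s.orderEmbOfFin hk).strictMono hij

variable {g : T.contract.Gen}

theorem collapseVert_mem_active {v : V} (hv : v ∈ (T.liftGen g).active) :
    T.collapseVert v ∈ g.active.erase ⊥ := by
  have h := notMem_of_active hv
  rw [collapseVert, dif_neg h, Finset.mem_erase]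
  exact ⟨WithBot.coe_ne_bot, (mem_active_liftGen ⟨v, h⟩).1 hv⟩

/-- The parameters of the cubes of `g` and `H` correspond if `H` has the same active half-edges as
the lift of `g` and there is none at `⊥`. -/
theorem spread_of_active_eq {H : Γ.Gen} (hH : H.active = (T.liftGen g).active) {k : ℕ}
    (hk : g.degree = k) (hk' : H.degree = k) (t : Fin k → unitInterval) :
    H.point (H.spread hk' t) = H.point fun v => g.spread hk t (T.collapseVert v) := by
  refine Gen.point_congr fun v hv => ?_
  obtain ⟨i, rfl⟩ := Gen.exists_eq_orderEmb hk' hv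
  rw [Gen.spread_apply, ← orderEmb_collapseVert (s' := g.active) (fun v hv => notMem_of_active (hH ▸ hv))
    hk' hk (fun v hv => Finset.mem_of_mem_erase (collapseVert_mem_active (hH ▸ hv))), Gen.spread_apply]

theorem orderEmb_zero_of_bot {k : ℕ} (hk : g.degree = k + 1) (hb : ⊥ ∈ g.active) :
    g.active.orderEmbOfFin hk 0 = ⊥ := by
  obtain ⟨i, hi⟩ := Gen.exists_eq_orderEmb hk hb
  rw [← le_bot_iff, ← hi]
  exact (g.active.orderEmbOfFin hk).monotone (Fin.zero_le i)

/-- If `g` has a half-edge at `⊥`, and `H` a half-edge at a vertex `w` of the tree instead, then the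
parameters of their cubes correspond up to moving the first coordinate to the position of `w`. -/
theorem spread_of_active_insert {H : Γ.Gen} {w : V} (hw : w ∈ T.verts)
    (hH : H.active = insert w (T.liftGen g).active) (hb : ⊥ ∈ g.active) {k : ℕ}
    (hk : g.degree = k + 1) (hk' : H.degree = k + 1) : ∃ p : Fin (k + 1), H.sign w = (-1) ^ (p : ℕ) ∧
      ∀ t : Fin (k + 1) → unitInterval, H.point (H.spread hk' (p.insertNth (t 0) fun j => t j.succ)) =
        H.point fun v => g.spread hk t (T.collapseVert v) := by
  have hwH : w ∈ H.active := by rw [hH]; exact Finset.mem_insert_self _ _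
  obtain ⟨p, hp⟩ := Gen.exists_eq_orderEmb hk' hwH
  have hwL : w ∉ (T.liftGen g).active := fun h => notMem_of_active h hw
  refine ⟨p, by rw [← hp, Gen.sign_orderEmb], fun t => Gen.point_congr fun v hv => ?_⟩
  obtain ⟨i, rfl⟩ := Gen.exists_eq_orderEmb hk' hv
  rw [Gen.spread_apply]
  refine Fin.succAboveCases p ?_ (fun j => ?_) i
  · rw [Fin.insertNth_apply_same, hp, T.collapseVert_eq_bot.2 hw, ← orderEmb_zero_of_bot hk hb,
      Gen.spread_apply]
  · rw [Fin.insertNth_apply_succAbove]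
    have hL : (T.liftGen g).active = H.active.erase (H.active.orderEmbOfFin hk' p) := by
      rw [hp, hH, Finset.erase_insert hwL]
    have hkL : (T.liftGen g).active.card = k := by
      have : H.active.card = k + 1 := hk'
      rw [hH, Finset.card_insert_of_notMem hwL] at this
      omega
    have hkE : (g.active.erase ⊥).card = k := card_active_erase.trans hkL
    have h1 := Gen.orderIso_erase H.active hk' p _ hkL hL j
    have h2 := Gen.orderIso_erase g.active hk 0 (g.active.erase ⊥) hkE
      (by rw [orderEmb_zero_of_bot hk hb]; ext; simp only [Finset.mem_erase]) j
    rw [← h1, ← orderEmb_collapseVert (fun v hv => notMem_of_active hv) hkL hkE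
      (fun v hv => collapseVert_mem_active hv), h2, Gen.spread_apply, Fin.succAbove_zero]

variable {r : V} (hT : T.IsTree) (hr : r ∈ T.verts) {n : ℕ}

section cubes

variable {δ : ℝ} (hδ : 0 < δ) (hδ' : δ ≤ 1 / 2) (hδn : δ < 1 / ((n : ℝ) + 1))

/-- The map from configurations with at most one point near `⊥` to configurations in `Γ`. -/
def expandConf : C(UConfLE n 1 T.contract.Space (T.nhdContract δ), UConf n Γ.Space) :=
  (UConfLE.incl n 1 (T.nhd δ)).comp (UConfLE.push n ((isExpansion_expansion hT hr hδ hδ' le_rfl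
      (by linarith)).pushable hT.1))

theorem expandConf_nearCube_eq_cube {k : ℕ} (hn : g.weight = n) (hk : g.degree = k)
    (hg : ∀ e b, g.st ⊥ ≠ .half e b) {H : Γ.Gen} (hH : H.active = (T.liftGen g).active)
    (hn' : H.weight = n) (hk' : H.degree = k)
    (h : ∀ u, Set.range (H.point fun v => u (T.collapseVert v)) = T.liftPt r '' Set.range (g.point u)) :
    (expandConf hT hr hδ hδ').comp (nearCube hδ hδ' hδn g hn hk) = H.cube hn' hk' := by
  ext t
  refine (Conf.mk_eq_iff _ _).2 ?_
  rw [Gen.range_ordCube, spread_of_active_eq hH hk hk', h,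
    ← range_expansion_of_not_half hδ hδ' hδn hT hr hn hg]
  exact (Fintype.equivFinOfCardEq (Gen.card_label.trans hn)).symm.surjective.range_comp
    fun l => expansion hT hr hδ hδ' (g.point (g.spread hk t) l)

theorem expandConf_nearCube_of_empty {k : ℕ} (hn : g.weight = n) (hk : g.degree = k)
    (hg : g.st ⊥ = .empty) (hn' : (T.liftGen g).weight = n) (hk' : (T.liftGen g).degree = k) :
    (expandConf hT hr hδ hδ').comp (nearCube hδ hδ' hδn g hn hk) = (T.liftGen g).cube hn' hk' := by
  have hg' : ∀ e b, g.st ⊥ ≠ .half e b := fun e b => by rw [hg]; simp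
  refine expandConf_nearCube_eq_cube hT hr hδ hδ' hδn hn hk hg' rfl hn' hk' fun u => ?_
  rw [range_liftGen u hg', outerPts_of_not_half u hg', sdiff_eq_left.2]
  rw [Set.disjoint_singleton_right, Gen.mem_range_point']
  rintro (⟨v, hv, h⟩ | ⟨e, j, hj, h⟩)
  · rw [show v = ⊥ from Sum.inl_injective (congrArg T.contract.normalForm h), hg] at hv
    cases hv
  · obtain ⟨b, h0, h1⟩ := edgePt_eq_vertexPt.1 h
    obtain ⟨h2, -⟩ := Gen.fromEnd_pos_eq_zero hj h0
    unfold Gen.HalfAt at h2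
    rw [h1] at h2
    exact hg' e b h2

theorem expandConf_nearCube_of_occupied {k : ℕ} (hn : g.weight = n) (hk : g.degree = k)
    (hg : g.st ⊥ = .occupied) (hn' : ((T.liftGen g).setState r .occupied (by simp)).weight = n)
    (hk' : ((T.liftGen g).setState r .occupied (by simp)).degree = k) :
    (expandConf hT hr hδ hδ').comp (nearCube hδ hδ' hδn g hn hk) =
      ((T.liftGen g).setState r .occupied (by simp)).cube hn' hk' := by
  have hg' : ∀ e b, g.st ⊥ ≠ .half e b := fun e b => by rw [hg]; simp
  have hv : (T.liftGen g).st r = .empty := liftGen_st_of_mem hr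
  refine expandConf_nearCube_eq_cube hT hr hδ hδ' hδn hn hk hg'
    (Gen.active_setState_occupied hv) hn' hk' fun u => ?_
  rw [Gen.range_setState_occupied hv, range_liftGen u hg', outerPts_of_not_half (r := r) u hg',
    ← liftPt_bot (T := T), ← Set.image_insert_eq, Set.insert_sdiff_singleton, Set.insert_eq_of_mem]
  exact ⟨.inl ⟨⊥, hg⟩, rfl⟩

end cubes

section half

variable {e : {e : E // e ∉ T.edges}} {b : Bool} (hg : g.st ⊥ = .half e b)

/-- Inserting a half-edge at a vertex of the tree gives the chain of a cube of sliding
configurations, as soon as the corresponding sets of points agree. -/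
theorem toSing_putHalf {k : ℕ} (hn : g.weight = n) (hk : g.degree = k + 1) {e' : E} {b' : Bool}
    (hv : Γ.vert e' b' ∈ T.verts) (hs) (c : C(Fin (k + 1) → unitInterval, UConf n Γ.Space))
    (p : (WithBot {v : V // v ∉ T.verts} → unitInterval) →
      ℝ × (WithBot {v : V // v ∉ T.verts} → unitInterval))
    (hc : ∀ t, c t = slideConf hg hT hr hn (p (g.spread hk t)))
    (h : ∀ u, Set.range (((T.liftGen g).setState (Γ.vert e' b') (.half e' b') hs).point
      fun v => u (T.collapseVert v)) = Set.range fun l => slidePt r hg l (p u)) :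
    Γ.toSing n (k + 1) ((T.liftGen g).putHalf e' b') =
      cubeChain (X := TopCat.of (UConf n Γ.Space)) c := by
  have hemp : (T.liftGen g).st (Γ.vert e' b') = .empty := liftGen_st_of_mem hv
  obtain ⟨hna, ha⟩ := Gen.active_setState_half hemp hs
  have hb : ⊥ ∈ g.active := Gen.mem_active.2 ⟨e, b, hg⟩
  have hw := liftGen_weight (g := g)
  have hd := liftGen_degree (g := g)
  simp only [hg, LocalState.isHalf, reduceCtorEq, if_true, if_false] at hw hd
  unfold Gen.putHalf
  set H := (T.liftGen g).setState (Γ.vert e' b') (.half e' b') hs with hHdef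
  have hnH : H.weight = n := by
    rw [hHdef, Gen.setState_weight hemp (by simp), hw, hn]
  have hkH : H.degree = k + 1 := by
    change Finset.card _ = _
    rw [ha, Finset.card_insert_of_notMem hna]
    exact hd.trans hk
  obtain ⟨q, hq, hpt⟩ := spread_of_active_insert hv ha hb hk hkH
  have key := cubeChain_insertNth (X := TopCat.of (UConf n Γ.Space)) (H.cube hnH hkH) c q fun t => by
    rw [hc]
    refine ((mk_eq_confOfLabels (p := slidePt r hg) _ _ _ _ _).2 ?_).symm
    rw [Gen.range_ordCube, hpt, h]
  rw [map_zsmul, toSing_single, genChain_of hnH hkH, key, ← hq, Gen.sign_insert hna ha, if_neg (lt_irrefl _),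
    one_mul]

include hT hr in
theorem range_point_eq_slidePt {u : WithBot {v : V // v ∉ T.verts} → unitInterval} (hs) :
    Set.range (((T.liftGen g).setState (Γ.vert e.1 b) (.half e.1 b) hs).point
      fun v => u (T.collapseVert v)) =
        Set.range fun l => slidePt r hg l ((T.path r (Γ.vert e.1 b)).length + g.lead u e b, u) := by
  have hh := halfAt_of_bot hg
  rw [range_liftGen_half u hg, outerPts_of_half (r := r) u hg, range_slidePt, min_self]
  dsimp only
  have h1 : ((Set.projIcc 0 1 zero_le_one (g.lead u e b) : unitInterval) : ℝ) = g.lead u e b := by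
    rw [Set.projIcc_of_mem _ ⟨Gen.lead_nonneg u hh.count_pos, (Gen.lead_lt_one u hh).le⟩]
  conv_rhs => rw [← h1, hairPt_add hT hr (vert_mem_of_bot hg), h1]

theorem range_setState_eq_slidePt {u : WithBot {v : V // v ∉ T.verts} → unitInterval} {d : E} {b' : Bool}
    (hd : d ∈ T.edges) (hs) {τ : ℝ} (hτ : τ ≤ (T.path r (Γ.vert e.1 b)).length) (x : unitInterval)
    (hx : (x : ℝ) = u ⊥ / (1 + u ⊥)) (hp : T.hairPt r e.1 b τ = Γ.halfEdgePt d b' x) :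
    Set.range (((T.liftGen g).setState (Γ.vert d b') (.half d b') hs).point
      fun v => u (T.collapseVert v)) =
        Set.range fun l => slidePt r hg l (τ, Function.update u ⊥ 0) := by
  have hh := halfAt_of_bot hg
  have hv := T.vert_mem d hd b'
  have hlead : g.lead (Function.update u ⊥ 0) e b = 0 :=
    Gen.lead_of_eq_zero hh (by rw [g.vert_eq _ _ _ hg]; simp)
  have hcount : (T.liftGen g).count d = 0 := by
    have : ∀ b, ¬ (T.liftGen g).HalfAt d b := fun b => halfAt_liftGen_of_mem (T.vert_mem d hd b)
    have hm : (T.liftGen g).mult d = 0 := dif_pos hd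
    simp [Gen.count, this, hm]
  rw [Gen.range_setState_half (liftGen_st_of_mem hv) hcount _ x
    (by rw [T.collapseVert_eq_bot.2 hv, hx]), range_slidePt]
  dsimp only
  rw [hlead, add_zero, min_eq_left hτ, hp, Gen.projIcc_zero', halfEdgePt_zero, g.vert_eq _ _ _ hg,
    ← range_liftGen_of_half (Function.update u ⊥ 0) hg (by simp)]
  congr 2
  refine Gen.point_congr fun v hv => ?_
  have := (Finset.mem_erase.1 (collapseVert_mem_active hv)).1
  rw [Function.update_of_ne this]

end half

end Subgraph
end Multigraph

namespace Multigraph.Subgraph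

variable {V E : Type} {Γ : Multigraph V E} [Fintype V] [LinearOrder V] [Fintype E] [DecidableEq E]
  {T : Γ.Subgraph}

/-! ### Prisms -/

/-- A track prescribes, in terms of the parameter of the half-edge at `⊥`, where on its hair the
sliding point is, and a new value of this parameter. The position may depend also on the
distance of the first point on the half-edge. -/
structure Track where
  /-- The position of the sliding point. -/
  pos : C(unitInterval × ℝ, ℝ)
  /-- The new parameter. -/
  param : C(unitInterval, unitInterval)

variable {r : V} (hT : T.IsTree) (hr : r ∈ T.verts) {n : ℕ} {g : T.contract.Gen}
  {e : {e : E // e ∉ T.edges}} {b : Bool}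

/-- The configurations described by a track; the additional parameter `s` pulls the sliding point
back to the root. -/
def trackConf (hg : g.st ⊥ = .half e b) (hn : g.weight = n) (x : Track) :
    C(unitInterval × (WithBot {v : V // v ∉ T.verts} → unitInterval), UConf n Γ.Space) where
  toFun p := slideConf hg hT hr hn
    ((1 - (p.1 : ℝ)) * x.pos (p.2 ⊥, g.lead (Function.update p.2 ⊥ (x.param (p.2 ⊥))) e b),
      Function.update p.2 ⊥ (x.param (p.2 ⊥)))
  continuous_toFun := by
    have h1 : Continuous fun p : unitInterval × (WithBot {v : V // v ∉ T.verts} → unitInterval) =>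
        Function.update p.2 ⊥ (x.param (p.2 ⊥)) :=
      continuous_snd.update ⊥ (x.param.continuous.comp ((continuous_apply _).comp continuous_snd))
    refine (slideConf hg hT hr hn).continuous.comp (Continuous.prodMk ?_ h1)
    refine (continuous_const.sub (continuous_subtype_val.comp continuous_fst)).mul
      (x.pos.continuous.comp (Continuous.prodMk ((continuous_apply _).comp continuous_snd) ?_))
    exact (Gen.continuous_lead b (halfAt_of_bot hg).count_pos).comp h1

theorem continuous_spread {V E : Type} {Γ : Multigraph V E} [Fintype V] [LinearOrder V] [Fintype E]
    [DecidableEq E] {g : Γ.Gen} {k : ℕ} (hk : g.degree = k) : Continuous (g.spread hk) := by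
  refine continuous_pi fun v => ?_
  unfold Gen.spread
  split_ifs
  · exact continuous_apply _
  · exact continuous_const

/-- The cube of configurations described by a track, with the parameter `s` as first coordinate. -/
def prism (hg : g.st ⊥ = .half e b) (hn : g.weight = n) {k : ℕ} (hk : g.degree = k) (x : Track) :
    C(Fin (k + 1) → unitInterval, UConf n Γ.Space) where
  toFun t := trackConf hT hr hg hn x (t 0, g.spread hk fun j => t j.succ)
  continuous_toFun := (trackConf hT hr hg hn x).continuous.comp (Continuous.prodMk
    (continuous_apply _) ((continuous_spread hk).comp (by fun_prop)))

/-- The slice of a prism with constant parameter `s`. -/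
def slice (hg : g.st ⊥ = .half e b) (hn : g.weight = n) {k : ℕ} (hk : g.degree = k) (x : Track)
    (s : unitInterval) : C(Fin k → unitInterval, UConf n Γ.Space) where
  toFun t := trackConf hT hr hg hn x (s, g.spread hk t)
  continuous_toFun := (trackConf hT hr hg hn x).continuous.comp (Continuous.prodMk
    continuous_const (continuous_spread hk))

/-- The chain of a prism, for generators with the half-edge `(e, b)` at `⊥`. -/
def prismChain (e : {e : E // e ∉ T.edges}) (b : Bool) (x : Track) (n k : ℕ) (g : T.contract.Gen) :
    (singChains (TopCat.of (UConf n Γ.Space))).X (k + 1) :=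
  if h : g.weight = n ∧ g.degree = k ∧ g.st ⊥ = .half e b then
    cubeChain (X := TopCat.of (UConf n Γ.Space)) (prism hT hr h.2.2 h.1 h.2.1 x) else 0

theorem prismChain_of (hg : g.st ⊥ = .half e b) (hn : g.weight = n) {k : ℕ} (hk : g.degree = k)
    (x : Track) : prismChain hT hr e b x n k g =
      cubeChain (X := TopCat.of (UConf n Γ.Space)) (prism hT hr hg hn hk x) :=
  dif_pos ⟨hn, hk, hg⟩

theorem prismChain_of_ne (hg : g.st ⊥ ≠ .half e b) (k : ℕ) (x : Track) :
    prismChain hT hr e b x n k g = 0 :=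
  dif_neg fun h => hg h.2.2

theorem trackConf_eq {g' : T.contract.Gen} (hg : g.st ⊥ = .half e b) (hg' : g'.st ⊥ = .half e b)
    (hn : g.weight = n) (hn' : g'.weight = n) (x : Track) (s : unitInterval)
    {u u' : WithBot {v : V // v ∉ T.verts} → unitInterval} (h : u ⊥ = u' ⊥)
    (h' : ∀ y, g.lead (Function.update u ⊥ y) e b = g'.lead (Function.update u' ⊥ y) e b ∧
      Set.range (g.point (Function.update u ⊥ y)) = Set.range (g'.point (Function.update u' ⊥ y))) :
    trackConf hT hr hg hn x (s, u) = trackConf hT hr hg' hn' x (s, u') := by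
  change slideConf hg hT hr hn _ = slideConf hg' hT hr hn' _
  dsimp only
  rw [← h, ← (h' _).1]
  exact slideConf_eq_slideConf hg hT hr hg' hn hn' _ (h' _).1 (h' _).2

/-- The faces of a prism in the direction of a vertex other than `⊥` are the prisms of the
corresponding terms of the differential. -/
theorem prism_face {g' : T.contract.Gen} (hg : g.st ⊥ = .half e b) (hg' : g'.st ⊥ = .half e b)
    (hn : g.weight = n) (hn' : g'.weight = n) {k : ℕ} (hk : g.degree = k + 1) (hk' : g'.degree = k)
    (x : Track) (i : Fin (k + 1)) (a : unitInterval)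
    (hi : g.active.orderEmbOfFin hk i ≠ ⊥)
    (hact : g'.active = g.active.erase (g.active.orderEmbOfFin hk i))
    (h : ∀ u : WithBot {v : V // v ∉ T.verts} → unitInterval, u (g.active.orderEmbOfFin hk i) = a →
      g'.lead u e b = g.lead u e b ∧ Set.range (g'.point u) = Set.range (g.point u)) :
    (prism hT hr hg hn hk x).comp (cubeFace i.succ a) = prism hT hr hg' hn' hk' x := by
  ext t
  have h1 : ∀ v ∈ g'.active, g.spread hk (i.insertNth a fun j => t j.succ) v =
      g'.spread hk' (fun j => t j.succ) v := by
    intro v hv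
    obtain ⟨j, rfl⟩ := Gen.exists_eq_orderEmb hk' hv
    rw [Gen.spread_apply, Gen.orderIso_erase g.active hk i g'.active hk' hact, Gen.spread_apply]
    simp
  have h2 : prism hT hr hg hn hk x (i.succ.insertNth a t) =
      trackConf hT hr hg hn x (t 0, g.spread hk (i.insertNth a fun j => t j.succ)) := by
    have e1 : Fin.insertNth (α := fun _ => unitInterval) i.succ a t 0 = t 0 := by
      conv_lhs => rw [← Fin.succ_succAbove_zero i, Fin.insertNth_apply_succAbove]
    have e2 : (fun j : Fin (k + 1) => Fin.insertNth (α := fun _ => unitInterval) i.succ a t j.succ) =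
        i.insertNth a fun j => t j.succ := by
      funext j
      refine Fin.succAboveCases i ?_ (fun j => ?_) j
      · simp
      · rw [Fin.insertNth_apply_succAbove, ← Fin.succ_succAbove_succ, Fin.insertNth_apply_succAbove]
    exact congrArg (trackConf hT hr hg hn x) (Prod.ext e1 (congrArg (g.spread hk) e2))
  refine h2.trans (trackConf_eq hT hr hg hg' hn hn' x _ (h1 _ (Gen.mem_active.2 ⟨e, b, hg'⟩)) fun y => ?_)
  have h3 : ∀ v ∈ g'.active, Function.update (g.spread hk (i.insertNth a fun j => t j.succ)) ⊥ y v =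
      Function.update (g'.spread hk' fun j => t j.succ) ⊥ y v := by
    intro v hv
    by_cases hvb : v = ⊥
    · subst hvb; simp
    · rw [Function.update_of_ne hvb, Function.update_of_ne hvb, h1 v hv]
  have h4 := h (Function.update (g.spread hk (i.insertNth a fun j => t j.succ)) ⊥ y)
    (by rw [Function.update_of_ne hi, Gen.spread_apply]; simp)
  rw [← Gen.lead_congr h3, ← Gen.point_congr h3]
  exact ⟨h4.1.symm, h4.2.symm⟩

/-- The boundary of a prism: the two slices at `s = 0, 1`, the two ends in the direction of `⊥`, and
the prisms of the differential. The terms of the differential at `⊥` have no half-edge there, so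
that their prism chains vanish. -/
theorem prismChain_d (hg : g.st ⊥ = .half e b) (hn : g.weight = n) {k : ℕ} (hk : g.degree = k + 1)
    (x : Track) :
    ((singChains (TopCat.of (UConf n Γ.Space))).d (k + 1 + 1) (k + 1)).hom
        (prismChain hT hr e b x n (k + 1) g) =
      cubeChain (X := TopCat.of (UConf n Γ.Space)) (slice hT hr hg hn hk x 1) -
        cubeChain (X := TopCat.of (UConf n Γ.Space)) (slice hT hr hg hn hk x 0) -
      (cubeChain (X := TopCat.of (UConf n Γ.Space)) ((prism hT hr hg hn hk x).comp (cubeFace (Fin.succ 0) 1)) -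
        cubeChain (X := TopCat.of (UConf n Γ.Space)) ((prism hT hr hg hn hk x).comp (cubeFace (Fin.succ 0) 0))) -
      ∑ v ∈ g.active, g.sign v •
        (prismChain hT hr e b x n k (g.release v) - prismChain hT hr e b x n k (g.settle v)) := by
  have hb : ⊥ ∈ g.active := Gen.mem_active.2 ⟨e, b, hg⟩
  have h0 : ∀ s, (prism hT hr hg hn hk x).comp (cubeFace 0 s) = slice hT hr hg hn hk x s := by
    intro s
    ext t
    have h1 : (fun j : Fin (k + 1) => Fin.insertNth (α := fun _ => unitInterval) 0 s t j.succ) = t := by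
      funext j
      exact Fin.insertNth_apply_succAbove (α := fun _ => unitInterval) (0 : Fin (k + 2)) s t j
    exact congrArg (trackConf hT hr hg hn x) (Prod.ext
      (Fin.insertNth_apply_same (α := fun _ => unitInterval) (0 : Fin (k + 2)) s t)
      (congrArg (g.spread hk) h1))
  rw [prismChain_of hT hr hg hn hk]
  refine (cubeChain_d (X := TopCat.of (UConf n Γ.Space)) (prism hT hr hg hn hk x)).trans ?_
  rw [Fin.sum_univ_succ, Fin.sum_univ_succ, h0, h0, Gen.bdry_eq_sum hk, Fin.sum_univ_succ,
    orderEmb_zero_of_bot hk hb, prismChain_of_ne, prismChain_of_ne]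
  · have key : ∀ j : Fin k,
        (-1 : ℤ) ^ (j.succ : ℕ) • (prismChain hT hr e b x n k (g.release (g.active.orderEmbOfFin hk j.succ)) -
          prismChain hT hr e b x n k (g.settle (g.active.orderEmbOfFin hk j.succ))) =
        - ((-1 : ℤ) ^ (j.succ.succ : ℕ) •
          (cubeChain (X := TopCat.of (UConf n Γ.Space)) ((prism hT hr hg hn hk x).comp (cubeFace j.succ.succ 1)) -
          cubeChain (X := TopCat.of (UConf n Γ.Space)) ((prism hT hr hg hn hk x).comp (cubeFace j.succ.succ 0)))) := by
      intro j
      have hm := g.active.orderEmbOfFin_mem hk j.succ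
      have hne : g.active.orderEmbOfFin hk j.succ ≠ ⊥ := by
        rw [← orderEmb_zero_of_bot hk hb]
        exact fun h => Fin.succ_ne_zero j ((g.active.orderEmbOfFin hk).injective h)
      have hgr : (g.release (g.active.orderEmbOfFin hk j.succ)).st ⊥ = .half e b := by
        rw [Gen.st_of_ne hne.symm (Gen.release_st hm), hg]
      have hgs : (g.settle (g.active.orderEmbOfFin hk j.succ)).st ⊥ = .half e b := by
        rw [Gen.st_of_ne hne.symm (Gen.settle_st hm), hg]
      have hvb : T.contract.vert e b ≠ g.active.orderEmbOfFin hk j.succ := by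
        rw [g.vert_eq _ _ _ hg]; exact hne.symm
      rw [prismChain_of hT hr hgr ((Gen.release_weight hm).trans hn) (Gen.degree_release hk hm),
        prismChain_of hT hr hgs ((Gen.settle_weight hm).trans hn) (Gen.degree_settle hk hm),
        prism_face hT hr hg hgr hn ((Gen.release_weight hm).trans hn) hk (Gen.degree_release hk hm) x
          j.succ 1 hne (Gen.release_active hm)
          fun u hu => ⟨Gen.lead_release hm hu e b, Gen.range_release hm hu⟩,
        prism_face hT hr hg hgs hn ((Gen.settle_weight hm).trans hn) hk (Gen.degree_settle hk hm) x
          j.succ 0 hne (Gen.settle_active hm)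
          fun u hu => ⟨Gen.lead_settle hm hu hvb, Gen.range_settle hm hu⟩, Fin.val_succ j.succ,
        pow_succ, mul_neg_one, neg_zsmul, neg_neg]
    rw [Finset.sum_congr rfl fun j _ => key j, Finset.sum_neg_distrib]
    simp
    abel
  · rw [Gen.settle_st hb]; simp
  · rw [Gen.release_st hb]; simp

end Multigraph.Subgraph

namespace Multigraph.Subgraph

variable {V E : Type} {Γ : Multigraph V E} [Fintype V] [LinearOrder V] [Fintype E] [DecidableEq E]
  {T : Γ.Subgraph}

/-! ### The chain homotopy -/

/-- The track of the expanded cube: the sliding point is where the expansion moves the point on the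
half-edge at `⊥`. -/
def expandTrack (δ : ℝ) (m : ℕ) : Track where
  pos := ⟨fun p => hairTime δ 1 m p.2,
    continuous_hairTime δ m continuous_const continuous_snd fun _ => le_rfl⟩
  param := .id _

/-- The track of the cube in which the half-edge at `⊥` is replaced by the same half-edge of `Γ`. -/
def stayTrack (m : ℕ) : Track where
  pos := ⟨fun p => m + p.2, by fun_prop⟩
  param := .id _

theorem continuous_edgePos : Continuous fun p : unitInterval × ℝ => (p.1 : ℝ) / (1 + p.1) :=
  Continuous.div (by fun_prop) (by fun_prop) fun p => by linarith [p.1.2.1]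

/-- The track of a half-edge by which the path in the tree leaves its `i`-th vertex. Its edge contains
no other point, so that gaps of relative lengths `t` and `1` put the point at distance `t / (1 + t)`
from that vertex. The parameter of the half-edge at `⊥` is set to `0`, where the remaining points of
its edge are as they are without this half-edge. -/
def leaveTrack (i : ℕ) : Track where
  pos := ⟨fun p => i + (p.1 : ℝ) / (1 + p.1), continuous_const.add continuous_edgePos⟩
  param := .const _ 0

/-- The track of the half-edge by which the path in the tree arrives at its `i + 1`-st vertex. -/
def arriveTrack (i : ℕ) : Track where
  pos := ⟨fun p => i + 1 - (p.1 : ℝ) / (1 + p.1), continuous_const.sub continuous_edgePos⟩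
  param := .const _ 0

variable {r : V} (hT : T.IsTree) (hr : r ∈ T.verts) {n : ℕ} {g : T.contract.Gen}
  {e : {e : E // e ∉ T.edges}} {b : Bool} {δ : ℝ}

/-- At `s = 1` the sliding point is at the root, so that only the parameter of the track matters. -/
theorem trackConf_one (hg : g.st ⊥ = .half e b) (hn : g.weight = n) {x y : Track}
    (h : x.param = y.param) (u : WithBot {v : V // v ∉ T.verts} → unitInterval) :
    trackConf hT hr hg hn x (1, u) = trackConf hT hr hg hn y (1, u) := by
  change slideConf hg hT hr hn _ = slideConf hg hT hr hn _
  simp [h]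

theorem slice_one (hg : g.st ⊥ = .half e b) (hn : g.weight = n) {k : ℕ} (hk : g.degree = k) {x y : Track}
    (h : x.param = y.param) : slice hT hr hg hn hk x 1 = slice hT hr hg hn hk y 1 := by
  ext t
  exact trackConf_one hT hr hg hn h _

/-- The ends of prisms in the direction of `⊥` agree if the tracks agree there. -/
theorem prism_end_congr (hg : g.st ⊥ = .half e b) (hn : g.weight = n) {k : ℕ} (hk : g.degree = k + 1)
    {x y : Track} {a : unitInterval} (h : x.param a = y.param a)
    (h' : ∀ u : WithBot {v : V // v ∉ T.verts} → unitInterval, u ⊥ = x.param a →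
      x.pos (a, g.lead u e b) = y.pos (a, g.lead u e b)) :
    (prism hT hr hg hn hk x).comp (cubeFace (Fin.succ 0) a) =
      (prism hT hr hg hn hk y).comp (cubeFace (Fin.succ 0) a) := by
  ext t
  have hb : ⊥ ∈ g.active := Gen.mem_active.2 ⟨e, b, hg⟩
  have h0 : g.spread hk (fun j => Fin.insertNth (α := fun _ => unitInterval) (Fin.succ 0) a t j.succ) ⊥ = a := by
    conv_lhs => rw [← orderEmb_zero_of_bot hk hb, Gen.spread_apply]
    simp
  change slideConf hg hT hr hn _ = slideConf hg hT hr hn _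
  simp only [cubeFace, ContinuousMap.coe_mk, h0]
  rw [h' _ (by simp), h]

/-- The chain homotopy on generators with the half-edge `(e, b)` at `⊥`: the prism of each term of the
contraction minus the prism of the expanded cube. -/
def homotopyChain (δ : ℝ) (e : {e : E // e ∉ T.edges}) (b : Bool) (n k : ℕ) (g : T.contract.Gen) :
    (singChains (TopCat.of (UConf n Γ.Space))).X (k + 1) :=
  prismChain hT hr e b (stayTrack (T.path r (Γ.vert e.1 b)).length) n k g -
    prismChain hT hr e b (expandTrack δ (T.path r (Γ.vert e.1 b)).length) n k g +
    ∑ i : Fin (T.path r (Γ.vert e.1 b)).length,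
      (prismChain hT hr e b (leaveTrack i) n k g - prismChain hT hr e b (arriveTrack i) n k g)

theorem homotopyChain_of_ne (hg : g.st ⊥ ≠ .half e b) (k : ℕ) :
    homotopyChain hT hr δ e b n k g = 0 := by
  unfold homotopyChain
  simp only [prismChain_of_ne hT hr hg]
  simp

omit [Fintype V] [LinearOrder V] [Fintype E] [DecidableEq E] in
theorem zsmul_sub_add_sum {M ι : Type*} [AddCommGroup M] [Fintype ι] (z : ℤ) (a b a' b' : M)
    (c d c' d' : ι → M) : z • (a - b + ∑ i, (c i - d i) - (a' - b' + ∑ i, (c' i - d' i))) =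
      z • (a - a') - z • (b - b') + ∑ i, (z • (c i - c' i) - z • (d i - d' i)) := by
  simp only [smul_sub, smul_add, Finset.smul_sum, Finset.sum_sub_distrib]
  abel

theorem sum_sign_homotopyChain (k : ℕ) : ∑ v ∈ g.active, g.sign v •
      (homotopyChain hT hr δ e b n k (g.release v) - homotopyChain hT hr δ e b n k (g.settle v)) =
    (∑ v ∈ g.active, g.sign v •
      (prismChain hT hr e b (stayTrack (T.path r (Γ.vert e.1 b)).length) n k (g.release v) -
        prismChain hT hr e b (stayTrack (T.path r (Γ.vert e.1 b)).length) n k (g.settle v))) -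
    (∑ v ∈ g.active, g.sign v •
      (prismChain hT hr e b (expandTrack δ (T.path r (Γ.vert e.1 b)).length) n k (g.release v) -
        prismChain hT hr e b (expandTrack δ (T.path r (Γ.vert e.1 b)).length) n k (g.settle v))) +
    ∑ i : Fin (T.path r (Γ.vert e.1 b)).length,
      ((∑ v ∈ g.active, g.sign v • (prismChain hT hr e b (leaveTrack i) n k (g.release v) -
          prismChain hT hr e b (leaveTrack i) n k (g.settle v))) -
        ∑ v ∈ g.active, g.sign v • (prismChain hT hr e b (arriveTrack i) n k (g.release v) -
          prismChain hT hr e b (arriveTrack i) n k (g.settle v))) := by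
  simp only [← Finset.sum_sub_distrib]
  rw [Finset.sum_comm, ← Finset.sum_add_distrib]
  refine Finset.sum_congr rfl fun v _ => ?_
  exact zsmul_sub_add_sum _ _ _ _ _ _ _ _ _

/-- The ends of the prisms cancel, which leaves the difference of the expanded cube and the terms of
the contraction. -/
theorem homotopyChain_d (hδ : 0 < δ) (hδn : δ < 1 / ((n : ℝ) + 1)) (hg : g.st ⊥ = .half e b)
    (hn : g.weight = n) {k : ℕ} (hk : g.degree = k + 1) :
    ((singChains (TopCat.of (UConf n Γ.Space))).d (k + 1 + 1) (k + 1)).hom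
        (homotopyChain hT hr δ e b n (k + 1) g) =
      cubeChain (X := TopCat.of (UConf n Γ.Space))
          (slice hT hr hg hn hk (expandTrack δ (T.path r (Γ.vert e.1 b)).length) 0) -
        (cubeChain (X := TopCat.of (UConf n Γ.Space))
          (slice hT hr hg hn hk (stayTrack (T.path r (Γ.vert e.1 b)).length) 0) +
        ∑ i : Fin (T.path r (Γ.vert e.1 b)).length,
          (cubeChain (X := TopCat.of (UConf n Γ.Space)) (slice hT hr hg hn hk (leaveTrack i) 0) -
            cubeChain (X := TopCat.of (UConf n Γ.Space)) (slice hT hr hg hn hk (arriveTrack i) 0))) -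
      ∑ v ∈ g.active, g.sign v •
        (homotopyChain hT hr δ e b n k (g.release v) - homotopyChain hT hr δ e b n k (g.settle v)) := by
  have hh := halfAt_of_bot hg
  have hvb := g.vert_eq _ _ _ hg
  set m := (T.path r (Γ.vert e.1 b)).length with hm
  -- The ends of the prisms of the half-edges of the path, as a function of the vertices of the path.
  let F : ℕ → (singChains (TopCat.of (UConf n Γ.Space))).X (k + 1) := fun i =>
    cubeChain (X := TopCat.of (UConf n Γ.Space))
      ((prism hT hr hg hn hk (leaveTrack i)).comp (cubeFace (Fin.succ 0) 0))
  have hlead : ∀ u : WithBot {v : V // v ∉ T.verts} → unitInterval, u ⊥ = 0 → g.lead u e b = 0 :=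
    fun u hu => Gen.lead_of_eq_zero hh (by rw [hvb, hu])
  -- At parameter `1` the first point of the half-edge is outside the support of the expansion.
  have e1 : (prism hT hr hg hn hk (expandTrack δ m)).comp (cubeFace (Fin.succ 0) 1) =
      (prism hT hr hg hn hk (stayTrack m)).comp (cubeFace (Fin.succ 0) 1) := by
    refine prism_end_congr hT hr hg hn hk rfl fun u hu => ?_
    refine hairTime_of_le hδ zero_le_one le_rfl (hδn.le.trans ?_)
    have h1 : g.gap u e b = 1 := by
      rw [Gen.gap, if_pos hh, hvb, hu]; rfl
    have h2 := Gen.denom_le (g := g) u e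
    have h3 := Gen.one_le_denom (g := g) u hh.count_pos
    rw [hn] at h2
    unfold Gen.lead
    rw [h1]
    exact one_div_le_one_div_of_le (by linarith) h2
  -- At parameter `0` it is at `⊥`, and is expanded to the root, where the path begins.
  have e2 : (prism hT hr hg hn hk (expandTrack δ m)).comp (cubeFace (Fin.succ 0) 0) =
      (prism hT hr hg hn hk (leaveTrack 0)).comp (cubeFace (Fin.succ 0) 0) := by
    refine prism_end_congr hT hr hg hn hk rfl fun u hu => ?_
    rw [hlead u hu]
    change hairTime δ 1 m 0 = ((0 : ℕ) : ℝ) + ((0 : unitInterval) : ℝ) / (1 + (0 : unitInterval))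
    simp [hairTime]
  have e3 : (prism hT hr hg hn hk (stayTrack m)).comp (cubeFace (Fin.succ 0) 0) =
      (prism hT hr hg hn hk (leaveTrack m)).comp (cubeFace (Fin.succ 0) 0) := by
    refine prism_end_congr hT hr hg hn hk rfl fun u hu => ?_
    rw [hlead u hu]
    simp [stayTrack, leaveTrack]
  -- The point is at the midpoint of the `i`-th edge of the path on both sides.
  have e4 : ∀ i : ℕ, (prism hT hr hg hn hk (leaveTrack i)).comp (cubeFace (Fin.succ 0) 1) =
      (prism hT hr hg hn hk (arriveTrack i)).comp (cubeFace (Fin.succ 0) 1) := by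
    intro i
    refine prism_end_congr hT hr hg hn hk rfl fun u hu => ?_
    simp [leaveTrack, arriveTrack]
    ring
  have e5 : ∀ i : ℕ, (prism hT hr hg hn hk (arriveTrack i)).comp (cubeFace (Fin.succ 0) 0) =
      (prism hT hr hg hn hk (leaveTrack (i + 1))).comp (cubeFace (Fin.succ 0) 0) := by
    intro i
    refine prism_end_congr hT hr hg hn hk rfl fun u hu => ?_
    simp [leaveTrack, arriveTrack]
  have hd := fun x => prismChain_d hT hr hg hn hk x
  have hsum : ∑ i : Fin m, (F i - F (i + 1)) = F 0 - F m := by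
    rw [Fin.sum_univ_eq_sum_range (fun i => F i - F (i + 1)), Finset.sum_range_sub']
  rw [sum_sign_homotopyChain, homotopyChain, map_add, map_sub, map_sum]
  simp only [map_sub, hd, e1, e2, e3, e4, e5, ← hm]
  rw [slice_one hT hr hg hn hk (x := expandTrack δ m) (y := stayTrack m) rfl]
  simp only [fun i => slice_one hT hr hg hn hk (x := leaveTrack i) (y := arriveTrack i) rfl]
  simp only [F, Finset.sum_sub_distrib] at hsum ⊢
  generalize cubeChain (X := TopCat.of (UConf n Γ.Space))
    ((prism hT hr hg hn hk (leaveTrack 0)).comp (cubeFace (Fin.succ 0) 0)) = X0 at hsum ⊢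
  generalize cubeChain (X := TopCat.of (UConf n Γ.Space))
    ((prism hT hr hg hn hk (leaveTrack m)).comp (cubeFace (Fin.succ 0) 0)) = X1 at hsum ⊢
  rw [sub_eq_sub_iff_add_eq_add] at hsum
  rw [← sub_eq_zero]
  have h9 := sub_eq_zero.2 hsum
  rw [← h9]
  abel

end Multigraph.Subgraph

namespace Multigraph.Subgraph

variable {V E : Type} {Γ : Multigraph V E} [Fintype V] [LinearOrder V] [Fintype E] [DecidableEq E]
  {T : Γ.Subgraph} {r : V} (hT : T.IsTree) (hr : r ∈ T.verts) {n : ℕ} {g : T.contract.Gen}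
  {e : {e : E // e ∉ T.edges}} {b : Bool} {δ : ℝ}

/-! ### The contraction on homology -/

/-- The half-edges inserted at the vertices of the tree give slices at time `0`. -/
theorem toSing_putHalf_eq_slice {k : ℕ} (hg : g.st ⊥ = .half e b) (hn : g.weight = n)
    (hk : g.degree = k + 1) {e' : E} {b' : Bool} (hv : Γ.vert e' b' ∈ T.verts)
    (hs : ∀ e₀ b₀, LocalState.half e' b' = .half e₀ b₀ → Γ.vert e₀ b₀ = Γ.vert e' b') (x : Track)
    (h : ∀ u, Set.range (((T.liftGen g).setState (Γ.vert e' b') (.half e' b') hs).point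
      fun v => u (T.collapseVert v)) = Set.range fun l => slidePt r hg l
        (x.pos (u ⊥, g.lead (Function.update u ⊥ (x.param (u ⊥))) e b),
          Function.update u ⊥ (x.param (u ⊥)))) :
    Γ.toSing n (k + 1) ((T.liftGen g).putHalf e' b') =
      cubeChain (X := TopCat.of (UConf n Γ.Space)) (slice hT hr hg hn hk x 0) := by
  refine toSing_putHalf (hg := hg) hT hr hn hk hv hs _ (fun u =>
    ((1 - ((0 : unitInterval) : ℝ)) * x.pos (u ⊥, g.lead (Function.update u ⊥ (x.param (u ⊥))) e b),
      Function.update u ⊥ (x.param (u ⊥)))) (fun t => rfl) fun u => ?_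
  rw [h u, Set.Icc.coe_zero, sub_zero, one_mul]

theorem toSing_putHalf_stay {k : ℕ} (hg : g.st ⊥ = .half e b) (hn : g.weight = n)
    (hk : g.degree = k + 1) : Γ.toSing n (k + 1) ((T.liftGen g).putHalf e.1 b) =
      cubeChain (X := TopCat.of (UConf n Γ.Space))
        (slice hT hr hg hn hk (stayTrack (T.path r (Γ.vert e.1 b)).length) 0) := by
  refine toSing_putHalf_eq_slice hT hr hg hn hk (vert_mem_of_bot hg) (by rintro _ _ ⟨⟩; rfl) _
    fun u => ?_
  rw [range_point_eq_slidePt hT hr hg]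
  simp [stayTrack]

theorem toSing_putHalf_leave {k : ℕ} (hg : g.st ⊥ = .half e b) (hn : g.weight = n)
    (hk : g.degree = k + 1) (i : Fin (T.path r (Γ.vert e.1 b)).length) :
    Γ.toSing n (k + 1) ((T.liftGen g).putHalf (T.path r (Γ.vert e.1 b))[i].1
      (T.path r (Γ.vert e.1 b))[i].2) = cubeChain (X := TopCat.of (UConf n Γ.Space))
        (slice hT hr hg hn hk (leaveTrack i) 0) := by
  have hv := vert_mem_of_bot hg
  obtain ⟨hp1, -, hp2⟩ := isPath_path hT hr hv
  have hd := hp2 _ (List.getElem_mem i.2)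
  refine toSing_putHalf_eq_slice hT hr hg hn hk (T.vert_mem _ hd _) (by rintro _ _ ⟨⟩; rfl) _
    fun u => ?_
  have hi : ((i : ℕ) : ℝ) + 1 ≤ (T.path r (Γ.vert e.1 b)).length := by exact_mod_cast i.2
  have h0 := (u ⊥).2.1
  let x : unitInterval := ⟨(u ⊥ : ℝ) / (1 + u ⊥), by positivity,
    (div_le_one (by positivity)).2 (by linarith)⟩
  have hx := x.2.2
  rw [range_setState_eq_slidePt hg hd _ (τ := i + x) (by linarith) x rfl
    (by rw [hairPt_of_le hT hr hv (by linarith)]; exact pathPt_getElem hp1 i.2 x)]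
  simp [leaveTrack, x]

theorem toSing_putHalf_arrive {k : ℕ} (hg : g.st ⊥ = .half e b) (hn : g.weight = n)
    (hk : g.degree = k + 1) (i : Fin (T.path r (Γ.vert e.1 b)).length) :
    Γ.toSing n (k + 1) ((T.liftGen g).putHalf (T.path r (Γ.vert e.1 b))[i].1
      (!(T.path r (Γ.vert e.1 b))[i].2)) = cubeChain (X := TopCat.of (UConf n Γ.Space))
        (slice hT hr hg hn hk (arriveTrack i) 0) := by
  have hv := vert_mem_of_bot hg
  obtain ⟨hp1, -, hp2⟩ := isPath_path hT hr hv
  have hd := hp2 _ (List.getElem_mem i.2)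
  refine toSing_putHalf_eq_slice hT hr hg hn hk (T.vert_mem _ hd _) (by rintro _ _ ⟨⟩; rfl) _
    fun u => ?_
  have hi : ((i : ℕ) : ℝ) + 1 ≤ (T.path r (Γ.vert e.1 b)).length := by exact_mod_cast i.2
  have h0 := (u ⊥).2.1
  let x : unitInterval := ⟨(u ⊥ : ℝ) / (1 + u ⊥), by positivity,
    (div_le_one (by positivity)).2 (by linarith)⟩
  have hx := x.2.2
  have hx0 := x.2.1
  have h1 := pathPt_getElem hp1 i.2 (unitInterval.symm x)
  rw [unitInterval.coe_symm_eq, ← add_sub_assoc] at h1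
  rw [range_setState_eq_slidePt hg hd _ (τ := i + 1 - x) (by linarith) x rfl
    (by rw [hairPt_of_le hT hr hv (by linarith), halfEdgePt_not]; exact h1)]
  simp [arriveTrack, x]

theorem toSing_putLocal_half {k : ℕ} (hg : g.st ⊥ = .half e b) (hn : g.weight = n)
    (hk : g.degree = k + 1) : Γ.toSing n (k + 1) (T.putLocal r (.half e b) (T.liftGen g)) =
      cubeChain (X := TopCat.of (UConf n Γ.Space))
          (slice hT hr hg hn hk (stayTrack (T.path r (Γ.vert e.1 b)).length) 0) +
        ∑ i : Fin (T.path r (Γ.vert e.1 b)).length,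
          (cubeChain (X := TopCat.of (UConf n Γ.Space)) (slice hT hr hg hn hk (leaveTrack i) 0) -
            cubeChain (X := TopCat.of (UConf n Γ.Space)) (slice hT hr hg hn hk (arriveTrack i) 0)) := by
  change Γ.toSing n (k + 1) ((T.liftGen g).putHalf e.1 b +
    (T.liftGen g).putPath (T.path r (Γ.vert e.1 b))) = _
  rw [map_add, toSing_putHalf_stay hT hr hg hn hk, Gen.putPath, ← Fin.sum_univ_fun_getElem, map_sum]
  refine congrArg _ (Finset.sum_congr rfl fun i _ => ?_)
  rw [map_sub]
  exact congrArg₂ _ (toSing_putHalf_leave hT hr hg hn hk i) (toSing_putHalf_arrive hT hr hg hn hk i)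

variable (hδ : 0 < δ) (hδ' : δ ≤ 1 / 2) (hδn : δ < 1 / ((n : ℝ) + 1))

theorem expandConf_nearCube_of_half {k : ℕ} (hg : g.st ⊥ = .half e b) (hn : g.weight = n)
    (hk : g.degree = k) : (expandConf hT hr hδ hδ').comp (nearCube hδ hδ' hδn g hn hk) =
      slice hT hr hg hn hk (expandTrack δ (T.path r (Γ.vert e.1 b)).length) 0 := by
  ext t
  refine (push_nearCube_of_half hδ hδ' hδn hT hr hn hk hg t).trans ?_
  change _ = slideConf hg hT hr hn _
  simp [expandTrack]

/-- The chain homotopy on generators. It vanishes unless there is a half-edge at `⊥`. -/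
def homotopyGen (δ : ℝ) (n k : ℕ) (g : T.contract.Gen) :
    (singChains (TopCat.of (UConf n Γ.Space))).X (k + 1) :=
  match g.st ⊥ with
  | .half e b => homotopyChain hT hr δ e b n k g
  | _ => 0

theorem homotopyGen_of_half (hg : g.st ⊥ = .half e b) (k : ℕ) :
    homotopyGen hT hr δ n k g = homotopyChain hT hr δ e b n k g := by
  unfold homotopyGen; split <;> simp_all

theorem homotopyGen_of_not_half (hg : ∀ e b, g.st ⊥ ≠ .half e b) (k : ℕ) :
    homotopyGen hT hr δ n k g = 0 := by
  unfold homotopyGen; split <;> simp_all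

/-- The linear extension of `homotopyGen`. -/
def homotopyMap (δ : ℝ) (n k : ℕ) :
    T.contract.Swiat →ₗ[ℤ] (singChains (TopCat.of (UConf n Γ.Space))).X (k + 1) :=
  Finsupp.linearCombination ℤ (homotopyGen hT hr δ n k)

theorem homotopyMap_single (k : ℕ) (g : T.contract.Gen) :
    homotopyMap hT hr δ n k (Finsupp.single g 1) = homotopyGen hT hr δ n k g :=
  (Finsupp.linearCombination_single ℤ 1 g).trans (@one_smul ℤ _ _ (_) _)

theorem homotopyMap_bdry (k : ℕ) (g : T.contract.Gen) : homotopyMap hT hr δ n k g.bdry =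
    ∑ v ∈ g.active, g.sign v •
      (homotopyGen hT hr δ n k (g.release v) - homotopyGen hT hr δ n k (g.settle v)) := by
  rw [Gen.bdry, map_sum]
  refine Finset.sum_congr rfl fun v _ => ?_
  rw [map_zsmul, map_sub, homotopyMap_single, homotopyMap_single]

theorem cubeChain_expand_of_not_half {k : ℕ} (hn : g.weight = n) (hk : g.degree = k)
    (hg : ∀ e b, g.st ⊥ ≠ .half e b) :
    cubeChain (X := TopCat.of (UConf n Γ.Space))
        ((expandConf hT hr hδ hδ').comp (nearCube hδ hδ' hδn g hn hk)) =
      Γ.toSing n k (T.swiatContract r (Finsupp.single g 1)) := by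
  have hw := liftGen_weight (g := g)
  have hd := liftGen_degree (g := g)
  rw [swiatContract_single]
  cases hs : g.st ⊥ with
  | empty =>
    simp only [hs, LocalState.isHalf, if_true, Bool.false_eq_true, if_false, add_zero] at hw hd
    have hn' := hw.trans hn
    have hk' := hd.trans hk
    refine Eq.trans ?_ ((toSing_single n k _).trans (genChain_of hn' hk')).symm
    rw [expandConf_nearCube_of_empty hT hr hδ hδ' hδn hn hk hs hn' hk']
  | occupied =>
    simp only [hs, LocalState.isHalf, reduceCtorEq, Bool.false_eq_true, if_false, add_zero] at hw hd
    have hr' : (T.liftGen g).st r = .empty := liftGen_st_of_mem hr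
    have hn' : ((T.liftGen g).setState r .occupied (by simp)).weight = n := by
      rw [Gen.setState_weight hr' (by simp), hw, hn]
    have hk' : ((T.liftGen g).setState r .occupied (by simp)).degree = k := by
      change Finset.card _ = k
      rw [Gen.active_setState_occupied hr']
      exact hd.trans hk
    refine Eq.trans ?_ ((toSing_single n k _).trans (genChain_of hn' hk')).symm
    rw [expandConf_nearCube_of_occupied hT hr hδ hδ' hδn hn hk hs hn' hk']
  | half e b => exact (hg e b hs).elim

/-- The expanded cube of a generator differs from the image of the generator under the contraction
by the boundary of the chain homotopy. -/
theorem cubeChain_expand {k : ℕ} (hn : g.weight = n) (hk : g.degree = k + 1) :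
    cubeChain (X := TopCat.of (UConf n Γ.Space))
        ((expandConf hT hr hδ hδ').comp (nearCube hδ hδ' hδn g hn hk)) =
      homotopyMap hT hr δ n k g.bdry +
        ((singChains (TopCat.of (UConf n Γ.Space))).d (k + 1 + 1) (k + 1)).hom
          (homotopyMap hT hr δ n (k + 1) (Finsupp.single g 1)) +
        Γ.toSing n (k + 1) (T.swiatContract r (Finsupp.single g 1)) := by
  rw [homotopyMap_bdry, homotopyMap_single]
  by_cases hg : ∀ e b, g.st ⊥ ≠ .half e b
  · have h0 : ∀ v ∈ g.active, v ≠ ⊥ := by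
      rintro v hv rfl
      obtain ⟨e, b, h⟩ := Gen.mem_active.1 hv
      exact hg e b h
    rw [homotopyGen_of_not_half hT hr hg, map_zero, add_zero, Finset.sum_eq_zero, zero_add]
    · exact cubeChain_expand_of_not_half hT hr hδ hδ' hδn hn hk hg
    · intro v hv
      rw [homotopyGen_of_not_half, homotopyGen_of_not_half, sub_zero, zsmul_zero]
      · rwa [Gen.st_of_ne (h0 v hv).symm (Gen.settle_st hv)]
      · rwa [Gen.st_of_ne (h0 v hv).symm (Gen.release_st hv)]
  · push Not at hg
    obtain ⟨e, b, hg⟩ := hg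
    have hface : ∀ v ∈ g.active, homotopyGen hT hr δ n k (g.release v) =
        homotopyChain hT hr δ e b n k (g.release v) ∧ homotopyGen hT hr δ n k (g.settle v) =
        homotopyChain hT hr δ e b n k (g.settle v) := by
      intro v hv
      by_cases hvb : v = ⊥
      · subst hvb
        have h1 : ∀ e b, (g.release ⊥).st ⊥ ≠ .half e b := fun e b => by
          rw [Gen.release_st hv]; simp
        have h2 : ∀ e b, (g.settle ⊥).st ⊥ ≠ .half e b := fun e b => by
          rw [Gen.settle_st hv]; simp
        rw [homotopyGen_of_not_half hT hr h1, homotopyGen_of_not_half hT hr h2,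
          homotopyChain_of_ne hT hr (h1 e b), homotopyChain_of_ne hT hr (h2 e b)]
        exact ⟨rfl, rfl⟩
      · exact ⟨homotopyGen_of_half hT hr (by rw [Gen.st_of_ne (Ne.symm hvb) (Gen.release_st hv), hg]) k,
          homotopyGen_of_half hT hr (by rw [Gen.st_of_ne (Ne.symm hvb) (Gen.settle_st hv), hg]) k⟩
    rw [homotopyGen_of_half hT hr hg, homotopyChain_d hT hr hδ hδn hg hn hk,
      expandConf_nearCube_of_half hT hr hδ hδ' hδn hg hn hk, swiatContract_single, hg,
      toSing_putLocal_half hT hr hg hn hk,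
      Finset.sum_congr rfl fun v hv => by rw [(hface v hv).1, (hface v hv).2]]
    abel

/-- The expansion of the cubes realizes the contraction on homology. -/
theorem homologyMap_nearCubes (k : ℕ) :
    HomologicalComplex.homologyMap ((nearCubes hδ hδ' hδn (T := T)).chainMap ≫
        singMap (expandConf hT hr hδ hδ')) k =
      HomologicalComplex.homologyMap (T.contractChain hT hr n ≫ Γ.swiatToSing n) k := by
  have hA : ∀ {k : ℕ} (g : T.contract.Gen) (hn : g.weight = n) (hk : g.degree = k),
      (((nearCubes hδ hδ' hδn (T := T)).chainMap ≫ singMap (expandConf hT hr hδ hδ')).f k).hom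
        (⟨Finsupp.single g 1, single_mem_swiatPart hn hk⟩ : T.contract.swiatPart n k) =
      cubeChain (X := TopCat.of (UConf n Γ.Space))
        ((expandConf hT hr hδ hδ').comp (nearCube hδ hδ' hδn g hn hk)) := by
    intro k g hn hk
    rw [← singMap_cubeChain]
    exact congrArg ((singMap (expandConf hT hr hδ hδ')).f k).hom
      ((nearCubes hδ hδ' hδn).chainMap_f_single g hn hk)
  refine homologyMap_eq_of_homotopy _ _
    (fun k => ModuleCat.ofHom (homotopyMap hT hr δ n k ∘ₗ (T.contract.swiatPart n k).subtype)) ?_ ?_ k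
  -- A generator of degree `0` has no half-edges.
  · refine swiatPart_hom_ext fun g hn hk => ?_
    have hg : ∀ e b, g.st ⊥ ≠ .half e b := fun e b hg => by
      have : ⊥ ∈ g.active := Gen.mem_active.2 ⟨e, b, hg⟩
      rw [Finset.card_eq_zero.1 hk] at this
      simp at this
    refine (hA g hn hk).trans ((cubeChain_expand_of_not_half hT hr hδ hδ' hδn hn hk hg).trans ?_)
    refine (zero_add _).symm.trans (congrArg₂ _ ?_ rfl)
    change 0 = ((singChains (TopCat.of (UConf n Γ.Space))).d 1 0).hom
      (homotopyMap hT hr δ n 0 (Finsupp.single g 1))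
    rw [homotopyMap_single, homotopyGen_of_not_half hT hr hg, map_zero]
  · intro k
    refine swiatPart_hom_ext fun g hn hk => ?_
    refine (hA g hn hk).trans ((cubeChain_expand hT hr hδ hδ' hδn hn hk).trans ?_)
    rw [swiatComplex_d, ← swiatD_single]
    rfl

end Multigraph.Subgraph

/-! ### The map given by the span -/

/-- The inclusion of the configurations with at most `k` points in `W`, for `U ⊆ W`. -/
def UConfLE.restrict (n k : ℕ) {X : Type} [TopologicalSpace X] {U W : Set X} (h : U ⊆ W) :
    C(UConfLE n k X W, UConfLE n k X U) where
  toFun := Quotient.map (sa := ConfLE.setoid n k X W) (sb := ConfLE.setoid n k X U)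
    (fun x => ⟨x.1, x.2.1, (Set.ncard_le_ncard (t := {i | x.1 i ∈ W}) (fun _ hi => h hi)
      (Set.toFinite _)).trans x.2.2⟩)
    fun _ _ h => h
  continuous_toFun := Continuous.quotient_map' (Continuous.subtype_mk continuous_subtype_val _) _

theorem UConfLE.incl_comp_restrict (n k : ℕ) {X : Type} [TopologicalSpace X] {U W : Set X}
    (h : U ⊆ W) : (UConfLE.incl n k U).comp (UConfLE.restrict n k h) = UConfLE.incl n k W := by
  ext x
  obtain ⟨x, rfl⟩ := Quotient.exists_rep x
  rfl

namespace Multigraph.Subgraph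

variable {V E : Type} {Γ : Multigraph V E} [Fintype V] [LinearOrder V] [Fintype E] [DecidableEq E]
  {T : Γ.Subgraph} {r : V} (hT : T.IsTree) (hr : r ∈ T.verts) {n : ℕ} {ε δ : ℝ}

theorem nhdContract_mono (h : δ ≤ ε) : T.nhdContract δ ⊆ T.nhdContract ε :=
  Set.image_mono (nhd_mono h)

theorem expandConf_comp_restrict (hδ : 0 < δ) (hδ' : δ ≤ 1 / 2) (hδε : δ ≤ ε) (hε' : ε ≤ 1) :
    (expandConf hT hr hδ hδ').comp (UConfLE.restrict n 1 (nhdContract_mono hδε)) =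
      (UConfLE.incl n 1 (T.nhd ε)).comp
        (UConfLE.push n ((isExpansion_expansion hT hr hδ hδ' hδε hε').pushable hT.1)) := by
  ext x
  obtain ⟨x, rfl⟩ := Quotient.exists_rep x
  rfl

/-- The map given by the span, restricted to the configurations with at most one point in a
smaller neighbourhood, applies an expansion with small support to each point. -/
theorem spanMap_comp_incl (hδ : 0 < δ) (hδ2 : δ < 1 / 2) (hδε : δ ≤ ε) (hε : 0 < ε)
    (hε' : ε ≤ 1 / 2) (hloop : (∃ e ∉ T.edges, ∀ b, Γ.vert e b ∈ T.verts) → ε < 1 / 2)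
    {f : C(T.contract.Space, Γ.Space)} (hf : T.IsExpansion ε f)
    (h : ContinuousMap.HomotopyEquiv (UConfLE n 1 T.contract.Space (T.nhdContract ε))
      (UConf n T.contract.Space)) (hh : h.toFun = UConfLE.incl n 1 (T.nhdContract ε)) :
    ((T.spanMap hT hf n h).comp (UConfLE.incl n 1 (T.nhdContract δ))).Homotopic
      (expandConf hT hr hδ hδ2.le) := by
  have hf₀ := isExpansion_expansion hT hr hδ hδ2.le hδε (by linarith)
  obtain ⟨-, -, h1⟩ := IsExpansion.isHomotopyEquiv_push hT.1 hε hε' hloop hf₀ hf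
    (pushHomotopic_expansion hT hr hδ hδ2.le hδε (by linarith)) n
  obtain ⟨-, h', hh'⟩ := isHomotopyEquiv_incl hT.1 hδ hδ2.le (fun _ => hδ2) n
  -- Both are homotopy inverses of inclusions into the same space.
  have h2 : ((UConfLE.restrict n 1 (nhdContract_mono hδε)).comp h.invFun).Homotopic h'.invFun := by
    have e1 := h'.left_inv.comp (.refl ((UConfLE.restrict n 1 (nhdContract_mono hδε)).comp h.invFun))
    have e2 := (ContinuousMap.Homotopic.refl h'.invFun).comp h.right_inv
    rw [hh, ← UConfLE.incl_comp_restrict n 1 (nhdContract_mono hδε), ← hh'] at e2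
    exact e1.symm.trans e2
  have h3 : (T.spanMap hT hf n h).Homotopic ((expandConf hT hr hδ hδ2.le).comp h'.invFun) := by
    refine ((ContinuousMap.Homotopic.refl (UConfLE.incl n 1 (T.nhd ε))).comp
      (h1.comp (.refl h.invFun))).trans ?_
    rw [← ContinuousMap.comp_assoc, ← expandConf_comp_restrict hT hr hδ hδ2.le hδε (by linarith),
      ContinuousMap.comp_assoc]
    exact (ContinuousMap.Homotopic.refl _).comp h2
  have h4 := (ContinuousMap.Homotopic.refl (expandConf hT hr hδ hδ2.le)).comp h'.left_inv
  rw [hh'] at h4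
  exact (h3.comp (.refl (UConfLE.incl n 1 (T.nhdContract δ)))).trans h4

/-- The map given by the span realizes the contraction on homology. -/
theorem homologyMap_spanMap (hε : 0 < ε) (hε' : ε ≤ 1 / 2)
    (hloop : (∃ e ∉ T.edges, ∀ b, Γ.vert e b ∈ T.verts) → ε < 1 / 2)
    {f : C(T.contract.Space, Γ.Space)} (hf : T.IsExpansion ε f)
    (h : ContinuousMap.HomotopyEquiv (UConfLE n 1 T.contract.Space (T.nhdContract ε))
      (UConf n T.contract.Space)) (hh : h.toFun = UConfLE.incl n 1 (T.nhdContract ε)) (k : ℕ) :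
    HomologicalComplex.homologyMap (T.contract.swiatToSing n) k ≫
        HomologicalComplex.homologyMap (singMap (T.spanMap hT hf n h)) k =
      HomologicalComplex.homologyMap (T.contractChain hT hr n) k ≫
        HomologicalComplex.homologyMap (Γ.swiatToSing n) k := by
  -- Away from the half-edges at `⊥`, the gaps of the cubes have length at least `1 / (n + 1)`.
  obtain ⟨δ, hδ, hδε, hδ2, hδn⟩ : ∃ δ : ℝ, 0 < δ ∧ δ ≤ ε ∧ δ < 1 / 2 ∧ δ < 1 / ((n : ℝ) + 1) := by
    have hn : (0 : ℝ) ≤ n := n.cast_nonneg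
    refine ⟨min ε (1 / (n + 3)), lt_min hε (by positivity), min_le_left _ _,
      (min_le_right _ _).trans_lt ?_, (min_le_right _ _).trans_lt ?_⟩
    · exact one_div_lt_one_div_of_lt (by norm_num) (by linarith)
    · exact one_div_lt_one_div_of_lt (by linarith) (by linarith)
  rw [← nearCubes_chainMap hδ hδ2.le hδn, HomologicalComplex.homologyMap_comp, Category.assoc,
    ← HomologicalComplex.homologyMap_comp (singMap _) (singMap _), ← singMap_comp,
    homologyMap_singMap_eq (spanMap_comp_incl hT hr hδ hδ2 hδε hε hε' hloop hf h hh),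
    ← HomologicalComplex.homologyMap_comp, ← HomologicalComplex.homologyMap_comp]
  exact homologyMap_nearCubes hT hr hδ hδ2.le hδn k

end Multigraph.Subgraph

end

end SubtreeContraction

theorem corollary3p2 {V E : Type} [Fintype V] [LinearOrder V] [Fintype E] [DecidableEq E]
    (Γ : Multigraph V E) (T : Γ.Subgraph) (hT : T.IsTree) (ε : ℝ) (hε : 0 < ε) (hε' : ε ≤ 1 / 2)
    (hloop : (∃ e ∉ T.edges, ∀ b, Γ.vert e b ∈ T.verts) → ε < 1 / 2) (n : ℕ) :
    -- the map `f : Γ / T → Γ` exists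
    (∃ f, T.IsExpansion ε f) ∧
    -- the contraction restricts to the reduced complexes, where it does not depend on `r`
    (∀ r ∈ T.verts, ∀ r' ∈ T.verts, ∀ c ∈ T.contract.reducedSwiat,
      T.swiatContract r c ∈ Γ.reducedSwiat ∧ T.swiatContract r c = T.swiatContract r' c) ∧
    -- the first map of the span is a homotopy equivalence
    IsHomotopyEquiv (ConfLE.incl n 1 (T.nhdContract ε)) ∧
    IsHomotopyEquiv (UConfLE.incl n 1 (T.nhdContract ε)) ∧
    ∀ (f : C(T.contract.Space, Γ.Space)) (hf : T.IsExpansion ε f),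
      -- the second map of the span is a homotopy equivalence
      IsHomotopyEquiv (ConfLE.push n (hf.pushable hT.1)) ∧
      IsHomotopyEquiv (UConfLE.push n (hf.pushable hT.1)) ∧
      -- the resulting map induces the contraction map on homology
      ∀ h : ContinuousMap.HomotopyEquiv (UConfLE n 1 T.contract.Space (T.nhdContract ε))
          (UConf n T.contract.Space),
        h.toFun = UConfLE.incl n 1 (T.nhdContract ε) →
        ∀ (r : V) (hr : r ∈ T.verts) (k : ℕ),
          HomologicalComplex.homologyMap (T.contract.swiatToSing n) k ≫
              HomologicalComplex.homologyMap (singMap (T.spanMap hT hf n h)) k =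
            HomologicalComplex.homologyMap (T.contractChain hT hr n) k ≫
              HomologicalComplex.homologyMap (Γ.swiatToSing n) k := by
  obtain ⟨r₀, hr₀⟩ := hT.1
  have hε1 : ε ≤ 1 := by linarith
  have hf₀ := Multigraph.Subgraph.isExpansion_expansion hT hr₀ hε hε' le_rfl hε1
  obtain ⟨h3, h3'⟩ := Multigraph.Subgraph.isHomotopyEquiv_incl hT.1 hε hε' hloop n
  refine ⟨⟨_, hf₀⟩, fun r hr r' hr' c hc => Multigraph.Subgraph.swiatContract_reduced hT hr hr' c hc,
    h3, h3', fun f hf => ?_⟩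
  obtain ⟨h4, h4', -⟩ := Multigraph.Subgraph.IsExpansion.isHomotopyEquiv_push hT.1 hε hε' hloop hf₀
    hf (Multigraph.Subgraph.pushHomotopic_expansion hT hr₀ hε hε' le_rfl hε1) n
  exact ⟨h4, h4', fun h hh r hr k =>
    Multigraph.Subgraph.homologyMap_spanMap hT hr hε hε' hloop hf h hh k⟩
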